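/- Let $n\ge 1$ be an integer, let $d,\delta\in\mathbb{R}$ with $\delta>0$, and let $Q$ be a nonzero polynomial on $\mathbb{R}^n$ (with complex coefficients) of total degree $m$. Let $f\in L^2(\mathbb{R}^n)$ be complex-valued, and let $\widehat f\in L^2(\mathbb{R}^n)$ be its Fourier transform, normalized by $\widehat f(y)=\int_{\mathbb{R}^n} f(x)e^{-i x\cdot y}\,dx$ for $f\in L^1\cap L^2$ and extended to $L^2(\mathbb{R}^n)$ by continuity. Write $|\cdot|$ for the Euclidean norm on $\mathbb{R}^n$ and the modulus on $\mathbb{C}$. Suppose that $$\int_{\mathbb{R}^n}\int_{\mathbb{R}^n}\frac{|f(x)|\,|\widehat f(y)|\,e^{|x||y|}\,|Q(y)|^{\delta}}{(1+|x|+|y|)^{d}}\,dx\,dy<\infty .$$ Then there are a real number $a>0$ and a polynomial $P$ on $\mathbb{R}^n$ (with complex coefficients) such that $f(x)=P(x)e^{-a|x|^2}$ for almost every $x\in\mathbb{R}^n$ and $$\deg P<\frac{d-n-m\delta}{2},$$ where $\deg P$ is the total degree and the zero polynomial has degree $-\infty$ (so $f=0$ almost everywhere if $d\le n+m\delta$).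 -/

import Mathlib

open MeasureTheory FourierTransform

noncomputable section

/-- The Fourier transform of an `L²` function on `ℝⁿ`, in the normalization
`f̂(y) = ∫ f(x) e^{-i x·y} dx`, extended to `L²` by Plancherel. Mathlib's `L²` transform `𝓕` uses
the kernel `e^{-2πi x·ξ}`, so `f̂(y) = (𝓕 f)(y / 2π)`. The result is a representative, determined
up to a null set. -/
def l2Fourier {n : ℕ} (f : EuclideanSpace ℝ (Fin n) → ℂ) (hf : MemLp f 2 volume)
    (y : EuclideanSpace ℝ (Fin n)) : ℂ :=
  (𝓕 (hf.toLp f : Lp ℂ 2 (volume : Measure (EuclideanSpace ℝ (Fin n)))) :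
    Lp ℂ 2 (volume : Measure (EuclideanSpace ℝ (Fin n)))) ((2 * Real.pi)⁻¹ • y)

/-- The value at a point of `ℝⁿ` of a polynomial in `n` variables with complex coefficients. -/
def polyValue {n : ℕ} (P : MvPolynomial (Fin n) ℂ) (x : EuclideanSpace ℝ (Fin n)) : ℂ :=
  MvPolynomial.eval (fun i => (x i : ℂ)) P

end

/-! Write t(x) = ⟪v, x⟫ for a direction v. If f is not zero, a point y with |y| > c and f̂(y)Q(y) ≠
0 at which the inner integral is finite bounds ∫|f(x)|e^{c|x|}dx. Hence f has all exponential
moments, and G(z) = ∫ f(x) e^{-iz t(x)} dx is an entire function extending r ↦ f̂(rv). Integrating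
the hypothesis over lines through the origin shows that, for almost every v,
|f(x)||G(r)|e^{|v||x||r|} is integrable in (x, r) after division by powers of 1+|v||x| and 1+|r|.

One-dimensional core. Put m(s) = ∫|f|e^{s|t|}, a majorant of |G| on |z| = s. Damping f by e^{-εt²}
preserves the integral condition up to powers and makes G of order two; then ∫₀^R |G(±s)| m(s) ds
grows polynomially. So the primitive of G(u)G(iu) has polynomial growth on the axes (approached by
slightly narrower sectors), and Phragmén–Lindelöf makes it a polynomial. Thus G(z)G(iz) is a
polynomial, G is a polynomial times the exponential of a quadratic, and the linear term of the
exponent must vanish because only the quadratic one cancels in the product. The degree bound does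
not depend on ε, so the form survives ε → 0. See `exists_polynomial_mul_rotate`,
`exists_polynomial_mul_gaussian`, `exists_laplace_eq_polynomial_mul_gaussian`.

Gluing the lines. The weight on the line of v is radial in x, so the moments it controls bound the
transform on every other line. This forces the exponents to be real and equal to -a|y|² with one a
(`re_mul_sq_le`, `exists_gaussian_on_lines`); a > 0 by Riemann–Lebesgue. Then f̂(y)e^{a|y|²} is
smooth and a polynomial of bounded degree on almost every line, so it is its own Taylor polynomial H
(`exists_polyValue_of_lines`). Fourier inversion gives f = P e^{-|x|²/4a} with deg P ≤ deg H.

Degree bound. The exponentials cancel near x = 2ay, where the integrand is of size |y|^{deg P + deg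
H + mδ - d} in a cone of directions. Convergence forces n + deg P + deg H + mδ - d < 0, and deg P ≤
deg H finishes. -/

namespace Beurling

open Complex Set Filter Topology Metric
open scoped Real ENNReal RealInnerProductSpace

/-! ### Polynomial growth and Phragmén–Lindelöf in a sector -/

/-- An entire function of polynomial growth is a polynomial. -/
theorem exists_polynomial_of_growth {H : ℂ → ℂ} (hH : Differentiable ℂ H) {C : ℝ} {N : ℕ}
    (hC : ∀ z, ‖H z‖ ≤ C * (1 + ‖z‖) ^ N) :
    ∃ p : Polynomial ℂ, p.natDegree ≤ N ∧ ∀ z, H z = p.eval z := by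
  have hder : ∀ k, N < k → iteratedDeriv k H 0 = 0 := by
    intro k hk
    have hbound : ∀ᶠ R : ℝ in atTop, ‖iteratedDeriv k H 0‖ ≤ k.factorial * (C * 2 ^ N) * R⁻¹ := by
      filter_upwards [eventually_ge_atTop (1 : ℝ)] with R hR
      have hR0 : 0 < R := by linarith
      have hC0 : 0 ≤ C := by simpa using (norm_nonneg _).trans (hC 0)
      have h := norm_iteratedDeriv_le_of_forall_mem_sphere_norm_le (c := 0) (R := R)
        (C := C * (2 * R) ^ N) (f := H) k hR0 hH.diffContOnCl (fun z hz ↦ by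
          refine (hC z).trans ?_
          have : ‖z‖ = R := by simpa using hz
          rw [this]
          gcongr
          linarith)
      refine h.trans ?_
      rw [mul_pow, div_eq_mul_inv]
      have h1 : R ^ N * (R ^ k)⁻¹ ≤ R⁻¹ := by
        rw [← div_eq_mul_inv, div_le_iff₀ (by positivity), inv_mul_eq_div, le_div_iff₀ hR0,
          ← pow_succ]
        exact pow_le_pow_right₀ hR hk
      calc (k.factorial : ℝ) * (C * (2 ^ N * R ^ N)) * (R ^ k)⁻¹
          = k.factorial * (C * 2 ^ N) * (R ^ N * (R ^ k)⁻¹) := by ring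
        _ ≤ _ := by gcongr
    have hlim : Tendsto (fun R : ℝ ↦ k.factorial * (C * 2 ^ N) * R⁻¹) atTop (𝓝 0) := by
      simpa using tendsto_inv_atTop_zero.const_mul ((k.factorial : ℝ) * (C * 2 ^ N))
    exact norm_le_zero_iff.1 (ge_of_tendsto hlim hbound)
  refine ⟨∑ k ∈ Finset.range (N + 1),
    Polynomial.monomial k ((k.factorial : ℂ)⁻¹ * iteratedDeriv k H 0), ?_, fun z ↦ ?_⟩
  · refine Polynomial.natDegree_sum_le_of_forall_le _ _ fun k hk ↦ ?_
    exact (Polynomial.natDegree_monomial_le _).trans (by simpa [Nat.lt_succ_iff] using hk)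
  · have h := hasSum_taylorSeries_of_entire hH 0 z
    rw [← h.tsum_eq, tsum_eq_sum (s := Finset.range (N + 1))]
    · simp only [Polynomial.eval_finsetSum, Polynomial.eval_monomial, sub_zero, smul_eq_mul]
      exact Finset.sum_congr rfl fun k _ ↦ by ring
    · intro k hk
      rw [hder k (by simpa using hk)]
      simp

/-- This lets (1+z)^N, holomorphic and zero-free on the closed right half-plane, stand in for
(1+|z|)^N. -/
theorem one_add_norm_le_two_mul_norm_one_add {z : ℂ} (hz : 0 ≤ z.re) :
    1 + ‖z‖ ≤ 2 * ‖1 + z‖ := by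
  have h1 : ‖z‖ ≤ ‖1 + z‖ := by
    rw [← sq_le_sq₀ (norm_nonneg _) (norm_nonneg _), ← normSq_eq_norm_sq, ← normSq_eq_norm_sq,
      normSq_apply, normSq_apply]
    simp
    nlinarith
  have h2 : 1 ≤ ‖1 + z‖ := by
    refine le_trans ?_ (re_le_norm _)
    simpa using hz
  linarith

/-- Phragmén–Lindelöf in the sector `α ≤ arg z ≤ π / 2` for entire functions of order two. -/
theorem sector_bound {K : ℂ → ℂ} (hK : Differentiable ℂ K) {B C M : ℝ} {N : ℕ}
    (hgrowth : ∀ z, ‖K z‖ ≤ C * Real.exp (B * ‖z‖ ^ 2)) {α : ℝ} (hα : 0 < α) (hα' : α < π / 2)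
    (h1 : ∀ s : ℝ, 0 ≤ s → ‖K (s * exp (α * I))‖ ≤ M * (1 + s) ^ N)
    (h2 : ∀ s : ℝ, 0 ≤ s → ‖K (s * I)‖ ≤ M * (1 + s) ^ N)
    {r β : ℝ} (hr : 0 < r) (hβ : α ≤ β) (hβ' : β ≤ π / 2) :
    ‖K (r * exp (β * I))‖ ≤ M * 2 ^ N * (1 + r) ^ N := by
  have hM : 0 ≤ M := by simpa using (norm_nonneg _).trans (h1 0 le_rfl)
  have hC : 0 ≤ C := by simpa using (norm_nonneg _).trans (hgrowth 0)
  have hre : ∀ ζ : ℂ, α ≤ ζ.im → ζ.im ≤ π / 2 → 0 ≤ (exp ζ).re := fun ζ ha hb ↦ by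
    rw [exp_re]
    exact mul_nonneg (Real.exp_pos _).le
      (Real.cos_nonneg_of_neg_pi_div_two_le_of_le (by linarith) hb)
  have hge : ∀ ζ : ℂ, α ≤ ζ.im → ζ.im ≤ π / 2 → 1 + ‖exp ζ‖ ≤ 2 * ‖1 + exp ζ‖ :=
    fun ζ ha hb ↦ one_add_norm_le_two_mul_norm_one_add (hre ζ ha hb)
  have hpos : ∀ ζ : ℂ, α ≤ ζ.im → ζ.im ≤ π / 2 → 0 < ‖1 + exp ζ‖ := fun ζ ha hb ↦ by
    have := hge ζ ha hb
    have := norm_nonneg (exp ζ)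
    linarith
  have hquot : ∀ ζ : ℂ, α ≤ ζ.im → ζ.im ≤ π / 2 → ‖K (exp ζ)‖ ≤ M * (1 + ‖exp ζ‖) ^ N →
      ‖K (exp ζ) / (1 + exp ζ) ^ N‖ ≤ M * 2 ^ N := fun ζ ha hb hz ↦ by
    rw [norm_div, norm_pow, div_le_iff₀ (pow_pos (hpos ζ ha hb) _), mul_assoc, ← mul_pow]
    refine hz.trans ?_
    gcongr
    exact hge ζ ha hb
  have hcl : closure (im ⁻¹' Ioo α (π / 2)) ⊆ im ⁻¹' Icc α (π / 2) :=
    closure_minimal (preimage_mono Ioo_subset_Icc_self) (isClosed_Icc.preimage continuous_im)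
  -- In the coordinate ζ = log z the sector is a horizontal strip. Dividing by (1+z)^N turns the
  -- polynomial bounds on the edges into constant ones, at the cost of a factor 2^N.
  have key := PhragmenLindelof.horizontal_strip (f := fun ζ ↦ K (exp ζ) / (1 + exp ζ) ^ N)
    (a := α) (b := π / 2) (C := M * 2 ^ N) (z := Real.log r + β * I) ?_ ?_ ?_ ?_ ?_ ?_
  · have hz : exp ((Real.log r : ℂ) + β * I) = r * exp (β * I) := by
      rw [exp_add, ← ofReal_exp, Real.exp_log hr]
    rw [hz, norm_div, norm_pow, div_le_iff₀] at key
    · refine key.trans ?_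
      gcongr
      refine (norm_add_le _ _).trans ?_
      simp [norm_exp_ofReal_mul_I, abs_of_pos hr]
    · have := hpos (Real.log r + β * I) (by simpa using hβ) (by simpa using hβ')
      rw [hz] at this
      positivity
  · refine DifferentiableOn.diffContOnCl fun ζ hζ ↦ ?_
    have hζ' := hcl hζ
    refine DifferentiableAt.differentiableWithinAt ?_
    refine ((hK _).comp ζ differentiable_exp.differentiableAt).div (by fun_prop) ?_
    exact pow_ne_zero _ (norm_pos_iff.1 (hpos ζ hζ'.1 hζ'.2))
  -- Order two is admissible only because the opening π/2 - α is strictly smaller than π/2: this is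
  -- where α > 0 is needed.
  · refine ⟨2, ?_, |B|, ?_⟩
    · rw [lt_div_iff₀ (by linarith)]
      linarith
    · refine Asymptotics.IsBigO.of_bound (C * 2 ^ N) ?_
      filter_upwards [mem_inf_of_right (mem_principal_self _)] with ζ hζ
      have h3 := hge ζ hζ.1.le hζ.2.le
      have h4 := hpos ζ hζ.1.le hζ.2.le
      rw [norm_div, norm_pow, div_le_iff₀ (by positivity), Real.norm_of_nonneg (Real.exp_pos _).le]
      have h5 : B * ‖exp ζ‖ ^ 2 ≤ |B| * Real.exp (2 * |ζ.re|) := by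
        rw [norm_exp, ← Real.exp_nat_mul]
        refine mul_le_mul (le_abs_self B) ?_ (by positivity) (by positivity)
        refine Real.exp_le_exp.2 ?_
        push_cast
        linarith [le_abs_self ζ.re]
      have h6 : 1 ≤ 2 * ‖1 + exp ζ‖ := by
        have := norm_nonneg (exp ζ)
        linarith
      calc ‖K (exp ζ)‖ ≤ C * Real.exp (|B| * Real.exp (2 * |ζ.re|)) :=
            (hgrowth _).trans (by gcongr)
        _ ≤ C * Real.exp (|B| * Real.exp (2 * |ζ.re|)) * (2 * ‖1 + exp ζ‖) ^ N :=
            le_mul_of_one_le_right (by positivity) (one_le_pow₀ h6)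
        _ = _ := by rw [mul_pow]; ring
  · intro ζ hζ
    refine hquot ζ hζ.ge (hζ.trans_le hα'.le) ?_
    have h := h1 (Real.exp ζ.re) (Real.exp_pos _).le
    rw [ofReal_exp, ← exp_add, ← hζ, re_add_im] at h
    rwa [norm_exp]
  · intro ζ hζ
    refine hquot ζ (hα'.le.trans hζ.ge) hζ.le ?_
    have h := h2 (Real.exp ζ.re) (Real.exp_pos _).le
    have h7 : (Real.exp ζ.re : ℂ) * I = exp ζ := by
      conv_rhs => rw [← re_add_im ζ, exp_add, hζ]
      rw [ofReal_exp]
      push_cast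
      rw [exp_pi_div_two_mul_I]
    rw [h7] at h
    rwa [norm_exp]
  · simpa using hβ
  · simpa using hβ'

/-! ### The product G(z)G(iz) is a polynomial -/

/-- The primitive vanishing at the origin of an entire function. -/
noncomputable def primitive (H : ℂ → ℂ) (z : ℂ) : ℂ := ∫ t in (0 : ℝ)..1, z * H (t * z)

theorem hasDerivAt_primitive {H : ℂ → ℂ} (hH : Differentiable ℂ H) (z : ℂ) :
    HasDerivAt (primitive H) (H z) z := by
  obtain ⟨Φ, hΦ⟩ := hH.isExactOn_univ
  have h : primitive H = fun z ↦ Φ z - Φ 0 := by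
    ext w
    have hd : ∀ t ∈ uIcc (0 : ℝ) 1, HasDerivAt (fun t : ℝ ↦ Φ (t * w)) (w * H (t * w)) t := by
      intro t _
      have h1 : HasDerivAt (fun t : ℝ ↦ (t : ℂ) * w) w t := by
        simpa using (ofRealCLM.hasDerivAt (x := t)).mul_const w
      have h2 := (hΦ (t * w) (mem_univ _)).comp t h1
      rw [mul_comm (H _) w] at h2
      exact h2
    have hc : Continuous H := hH.continuous
    have := intervalIntegral.integral_eq_sub_of_hasDerivAt hd
      (Continuous.intervalIntegrable (by fun_prop) _ _)
    simpa [primitive] using this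
  rw [h]
  exact (hΦ z (mem_univ _)).sub_const _

theorem primitive_mul_left (H : ℂ → ℂ) (c w : ℂ) :
    primitive H (c * w) = c * primitive (fun u ↦ H (c * u)) w := by
  simp only [primitive, ← intervalIntegral.integral_const_mul]
  congr 1
  ext t
  rw [mul_left_comm (t : ℂ) c w]
  ring

theorem norm_primitive_ray_le {H : ℂ → ℂ} (hH : Continuous H) {u : ℂ} (hu : ‖u‖ = 1) {s : ℝ}
    (hs : 0 ≤ s) {g : ℝ → ℝ} (hg : IntervalIntegrable g volume 0 s)
    (hle : ∀ x : ℝ, 0 ≤ x → ‖H (x * u)‖ ≤ g x) :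
    ‖primitive H (s * u)‖ ≤ ∫ x in (0 : ℝ)..s, g x := by
  calc ‖primitive H (s * u)‖
      ≤ ∫ t in (0 : ℝ)..1, ‖s * u * H (t * (s * u))‖ :=
        intervalIntegral.norm_integral_le_integral_norm zero_le_one
    _ = s * ∫ t in (0 : ℝ)..1, ‖H ((t * s : ℝ) * u)‖ := by
        rw [← intervalIntegral.integral_const_mul]
        congr 1
        ext t
        rw [norm_mul, norm_mul, hu, norm_real, Real.norm_of_nonneg hs, mul_one]
        push_cast
        rw [mul_assoc (t : ℂ)]
    _ = ∫ x in (0 : ℝ)..s, ‖H (x * u)‖ := by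
        have := intervalIntegral.smul_integral_comp_mul_right (a := 0) (b := 1)
          (fun x : ℝ ↦ ‖H (x * u)‖) s
        simpa using this
    _ ≤ _ := by
        refine intervalIntegral.integral_mono_on hs
          (Continuous.intervalIntegrable (by fun_prop) _ _) hg fun x hx ↦ hle x hx.1

/-- If `A` and `B` are entire of order two and their product with a majorant `m` has polynomially
growing integrals over the real half-lines, then so does the primitive of `A(u) B(iu)` in
the first quadrant. -/
theorem norm_primitive_le_of_quadrant {A B : ℂ → ℂ} (hA : Differentiable ℂ A)
    (hB : Differentiable ℂ B) {m : ℝ → ℝ} (hm : Monotone m) (hAm : ∀ z, ‖A z‖ ≤ m ‖z‖)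
    (hBm : ∀ z, ‖B z‖ ≤ m ‖z‖) {C b M : ℝ} {N : ℕ}
    (hgrowth : ∀ z : ℂ, m ‖z‖ ≤ C * Real.exp (b * ‖z‖ ^ 2))
    (hAM : ∀ R : ℝ, 0 ≤ R → ∫ s in (0 : ℝ)..R, ‖A s‖ * m s ≤ M * (1 + R) ^ N)
    (hBM : ∀ R : ℝ, 0 ≤ R → ∫ s in (0 : ℝ)..R, ‖B (-s)‖ * m s ≤ M * (1 + R) ^ N)
    {z : ℂ} (hre : 0 ≤ z.re) (him : 0 ≤ z.im) :
    ‖primitive (fun u ↦ A u * B (I * u)) z‖ ≤ M * 2 ^ N * (1 + ‖z‖) ^ N := by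
  have hAc : Continuous A := hA.continuous
  have hBc : Continuous B := hB.continuous
  have hM : 0 ≤ M := by simpa using hAM 0 le_rfl
  have hm0 : ∀ s, 0 ≤ s → 0 ≤ m s := fun s hs ↦ by
    simpa [abs_of_nonneg hs] using (norm_nonneg _).trans (hAm s)
  have hC : 0 ≤ C := by simpa using (norm_nonneg _).trans ((hAm 0).trans (hgrowth 0))
  have hAi : ∀ R, IntervalIntegrable (fun s : ℝ ↦ ‖A s‖ * m s) volume 0 R := fun R ↦
    (hm.intervalIntegrable).continuousOn_mul (by fun_prop)
  have hBi : ∀ R, IntervalIntegrable (fun s : ℝ ↦ ‖B (-s)‖ * m s) volume 0 R := fun R ↦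
    (hm.intervalIntegrable).continuousOn_mul (by fun_prop)
  -- On the ray arg u = α the rotated factor A is evaluated at real points and B is bounded by m; on
  -- the imaginary ray the roles are exchanged. Both edges of a sector of opening less than π/2 thus
  -- carry the given integral bounds.
  set H : ℝ → ℂ → ℂ := fun α u ↦ A (exp (-α * I) * u) * B (I * u) with hH
  have hHd : ∀ α, Differentiable ℂ (H α) := fun α ↦
    (hA.comp (by fun_prop)).mul (hB.comp (by fun_prop))
  have hunit : ∀ α : ℝ, ‖exp (α * I)‖ = 1 := norm_exp_ofReal_mul_I
  have hunit' : ∀ α : ℝ, ‖exp (-α * I)‖ = 1 := fun α ↦ by simpa using hunit (-α)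
  have hray1 : ∀ α : ℝ, ∀ s : ℝ, 0 ≤ s →
      ‖primitive (H α) (s * exp (α * I))‖ ≤ M * (1 + s) ^ N := by
    intro α s hs
    refine (norm_primitive_ray_le (hHd α).continuous (hunit α) hs (hAi s) fun x hx ↦ ?_).trans
      (hAM s hs)
    have h1 : exp (-α * I) * (x * exp (α * I)) = x := by
      rw [mul_left_comm, ← exp_add]
      simp
    simp only [hH, h1, norm_mul]
    gcongr
    refine (hBm _).trans_eq ?_
    rw [norm_mul, norm_mul, hunit, norm_I, norm_real, Real.norm_of_nonneg hx, one_mul, mul_one]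
  have hray2 : ∀ α : ℝ, ∀ s : ℝ, 0 ≤ s → ‖primitive (H α) (s * I)‖ ≤ M * (1 + s) ^ N := by
    intro α s hs
    refine (norm_primitive_ray_le (hHd α).continuous norm_I hs (hBi s) fun x hx ↦ ?_).trans
      (hBM s hs)
    have h1 : I * (x * I) = -x := by
      rw [mul_left_comm, I_mul_I]
      simp
    simp only [hH, h1, norm_mul]
    rw [mul_comm]
    gcongr
    refine (hAm _).trans_eq ?_
    rw [norm_mul, norm_mul, hunit', norm_I, norm_real, Real.norm_of_nonneg hx, one_mul, mul_one]
  have hgr : ∀ α : ℝ, ∀ w : ℂ,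
      ‖primitive (H α) w‖ ≤ C ^ 2 * Real.exp ((2 * b + 1) * ‖w‖ ^ 2) := by
    intro α w
    have h1 : ∀ t ∈ uIoc (0 : ℝ) 1,
        ‖w * H α (t * w)‖ ≤ ‖w‖ * (C * Real.exp (b * ‖w‖ ^ 2)) ^ 2 := by
      intro t ht
      rw [uIoc_of_le zero_le_one] at ht
      have h2 : ‖(t : ℂ) * w‖ ≤ ‖w‖ := by
        rw [norm_mul, norm_real, Real.norm_of_nonneg ht.1.le]
        exact mul_le_of_le_one_left (norm_nonneg _) ht.2
      have h3 : ∀ c : ℂ, ‖c‖ = 1 → m ‖c * (t * w)‖ ≤ C * Real.exp (b * ‖w‖ ^ 2) := by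
        intro c hc
        rw [norm_mul, hc, one_mul]
        exact (hm h2).trans (hgrowth w)
      rw [norm_mul, norm_mul, sq]
      have h4 := (hAm _).trans (h3 _ (hunit' α))
      have h5 := (hBm _).trans (h3 _ norm_I)
      gcongr
    refine (intervalIntegral.norm_integral_le_of_norm_le_const h1).trans ?_
    have h6 : ‖w‖ ≤ Real.exp (‖w‖ ^ 2) := by
      nlinarith [Real.add_one_le_exp (‖w‖ ^ 2), sq_nonneg (‖w‖ - 1 / 2)]
    calc _ = C ^ 2 * (‖w‖ * Real.exp (2 * (b * ‖w‖ ^ 2))) := by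
          rw [mul_pow, ← Real.exp_nat_mul]
          simp
          ring
      _ ≤ C ^ 2 * (Real.exp (‖w‖ ^ 2) * Real.exp (2 * (b * ‖w‖ ^ 2))) := by gcongr
      _ = _ := by
          rw [← Real.exp_add]
          ring_nf
  have hH0 : H 0 = fun u ↦ A u * B (I * u) := by simp [hH]
  rw [← hH0]
  rcases eq_or_ne z 0 with rfl | hz
  · simp [primitive]
    positivity
  have hzpos : 0 < ‖z‖ := norm_pos_iff.2 hz
  have hzeq : (‖z‖ : ℂ) * exp (arg z * I) = z := norm_mul_exp_arg_mul_I z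
  have harg1 : arg z ≤ π / 2 := arg_le_pi_div_two_iff.2 (Or.inl hre)
  rcases (arg_nonneg_iff.2 him).eq_or_lt with h0 | hpos
  · have := hray1 0 ‖z‖ hzpos.le
    rw [← h0] at hzeq
    rw [hzeq] at this
    refine this.trans ?_
    gcongr
    exact le_mul_of_one_le_right hM (one_le_pow₀ one_le_two)
  · have hcont : Continuous fun α : ℝ ↦ ‖primitive (H α) z‖ := by
      refine Continuous.norm ?_
      simp only [primitive, hH]
      exact intervalIntegral.continuous_parametric_intervalIntegral_of_continuous' (by fun_prop) _ _
    -- The sector bound is uniform in α, so it passes to the limit α → 0⁺. The positive real ray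
    -- lies in none of these sectors, hence its separate treatment.
    refine le_of_tendsto (hcont.continuousWithinAt (s := Ioi 0) (x := 0)).tendsto ?_
    filter_upwards [Ioo_mem_nhdsGT (show (0 : ℝ) < min (arg z) (π / 4) by
      have := Real.pi_pos
      positivity)] with α hα
    have hα2 := hα.2.trans_le (min_le_left _ _)
    have hα3 := hα.2.trans_le (min_le_right _ _)
    have := sector_bound (K := primitive (H α))
      (fun w ↦ (hasDerivAt_primitive (hHd α) w).differentiableAt) (hgr α) hα.1
      (by linarith [Real.pi_pos]) (hray1 α) (hray2 α) hzpos hα2.le harg1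
    rwa [hzeq] at this

/-- The polynomial identity at the heart of Beurling's theorem. -/
theorem exists_polynomial_mul_rotate {G : ℂ → ℂ} (hG : Differentiable ℂ G) {m : ℝ → ℝ}
    (hm : Monotone m) (hGm : ∀ z, ‖G z‖ ≤ m ‖z‖) {C b M : ℝ} {N : ℕ}
    (hgrowth : ∀ z : ℂ, m ‖z‖ ≤ C * Real.exp (b * ‖z‖ ^ 2))
    (hM1 : ∀ R : ℝ, 0 ≤ R → ∫ s in (0 : ℝ)..R, ‖G s‖ * m s ≤ M * (1 + R) ^ N)
    (hM2 : ∀ R : ℝ, 0 ≤ R → ∫ s in (0 : ℝ)..R, ‖G (-s)‖ * m s ≤ M * (1 + R) ^ N) :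
    ∃ p : Polynomial ℂ, p.natDegree ≤ N ∧ ∀ z, G z * G (I * z) = p.eval z := by
  set H : ℂ → ℂ := fun u ↦ G u * G (I * u) with hH
  have hHd : Differentiable ℂ H := hG.mul (hG.comp (by fun_prop))
  have hG' : Differentiable ℂ fun z ↦ G (-z) := hG.comp differentiable_neg
  have hGm' : ∀ z, ‖G (-z)‖ ≤ m ‖z‖ := fun z ↦ by simpa using hGm (-z)
  have hbound : ∀ z, ‖primitive H z‖ ≤ M * 2 ^ N * (1 + ‖z‖) ^ N := by
    -- A quarter turn carries each quadrant to the first one, and H becomes a product G(±u)G(±iu),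
    -- again within reach of the quadrant estimate.
    have hrot : ∀ c w : ℂ, ‖c‖ = 1 →
        ‖primitive (fun u ↦ H (c * u)) w‖ ≤ M * 2 ^ N * (1 + ‖w‖) ^ N →
        ‖primitive H (c * w)‖ ≤ M * 2 ^ N * (1 + ‖c * w‖) ^ N := by
      intro c w hc h
      rwa [primitive_mul_left, norm_mul, norm_mul, hc, one_mul, one_mul]
    intro z
    rcases le_total 0 z.re with hre | hre <;> rcases le_total 0 z.im with him | him
    · exact norm_primitive_le_of_quadrant hG hG hm hGm hGm hgrowth hM1 hM2 hre him
    · have hz : z = -I * (I * z) := by rw [← mul_assoc]; simp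
      rw [hz]
      refine hrot (-I) (I * z) (by simp) ?_
      have h1 : (fun u ↦ H (-I * u)) = fun u ↦ G u * G (-(I * u)) := by
        ext u
        simp only [hH, neg_mul, mul_neg, ← mul_assoc, I_mul_I, neg_neg, one_mul]
        ring
      rw [h1]
      exact norm_primitive_le_of_quadrant hG hG' hm hGm hGm' hgrowth hM1
        (by simpa using hM1) (by simpa using him) (by simpa using hre)
    · have hz : z = I * (-I * z) := by rw [← mul_assoc]; simp
      rw [hz]
      refine hrot I (-I * z) (by simp) ?_
      have h1 : (fun u ↦ H (I * u)) = fun u ↦ G (-u) * G (I * u) := by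
        ext u
        simp only [hH, ← mul_assoc, I_mul_I, neg_mul, one_mul]
        ring
      rw [h1]
      exact norm_primitive_le_of_quadrant hG' hG hm hGm' hGm hgrowth hM2 hM2
        (by simpa using him) (by simpa using hre)
    · have hz : z = -1 * (-z) := by simp
      rw [hz]
      refine hrot (-1) (-z) (by simp) ?_
      have h1 : (fun u ↦ H (-1 * u)) = fun u ↦ G (-u) * G (-(I * u)) := by
        ext u
        simp [hH]
      rw [h1]
      exact norm_primitive_le_of_quadrant hG' hG' hm hGm' hGm' hgrowth hM2
        (by simpa using hM1) (by simpa using hre) (by simpa using him)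
  obtain ⟨p, hp, hpe⟩ := exists_polynomial_of_growth
    (fun w ↦ (hasDerivAt_primitive hHd w).differentiableAt) hbound
  refine ⟨p.derivative, (Polynomial.natDegree_derivative_le p).trans (by omega), fun z ↦ ?_⟩
  have h1 := hasDerivAt_primitive hHd z
  rw [funext hpe] at h1
  exact h1.unique (p.hasDerivAt z)

/-! ### From the product identity to polynomial times Gaussian -/

theorem exists_norm_eval_le (p : Polynomial ℂ) :
    ∃ K : ℝ, 0 ≤ K ∧ ∀ z, ‖p.eval z‖ ≤ K * (1 + ‖z‖) ^ p.natDegree := by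
  refine ⟨∑ k ∈ Finset.range (p.natDegree + 1), ‖p.coeff k‖, by positivity, fun z ↦ ?_⟩
  rw [Polynomial.eval_eq_sum_range, Finset.sum_mul]
  refine norm_sum_le_of_le _ fun k hk ↦ ?_
  rw [norm_mul, norm_pow]
  have h1 : ‖z‖ ^ k ≤ (1 + ‖z‖) ^ k := by gcongr; linarith
  have h2 : (1 + ‖z‖) ^ k ≤ (1 + ‖z‖) ^ p.natDegree :=
    pow_le_pow_right₀ (by linarith [norm_nonneg z]) (by simpa [Nat.lt_succ_iff] using hk)
  gcongr
  exact h1.trans h2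

theorem exists_le_norm_eval {p : Polynomial ℂ} (hp : p ≠ 0) :
    ∃ c R : ℝ, 0 < c ∧ ∀ z : ℂ, R ≤ ‖z‖ → c ≤ ‖p.eval z‖ := by
  rcases Nat.eq_zero_or_pos p.natDegree with h0 | hpos
  · obtain ⟨a, rfl⟩ := Polynomial.natDegree_eq_zero.1 h0
    exact ⟨‖a‖, 0, by simpa using hp, fun z _ ↦ by simp⟩
  · have h := p.tendsto_norm_atTop (Polynomial.natDegree_pos_iff_degree_pos.1 hpos)
      (tendsto_norm_cobounded_atTop (E := ℂ))
    have h1 := h.eventually_ge_atTop 1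
    rw [← comap_norm_atTop, eventually_comap] at h1
    obtain ⟨R, hR⟩ := eventually_atTop.1 h1
    exact ⟨1, R, one_pos, fun z hz ↦ hR _ hz z rfl⟩

theorem eventually_pow_lt_exp {c κ : ℝ} (hc : 0 < c) (hκ : 0 < κ) (K : ℝ) {lam : ℝ} (hl : 0 ≤ lam)
    (N : ℕ) : ∀ᶠ s : ℝ in atTop, K * (1 + lam * s) ^ N < c * Real.exp (κ * s) := by
  have h := (isLittleO_pow_exp_pos_mul_atTop N hκ).bound
    (show 0 < c / ((|K| + 1) * (1 + lam) ^ N) by positivity)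
  filter_upwards [h, eventually_ge_atTop 1] with s hs hs1
  have hs0 : 0 ≤ s := by linarith
  rw [Real.norm_of_nonneg (by positivity), Real.norm_of_nonneg (by positivity), div_mul_eq_mul_div,
    le_div_iff₀ (by positivity)] at hs
  have h1 : (1 + lam * s) ^ N ≤ ((1 + lam) * s) ^ N := by
    gcongr
    nlinarith
  rw [mul_pow] at h1
  have h2 : 0 < (1 + lam) ^ N * s ^ N := by positivity
  calc K * (1 + lam * s) ^ N ≤ |K| * (1 + lam * s) ^ N := by gcongr; exact le_abs_self K
    _ ≤ |K| * ((1 + lam) ^ N * s ^ N) := by gcongr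
    _ < (|K| + 1) * ((1 + lam) ^ N * s ^ N) := by gcongr; linarith
    _ = s ^ N * ((|K| + 1) * (1 + lam) ^ N) := by ring
    _ ≤ _ := hs

/-- An entire divisor of a nonzero polynomial is a polynomial times a zero-free function. -/
theorem exists_polynomial_mul_zero_free {G B : ℂ → ℂ} (hG : Differentiable ℂ G)
    (hB : Continuous B) {p : Polynomial ℂ} (hp : p ≠ 0) (h : ∀ z, G z * B z = p.eval z) :
    ∃ (P : Polynomial ℂ) (G₁ : ℂ → ℂ), P ≠ 0 ∧ P.natDegree ≤ p.natDegree ∧ Differentiable ℂ G₁ ∧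
      (∀ z, G₁ z ≠ 0) ∧ ∀ z, G z = P.eval z * G₁ z := by
  induction hn : p.natDegree generalizing G p with
  | zero =>
    refine ⟨1, G, one_ne_zero, by simp, hG, fun z hz ↦ hp ?_, by simp⟩
    obtain ⟨a, rfl⟩ := Polynomial.natDegree_eq_zero.1 hn
    have := h z
    rw [hz, zero_mul, Polynomial.eval_C] at this
    rw [← this, Polynomial.C_0]
  | succ n ih =>
    by_cases hz : ∀ z, G z ≠ 0
    · exact ⟨1, G, one_ne_zero, by simp, hG, hz, by simp⟩
    push Not at hz
    obtain ⟨z₀, hz₀⟩ := hz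
    have hroot : p.IsRoot z₀ := by
      rw [Polynomial.IsRoot, ← h z₀, hz₀, zero_mul]
    obtain ⟨q, rfl⟩ := Polynomial.dvd_iff_isRoot.2 hroot
    have hq : q ≠ 0 := right_ne_zero_of_mul hp
    have hdeg : q.natDegree = n := by
      rw [Polynomial.natDegree_mul (Polynomial.X_sub_C_ne_zero _) hq,
        Polynomial.natDegree_X_sub_C] at hn
      omega
    have hD : Differentiable ℂ (dslope G z₀) := by
      rw [← differentiableOn_univ, differentiableOn_dslope univ_mem]
      exact hG.differentiableOn
    have hGD : ∀ z, G z = (z - z₀) * dslope G z₀ z := fun z ↦ by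
      have := sub_smul_dslope G z₀ z
      rw [smul_eq_mul, hz₀, sub_zero] at this
      exact this.symm
    -- Cancelling z - z₀ is legitimate off z₀; continuity of both sides supplies the missing point,
    -- so B need not be holomorphic.
    have hDB : ∀ z, dslope G z₀ z * B z = q.eval z := by
      have : (fun z ↦ dslope G z₀ z * B z) = fun z ↦ q.eval z := by
        refine Continuous.ext_on (dense_compl_singleton z₀) (hD.continuous.mul hB)
          q.continuous fun z hz ↦ ?_
        have h1 := h z
        rw [hGD, Polynomial.eval_mul, mul_assoc] at h1
        simp only [Polynomial.eval_sub, Polynomial.eval_X, Polynomial.eval_C] at h1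
        exact mul_left_cancel₀ (sub_ne_zero.2 hz) h1
      exact congrFun this
    obtain ⟨P, G₁, hP, hPd, hG₁, hne, heq⟩ := ih hD hq hDB hdeg
    refine ⟨(Polynomial.X - Polynomial.C z₀) * P, G₁,
      mul_ne_zero (Polynomial.X_sub_C_ne_zero _) hP, ?_, hG₁, hne, fun z ↦ ?_⟩
    · rw [Polynomial.natDegree_mul (Polynomial.X_sub_C_ne_zero _) hP,
        Polynomial.natDegree_X_sub_C]
      omega
    · rw [hGD z, heq z]
      simp [mul_assoc]

/-- A zero-free entire function of order two is the exponential of a quadratic polynomial. -/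
theorem exists_eq_exp_quadratic {G : ℂ → ℂ} (hG : Differentiable ℂ G) (h0 : ∀ z, G z ≠ 0) {C b : ℝ}
    (hb : 0 ≤ b) (hgrowth : ∀ z, ‖G z‖ ≤ C * Real.exp (b * ‖z‖ ^ 2)) :
    ∃ q : Polynomial ℂ, q.natDegree ≤ 2 ∧ ∀ z, G z = exp (q.eval z) := by
  have hC : 0 < C := by
    have := (norm_pos_iff.2 (h0 0)).trans_le (hgrowth 0)
    simpa using this
  have hdG : Differentiable ℂ (deriv G) := by
    rw [← differentiableOn_univ]
    exact hG.differentiableOn.deriv isOpen_univ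
  -- A primitive of G'/G is a logarithm of G up to a constant. The growth of G bounds its real part
  -- from above, and Borel–Carathéodory turns this into a bound for its modulus.
  obtain ⟨φ₀, hφ₀⟩ := (hdG.div hG h0).isExactOn_univ
  have hconst : ∀ z, G z * exp (-φ₀ z) = G 0 * exp (-φ₀ 0) := by
    have hd : ∀ z, HasDerivAt (fun z ↦ G z * exp (-φ₀ z)) 0 z := fun z ↦ by
      have h1 := (hG z).hasDerivAt.mul ((hφ₀ z (mem_univ _)).neg.cexp)
      convert! h1 using 1
      simp only [Pi.div_apply]
      have := h0 z
      field_simp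
      ring
    intro z
    exact is_const_of_deriv_eq_zero (fun z ↦ (hd z).differentiableAt) (fun z ↦ (hd z).deriv) z 0
  set k := log (G 0 * exp (-φ₀ 0)) with hk
  set φ : ℂ → ℂ := fun z ↦ φ₀ z + k with hφ
  have hφd : Differentiable ℂ φ := fun z ↦ ((hφ₀ z (mem_univ _)).add_const k).differentiableAt
  have hGφ : ∀ z, G z = exp (φ z) := fun z ↦ by
    rw [hφ, exp_add, hk, exp_log (mul_ne_zero (h0 0) (exp_ne_zero _)), ← hconst z, mul_left_comm,
      ← exp_add]
    simp
  have hre : ∀ z, (φ z).re ≤ |Real.log C| + b * ‖z‖ ^ 2 := fun z ↦ by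
    have h1 := hgrowth z
    rw [hGφ, norm_exp, ← Real.exp_log hC, ← Real.exp_add, Real.exp_le_exp] at h1
    linarith [le_abs_self (Real.log C)]
  have hbound : ∀ z, ‖φ z‖ ≤ (2 * (|Real.log C| + 1 + 4 * b) + 3 * ‖φ 0‖) * (1 + ‖z‖) ^ 2 := by
    intro z
    have hz := norm_nonneg z
    -- With this radius R - |z| ≥ |z| and 3(R - |z|) ≥ R + |z|, so both quotients in
    -- Borel–Carathéodory are bounded.
    set R := 2 * (1 + ‖z‖) with hR
    have hRp : 0 < R := by positivity
    have h1 := borelCaratheodory (f := φ) (M := |Real.log C| + 1 + b * R ^ 2) (R := R) (z := z)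
      (by positivity) hφd.differentiableOn (fun w hw ↦ by
        have hw' : ‖w‖ < R := by simpa using hw
        have : b * ‖w‖ ^ 2 ≤ b * R ^ 2 := by gcongr
        have := hre w
        simp only [mem_ofPred_eq]
        linarith) hRp (by simp [hR]; linarith)
    have hden : 0 < R - ‖z‖ := by linarith
    have h2 : 2 * (|Real.log C| + 1 + b * R ^ 2) * ‖z‖ / (R - ‖z‖) ≤
        2 * (|Real.log C| + 1 + b * R ^ 2) := by
      rw [div_le_iff₀ hden]
      gcongr
      linarith
    have h3 : ‖φ 0‖ * (R + ‖z‖) / (R - ‖z‖) ≤ 3 * ‖φ 0‖ := by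
      rw [div_le_iff₀ hden]
      nlinarith [norm_nonneg (φ 0)]
    have h4 : 1 ≤ (1 + ‖z‖) ^ 2 := one_le_pow₀ (by linarith)
    have h5 : R ^ 2 = 4 * (1 + ‖z‖) ^ 2 := by rw [hR]; ring
    rw [h5] at h1 h2
    have h6 : |Real.log C| + 1 ≤ (|Real.log C| + 1) * (1 + ‖z‖) ^ 2 :=
      le_mul_of_one_le_right (by positivity) h4
    have h7 : ‖φ 0‖ ≤ ‖φ 0‖ * (1 + ‖z‖) ^ 2 := le_mul_of_one_le_right (by positivity) h4
    nlinarith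
  obtain ⟨q, hq, hqe⟩ := exists_polynomial_of_growth hφd hbound
  exact ⟨q, hq, fun z ↦ by rw [hGφ, hqe]⟩

/-- Beurling's theorem for an entire function of order two, in terms of a radial majorant. -/
theorem exists_polynomial_mul_gaussian {G : ℂ → ℂ} (hG : Differentiable ℂ G) {m : ℝ → ℝ}
    (hm : Monotone m) (hGm : ∀ z, ‖G z‖ ≤ m ‖z‖) {C b M : ℝ} {N : ℕ} (hb : 0 ≤ b)
    (hgrowth : ∀ z : ℂ, m ‖z‖ ≤ C * Real.exp (b * ‖z‖ ^ 2))
    (hM1 : ∀ R : ℝ, 0 ≤ R → ∫ s in (0 : ℝ)..R, ‖G s‖ * m s ≤ M * (1 + R) ^ N)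
    (hM2 : ∀ R : ℝ, 0 ≤ R → ∫ s in (0 : ℝ)..R, ‖G (-s)‖ * m s ≤ M * (1 + R) ^ N) :
    ∃ (P : Polynomial ℂ) (a : ℂ), P.natDegree ≤ N ∧ ∀ z, G z = P.eval z * exp (a * z ^ 2) := by
  obtain ⟨p, hpN, hp⟩ := exists_polynomial_mul_rotate hG hm hGm hgrowth hM1 hM2
  have hGI : Differentiable ℂ fun z ↦ G (I * z) := hG.comp (by fun_prop)
  rcases eq_or_ne p 0 with rfl | hp0
  · have hana : ∀ {f : ℂ → ℂ}, Differentiable ℂ f → AnalyticOnNhd ℂ f univ := fun hf ↦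
      hf.differentiableOn.analyticOnNhd isOpen_univ
    have h1 := (hana hG).eq_zero_or_eq_zero_of_mul_eq_zero (hana hGI)
      (fun z _ ↦ by simpa using hp z) isPreconnected_univ
    have hG0 : ∀ z, G z = 0 := by
      rcases h1 with h | h
      · exact fun z ↦ h z (mem_univ z)
      · intro z
        have := h (-I * z) (mem_univ _)
        rwa [← mul_assoc, mul_neg, I_mul_I, neg_neg, one_mul] at this
    exact ⟨0, 0, by simp, fun z ↦ by simp [hG0]⟩
  obtain ⟨P, G₁, hP, hPd, hG₁, hne, hfac⟩ :=
    exists_polynomial_mul_zero_free hG hGI.continuous hp0 hp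
  obtain ⟨c, R, hc, hcR⟩ := exists_le_norm_eval hP
  have hC : 0 ≤ C := by simpa using (norm_nonneg _).trans ((hGm 0).trans (hgrowth 0))
  obtain ⟨D, hD⟩ := (isCompact_closedBall (0 : ℂ) R).exists_bound_of_continuousOn
    hG₁.continuous.continuousOn
  -- Dividing by P costs a constant outside a disc, where |P| ≥ c; inside the disc G₁ is bounded by
  -- compactness.
  have hgr₁ : ∀ z, ‖G₁ z‖ ≤ (C / c + |D|) * Real.exp (b * ‖z‖ ^ 2) := by
    intro z
    have h1 : 1 ≤ Real.exp (b * ‖z‖ ^ 2) := Real.one_le_exp (by positivity)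
    rcases le_total R ‖z‖ with hz | hz
    · have h2 := (hGm z).trans (hgrowth z)
      rw [hfac, norm_mul] at h2
      have h3 : c * ‖G₁ z‖ ≤ C * Real.exp (b * ‖z‖ ^ 2) :=
        le_trans (by gcongr; exact hcR z hz) h2
      have h4 : ‖G₁ z‖ ≤ C / c * Real.exp (b * ‖z‖ ^ 2) := by
        rw [div_mul_eq_mul_div, le_div_iff₀ hc]
        linarith
      nlinarith [abs_nonneg D]
    · have h2 := (hD z (by simpa using hz)).trans (le_abs_self D)
      have h3 : 0 ≤ C / c := by positivity
      nlinarith [abs_nonneg D]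
  obtain ⟨q, hq, hqe⟩ := exists_eq_exp_quadratic hG₁ hne hb hgr₁
  have hqz : ∀ z, q.eval z = q.coeff 0 + q.coeff 1 * z + q.coeff 2 * z ^ 2 := fun z ↦ by
    rw [Polynomial.eval_eq_sum_range' (show q.natDegree < 3 by omega)]
    simp [Finset.sum_range_succ]
  set β := q.coeff 1 * (1 + I) with hβ
  have hprod : ∀ z, p.eval z = P.eval z * P.eval (I * z) * exp (2 * q.coeff 0) * exp (β * z) := by
    intro z
    rw [← hp z, hfac, hfac, hqe, hqe, hqz, hqz, mul_mul_mul_comm, ← exp_add, mul_assoc _ (exp _),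
      ← exp_add]
    congr 2
    rw [hβ, mul_pow, I_sq]
    ring
  -- Since (iz)² = -z², the quadratic exponents cancel in the product and only e^{βz} remains. Along
  -- z = s·β̄ it equals e^{|β|²s}, which outgrows p while the two factors P stay bounded below.
  have hβ0 : β = 0 := by
    by_contra hβ0
    have hβp : 0 < ‖β‖ := norm_pos_iff.2 hβ0
    obtain ⟨K, hK, hKp⟩ := exists_norm_eval_le p
    have hev := eventually_pow_lt_exp (c := c * c * ‖exp (2 * q.coeff 0)‖) (κ := ‖β‖ ^ 2)
      (lam := ‖β‖) (by have := norm_pos_iff.2 (exp_ne_zero (2 * q.coeff 0)); positivity)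
      (by positivity) K hβp.le p.natDegree
    obtain ⟨s, hs, hs0, hsR⟩ := (hev.and ((eventually_ge_atTop 0).and
      (eventually_ge_atTop (R / ‖β‖)))).exists
    have hz : ‖(s : ℂ) * (starRingEnd ℂ) β‖ = ‖β‖ * s := by
      rw [norm_mul, norm_real, Real.norm_of_nonneg hs0, RCLike.norm_conj, mul_comm]
    have hzR : R ≤ ‖β‖ * s := by rwa [div_le_iff₀' hβp] at hsR
    have h1 := hKp (s * (starRingEnd ℂ) β)
    have h2 : ‖exp (β * (s * (starRingEnd ℂ) β))‖ = Real.exp (‖β‖ ^ 2 * s) := by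
      rw [norm_exp, mul_left_comm, mul_conj, normSq_eq_norm_sq, ← ofReal_mul, ofReal_re, mul_comm]
    rw [hprod, norm_mul, norm_mul, norm_mul, h2, hz] at h1
    have h3 := hcR (s * (starRingEnd ℂ) β) (by rwa [hz])
    have h4 := hcR (I * (s * (starRingEnd ℂ) β)) (by rwa [norm_mul, norm_I, one_mul, hz])
    refine absurd (hs.trans_le ?_) (not_lt.2 h1)
    gcongr
  have hq1 : q.coeff 1 = 0 := by
    rcases mul_eq_zero.1 hβ0 with h | h
    · exact h
    · have := congrArg re h
      simp at this
  refine ⟨P * Polynomial.C (exp (q.coeff 0)), q.coeff 2, ?_, fun z ↦ ?_⟩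
  · exact (Polynomial.natDegree_mul_C_le _ _).trans (hPd.trans hpN)
  · rw [hfac, hqe, hqz, hq1, zero_mul, add_zero, exp_add]
    simp [mul_assoc]

/-! ### Limits of polynomials times Gaussians -/

/-- With the degree bounded, finitely many fixed nodes control a polynomial everywhere; bounds and
pointwise limits are both transported this way. -/
theorem eval_eq_sum_lagrange {N : ℕ} {v : ℕ → ℂ} (hv : Function.Injective v) {P : Polynomial ℂ}
    (hP : P.natDegree ≤ N) (z : ℂ) :
    P.eval z = ∑ j ∈ Finset.range (N + 1),
      P.eval (v j) * (Lagrange.basis (Finset.range (N + 1)) v j).eval z := by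
  have h := Lagrange.eq_interpolate (s := Finset.range (N + 1)) (v := v) (f := P) hv.injOn (by
    rw [Finset.card_range]
    exact (Polynomial.degree_le_of_natDegree_le hP).trans_lt (by exact_mod_cast Nat.lt_succ_self N))
  conv_lhs => rw [h, Lagrange.interpolate_apply, Polynomial.eval_finsetSum]
  simp

/-- A function `P(z) e^{a z²}` that is bounded on the disc of radius two is
exponentially small in `|a|` on the disc of radius `1 / 2`. -/
theorem exists_norm_polynomial_mul_gaussian_le (N : ℕ) (C : ℝ) :
    ∃ K : ℝ, ∀ (P : Polynomial ℂ) (a : ℂ), P.natDegree ≤ N →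
      (∀ z, ‖z‖ ≤ 2 → ‖P.eval z * exp (a * z ^ 2)‖ ≤ C) →
      ∀ z, ‖z‖ ≤ 1 / 2 → ‖P.eval z * exp (a * z ^ 2)‖ ≤ K * Real.exp (-(‖a‖ / 2)) := by
  -- The N+1 nodes lie in [1, 2]: far enough out for the Gaussian to be at least e^{|a|}, yet within
  -- the disc where the bound C holds.
  set v : ℕ → ℂ := fun j ↦ 1 + j / (N + 1) with hv
  have hN : (N + 1 : ℂ) ≠ 0 := by exact_mod_cast Nat.succ_ne_zero N
  have hvi : Function.Injective v := fun i j h ↦ by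
    simp only [hv, add_right_inj] at h
    field_simp at h
    exact_mod_cast h
  have hvr : ∀ j : ℕ, v j = ((1 + j / (N + 1) : ℝ) : ℂ) := fun j ↦ by simp [hv]
  set ℓ := Lagrange.basis (Finset.range (N + 1)) v with hℓ
  have hL : ∀ j, ∃ L : ℝ, ∀ z ∈ closedBall (0 : ℂ) (1 / 2), ‖(ℓ j).eval z‖ ≤ L := fun j ↦
    (isCompact_closedBall _ _).exists_bound_of_continuousOn (ℓ j).continuous.continuousOn
  choose L hL using hL
  refine ⟨∑ j ∈ Finset.range (N + 1), C * L j, fun P a hP hbound z hz ↦ ?_⟩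
  -- On the ray of direction u the factor e^{az²} grows as fast as possible, so P is at most
  -- C·e^{-|a|} at the nodes. Interpolation carries this to |z| ≤ 1/2, where e^{az²} costs only
  -- e^{|a|/4}.
  obtain ⟨u, hu, hau⟩ : ∃ u : ℂ, ‖u‖ = 1 ∧ a * u ^ 2 = ‖a‖ := by
    refine ⟨exp ((-(arg a) / 2 : ℝ) * I), norm_exp_ofReal_mul_I _, ?_⟩
    rw [← exp_nat_mul]
    nth_rewrite 1 [← norm_mul_exp_arg_mul_I a]
    rw [mul_assoc, ← exp_add]
    have : (arg a : ℂ) * I + ((2 : ℕ) : ℂ) * (((-(arg a) / 2 : ℝ) : ℂ) * I) = 0 := by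
      push_cast
      ring
    rw [this, exp_zero, mul_one]
  have hu0 : u ≠ 0 := norm_ne_zero_iff.1 (by rw [hu]; exact one_ne_zero)
  set p := P.comp (Polynomial.C u * Polynomial.X) with hp
  have hpe : ∀ s, p.eval s = P.eval (u * s) := fun s ↦ by simp [hp]
  have hpd : p.natDegree ≤ N := by
    refine (Polynomial.natDegree_comp_le).trans ?_
    rw [Polynomial.natDegree_C_mul_X u hu0, mul_one]
    exact hP
  set s := u⁻¹ * z with hs
  have hsz : z = u * s := by rw [hs, mul_inv_cancel_left₀ hu0]
  have hsn : ‖s‖ ≤ 1 / 2 := by rw [hs, norm_mul, norm_inv, hu, inv_one, one_mul]; exact hz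
  have hnode : ∀ j ∈ Finset.range (N + 1), ‖p.eval (v j)‖ ≤ C * Real.exp (-‖a‖) := by
    intro j hj
    have hj' : (j : ℝ) / (N + 1) ≤ 1 := by
      rw [div_le_one (by positivity)]
      have := Finset.mem_range.1 hj
      exact_mod_cast this.le
    have hj0 : (0 : ℝ) ≤ (j : ℝ) / (N + 1) := by positivity
    set x : ℝ := 1 + j / (N + 1) with hx
    have h1 := hbound (u * v j) (by
      rw [norm_mul, hu, one_mul, hvr, norm_real, Real.norm_of_nonneg (by linarith)]
      linarith)
    rw [norm_mul, mul_pow, ← mul_assoc a, hau, hvr, ← hx, ← ofReal_pow, ← ofReal_mul, ← ofReal_exp,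
      norm_real, Real.norm_of_nonneg (Real.exp_pos _).le] at h1
    rw [hpe, hvr, ← hx, Real.exp_neg, ← div_eq_mul_inv, le_div_iff₀ (Real.exp_pos _)]
    refine le_trans ?_ h1
    gcongr
    exact le_mul_of_one_le_right (norm_nonneg a) (one_le_pow₀ (by linarith))
  have hC : 0 ≤ C := (norm_nonneg _).trans (hbound 0 (by simp))
  have hPz : ‖P.eval z‖ ≤ (∑ j ∈ Finset.range (N + 1), C * L j) * Real.exp (-‖a‖) := by
    rw [hsz, ← hpe, eval_eq_sum_lagrange hvi hpd, Finset.sum_mul]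
    refine norm_sum_le_of_le _ fun j hj ↦ ?_
    rw [norm_mul]
    have h1 := hnode j hj
    have h2 := hL j s (by simpa using hsn)
    calc _ ≤ C * Real.exp (-‖a‖) * L j := by gcongr
      _ = _ := by ring
  have hsum : 0 ≤ ∑ j ∈ Finset.range (N + 1), C * L j := by
    have := (norm_nonneg _).trans hPz
    exact nonneg_of_mul_nonneg_left this (Real.exp_pos _)
  have hexp : ‖exp (a * z ^ 2)‖ ≤ Real.exp (‖a‖ / 4) := by
    refine (norm_exp_le_exp_norm _).trans (Real.exp_le_exp.2 ?_)
    rw [norm_mul, norm_pow]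
    have : ‖z‖ ^ 2 ≤ (1 / 2) ^ 2 := by gcongr
    nlinarith [norm_nonneg a]
  rw [norm_mul]
  calc _ ≤ (∑ j ∈ Finset.range (N + 1), C * L j) * Real.exp (-‖a‖) * Real.exp (‖a‖ / 4) := by
        gcongr
    _ = (∑ j ∈ Finset.range (N + 1), C * L j) * Real.exp (-‖a‖ + ‖a‖ / 4) := by
        rw [mul_assoc, Real.exp_add]
    _ ≤ _ := by
        gcongr
        linarith [norm_nonneg a]

/-- Pointwise limits of locally bounded sequences `P_k(z) e^{a_k z²}` with `deg P_k ≤ N`. -/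
theorem exists_polynomial_mul_gaussian_of_tendsto {N : ℕ} {F : ℂ → ℂ} (hF : Differentiable ℂ F)
    {P : ℕ → Polynomial ℂ} {a : ℕ → ℂ} (hP : ∀ k, (P k).natDegree ≤ N) {C : ℝ}
    (hbound : ∀ k z, ‖z‖ ≤ 2 → ‖(P k).eval z * exp (a k * z ^ 2)‖ ≤ C)
    (hlim : ∀ z, Tendsto (fun k ↦ (P k).eval z * exp (a k * z ^ 2)) atTop (𝓝 (F z))) :
    ∃ (p : Polynomial ℂ) (b : ℂ), p.natDegree ≤ N ∧ ∀ z, F z = p.eval z * exp (b * z ^ 2) := by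
  -- Either a subsequence of the exponents converges, and then the polynomials converge at the
  -- nodes; or |a k| → ∞, and the preceding estimate forces F to vanish near 0.
  by_cases hfreq : ∃ B : ℝ, ∃ᶠ k in atTop, a k ∈ closedBall (0 : ℂ) B
  · obtain ⟨B, hB⟩ := hfreq
    obtain ⟨b, -, σ, hσ, hb⟩ := tendsto_subseq_of_frequently_bounded isBounded_closedBall hB
    set Q : ℂ → ℂ := fun z ↦ F z * exp (-(b * z ^ 2)) with hQ
    have hPQ : ∀ z, Tendsto (fun k ↦ (P (σ k)).eval z) atTop (𝓝 (Q z)) := fun z ↦ by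
      have h1 := (hlim z).comp hσ.tendsto_atTop
      have h2 : Tendsto (fun k ↦ exp (-(a (σ k) * z ^ 2))) atTop (𝓝 (exp (-(b * z ^ 2)))) :=
        (continuous_exp.tendsto _).comp ((hb.mul_const (z ^ 2)).neg)
      refine (h1.mul h2).congr fun k ↦ ?_
      simp only [Function.comp, mul_assoc, ← exp_add]
      simp
    have hv : Function.Injective (fun j : ℕ ↦ (j : ℂ)) := Nat.cast_injective
    refine ⟨∑ j ∈ Finset.range (N + 1),
      Polynomial.C (Q j) * Lagrange.basis (Finset.range (N + 1)) (fun j : ℕ ↦ (j : ℂ)) j, b,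
      ?_, fun z ↦ ?_⟩
    · refine Polynomial.natDegree_sum_le_of_forall_le _ _ fun j hj ↦ ?_
      refine (Polynomial.natDegree_C_mul_le _ _).trans ?_
      have := Lagrange.degree_basis (hv.injOn (s := Finset.range (N + 1))) hj
      rw [Polynomial.natDegree_eq_of_degree_eq_some this]
      simp
    · have h1 : Q z = ∑ j ∈ Finset.range (N + 1), Q j *
          (Lagrange.basis (Finset.range (N + 1)) (fun j : ℕ ↦ (j : ℂ)) j).eval z := by
        refine tendsto_nhds_unique (hPQ z) ?_
        simp_rw [eval_eq_sum_lagrange hv (hP _) z]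
        exact tendsto_finsetSum _ fun j _ ↦ (hPQ j).mul_const _
      rw [Polynomial.eval_finsetSum]
      simp only [Polynomial.eval_mul, Polynomial.eval_C]
      rw [← h1, hQ, mul_assoc, ← exp_add]
      simp
  · push Not at hfreq
    have hatop : Tendsto (fun k ↦ ‖a k‖) atTop atTop := by
      refine tendsto_atTop.2 fun B ↦ ?_
      have := hfreq B
      filter_upwards [this] with k hk
      simp only [mem_closedBall, dist_zero_right, not_le] at hk
      exact hk.le
    obtain ⟨K, hK⟩ := exists_norm_polynomial_mul_gaussian_le N C
    have hzero : ∀ z, ‖z‖ ≤ 1 / 2 → F z = 0 := by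
      intro z hz
      have h1 : Tendsto (fun k ↦ K * Real.exp (-(‖a k‖ / 2))) atTop (𝓝 0) := by
        have : Tendsto (fun k ↦ Real.exp (-(‖a k‖ / 2))) atTop (𝓝 0) :=
          Real.tendsto_exp_neg_atTop_nhds_zero.comp (hatop.atTop_div_const two_pos)
        simpa using this.const_mul K
      exact tendsto_nhds_unique (hlim z)
        (squeeze_zero_norm (fun k ↦ hK _ _ (hP k) (hbound k) z hz) h1)
    have hF0 : F = 0 := by
      refine AnalyticOnNhd.eq_of_eventuallyEq (z₀ := 0)
        (fun z _ ↦ hF.analyticAt z) (fun z _ ↦ analyticAt_const) ?_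
      filter_upwards [closedBall_mem_nhds (0 : ℂ) (show (0 : ℝ) < 1 / 2 by norm_num)] with z hz
      exact hzero z (by simpa using hz)
    exact ⟨0, 0, by simp, fun z ↦ by simp [hF0]⟩

/-! ### The Fourier–Laplace transform and Gaussian damping -/

section LaplaceTransform

variable {X : Type*} {f : X → ℂ} {t : X → ℝ}

/-- The Gaussian regularization of a function relative to `t`. -/
noncomputable def damp (ε : ℝ) (f : X → ℂ) (t : X → ℝ) (x : X) : ℂ :=
  f x * (Real.exp (-(ε * t x ^ 2)) : ℂ)

theorem norm_damp (ε : ℝ) (x : X) : ‖damp ε f t x‖ = ‖f x‖ * Real.exp (-(ε * t x ^ 2)) := by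
  rw [damp, norm_mul, norm_real, Real.norm_of_nonneg (Real.exp_pos _).le]

theorem norm_damp_le {ε : ℝ} (hε : 0 ≤ ε) (x : X) : ‖damp ε f t x‖ ≤ ‖f x‖ := by
  rw [norm_damp]
  refine mul_le_of_le_one_right (norm_nonneg _) (Real.exp_le_one_iff.2 ?_)
  have := mul_nonneg hε (sq_nonneg (t x))
  linarith

variable [MeasurableSpace X] {μ : Measure X}

/-- The Fourier–Laplace transform `z ↦ ∫ f(x) e^{-i z t(x)} dμ(x)` of the image of `f μ` under a
real function `t`. -/
noncomputable def laplace (μ : Measure X) (f : X → ℂ) (t : X → ℝ) (z : ℂ) : ℂ :=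
  ∫ x, f x * exp (-(I * z * t x)) ∂μ

theorem norm_exp_neg_I_mul (z : ℂ) (s : ℝ) : ‖exp (-(I * z * s))‖ = Real.exp (z.im * s) := by
  rw [norm_exp]
  congr 1
  simp

theorem norm_exp_neg_I_mul_le (z : ℂ) (s : ℝ) :
    ‖exp (-(I * z * s))‖ ≤ Real.exp (|z.im| * |s|) := by
  rw [norm_exp_neg_I_mul, ← abs_mul]
  exact Real.exp_le_exp.2 (le_abs_self _)

theorem aestronglyMeasurable_laplace_integrand (hf : AEStronglyMeasurable f μ) (ht : Measurable t)
    (z : ℂ) : AEStronglyMeasurable (fun x ↦ f x * exp (-(I * z * t x))) μ :=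
  hf.mul (Measurable.aestronglyMeasurable (by fun_prop))

theorem norm_laplace_le (hexp : ∀ c : ℝ, Integrable (fun x ↦ ‖f x‖ * Real.exp (c * |t x|)) μ)
    (z : ℂ) : ‖laplace μ f t z‖ ≤ ∫ x, ‖f x‖ * Real.exp (|z.im| * |t x|) ∂μ := by
  refine norm_integral_le_of_norm_le (hexp _) (Eventually.of_forall fun x ↦ ?_)
  rw [norm_mul]
  gcongr
  exact norm_exp_neg_I_mul_le _ _

theorem differentiableAt_laplace (hf : AEStronglyMeasurable f μ) (ht : Measurable t) {c : ℝ}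
    (hexp : Integrable (fun x ↦ ‖f x‖ * Real.exp (c * |t x|)) μ) {z₀ : ℂ} (hz₀ : |z₀.im| < c) :
    DifferentiableAt ℂ (laplace μ f t) z₀ := by
  -- One η is spent on moving z in a disc around z₀, the other on absorbing the factor |t| produced
  -- by differentiation.
  obtain ⟨η, hη, hηc⟩ : ∃ η > 0, |z₀.im| + 2 * η = c :=
    ⟨(c - |z₀.im|) / 2, by linarith, by ring⟩
  have hball : ∀ z ∈ ball z₀ η, ∀ x, ‖exp (-(I * z * t x))‖ ≤ Real.exp ((c - η) * |t x|) := by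
    intro z hz x
    refine (norm_exp_neg_I_mul_le _ _).trans (Real.exp_le_exp.2 ?_)
    gcongr
    have h1 : ‖z - z₀‖ < η := by simpa [dist_eq_norm] using hz
    have h2 := abs_im_le_norm (z - z₀)
    rw [sub_im] at h2
    have h3 := abs_sub_abs_le_abs_sub z.im z₀.im
    linarith
  have hmono : ∀ x, Real.exp ((c - η) * |t x|) ≤ Real.exp (c * |t x|) := fun x ↦ by
    gcongr
    linarith
  have h := hasDerivAt_integral_of_dominated_loc_of_deriv_le (μ := μ)
    (F := fun z x ↦ f x * exp (-(I * z * t x)))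
    (F' := fun z x ↦ f x * (exp (-(I * z * t x)) * (-(I * t x))))
    (x₀ := z₀) (s := ball z₀ η) (bound := fun x ↦ η⁻¹ * (‖f x‖ * Real.exp (c * |t x|)))
    (ball_mem_nhds z₀ hη)
    (Eventually.of_forall fun z ↦ aestronglyMeasurable_laplace_integrand hf ht z) ?_ ?_ ?_
    (hexp.const_mul _) ?_
  · exact h.2.differentiableAt
  · refine hexp.mono' (aestronglyMeasurable_laplace_integrand hf ht z₀)
      (Eventually.of_forall fun x ↦ ?_)
    rw [norm_mul]
    gcongr
    exact (hball z₀ (mem_ball_self hη) x).trans (hmono x)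
  · exact hf.mul (Measurable.aestronglyMeasurable (by fun_prop))
  · refine Eventually.of_forall fun x z hz ↦ ?_
    rw [norm_mul, norm_mul, norm_neg, norm_mul, norm_I, one_mul, norm_real, Real.norm_eq_abs,
      mul_left_comm η⁻¹]
    refine mul_le_mul_of_nonneg_left ?_ (norm_nonneg _)
    have h1 : |t x| ≤ η⁻¹ * Real.exp (η * |t x|) := by
      rw [inv_mul_eq_div, le_div_iff₀ hη]
      linarith [Real.add_one_le_exp (η * |t x|)]
    calc _ ≤ Real.exp ((c - η) * |t x|) * (η⁻¹ * Real.exp (η * |t x|)) := by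
          gcongr
          exact hball z hz x
      _ = η⁻¹ * Real.exp (c * |t x|) := by
          rw [mul_left_comm, ← Real.exp_add]
          ring_nf
  · refine Eventually.of_forall fun x z _ ↦ ?_
    have h1 : HasDerivAt (fun z : ℂ ↦ -(I * z * t x)) (-(I * t x)) z := by
      have h2 := (((hasDerivAt_id z).const_mul I).mul_const (t x : ℂ)).neg
      rw [mul_one] at h2
      exact h2
    exact h1.cexp.const_mul (f x)

theorem differentiable_laplace (hf : AEStronglyMeasurable f μ) (ht : Measurable t)
    (hexp : ∀ c : ℝ, Integrable (fun x ↦ ‖f x‖ * Real.exp (c * |t x|)) μ) :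
    Differentiable ℂ (laplace μ f t) := fun z ↦
  differentiableAt_laplace hf ht (hexp (|z.im| + 1)) (lt_add_one _)

theorem aestronglyMeasurable_damp (hf : AEStronglyMeasurable f μ) (ht : Measurable t) (ε : ℝ) :
    AEStronglyMeasurable (damp ε f t) μ :=
  hf.mul (Measurable.aestronglyMeasurable (by fun_prop))

theorem integrable_damp_mul_exp (hf : AEStronglyMeasurable f μ) (ht : Measurable t)
    (hexp : ∀ c : ℝ, Integrable (fun x ↦ ‖f x‖ * Real.exp (c * |t x|)) μ) {ε : ℝ} (hε : 0 ≤ ε)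
    (c : ℝ) : Integrable (fun x ↦ ‖damp ε f t x‖ * Real.exp (c * |t x|)) μ := by
  refine (hexp c).mono' ((aestronglyMeasurable_damp hf ht ε).norm.mul
    (Measurable.aestronglyMeasurable (by fun_prop))) (Eventually.of_forall fun x ↦ ?_)
  rw [Real.norm_of_nonneg (by positivity)]
  gcongr
  exact norm_damp_le hε x

theorem tendsto_laplace_damp (hf : AEStronglyMeasurable f μ) (ht : Measurable t)
    (hexp : ∀ c : ℝ, Integrable (fun x ↦ ‖f x‖ * Real.exp (c * |t x|)) μ) {ε : ℕ → ℝ}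
    (hε : ∀ k, 0 ≤ ε k) (hlim : Tendsto ε atTop (𝓝 0)) (z : ℂ) :
    Tendsto (fun k ↦ laplace μ (damp (ε k) f t) t z) atTop (𝓝 (laplace μ f t z)) := by
  refine tendsto_integral_of_dominated_convergence (fun x ↦ ‖f x‖ * Real.exp (|z.im| * |t x|))
    (fun k ↦ aestronglyMeasurable_laplace_integrand (aestronglyMeasurable_damp hf ht _) ht z)
    (hexp _) (fun k ↦ Eventually.of_forall fun x ↦ ?_) (Eventually.of_forall fun x ↦ ?_)
  · rw [norm_mul]
    gcongr
    · exact norm_damp_le (hε k) x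
    · exact norm_exp_neg_I_mul_le _ _
  · refine Tendsto.mul_const _ ?_
    have h1 : Tendsto (fun k ↦ -(ε k * t x ^ 2)) atTop (𝓝 0) := by
      simpa using (hlim.mul_const (t x ^ 2)).neg
    have h2 : Tendsto (fun k ↦ ((Real.exp (-(ε k * t x ^ 2)) : ℝ) : ℂ)) atTop (𝓝 ((1 : ℝ) : ℂ)) := by
      refine (continuous_ofReal.tendsto _).comp ?_
      have := (Real.continuous_exp.tendsto 0).comp h1
      rwa [Real.exp_zero] at this
    simpa [damp] using h2.const_mul (f x)

theorem integrable_of_integrable_exp (hf : AEStronglyMeasurable f μ)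
    (hexp : ∀ c : ℝ, Integrable (fun x ↦ ‖f x‖ * Real.exp (c * |t x|)) μ) : Integrable f μ := by
  have := hexp 0
  simp only [zero_mul, Real.exp_zero, mul_one] at this
  exact (integrable_norm_iff hf).1 this

/-- Damping by a Gaussian amounts to convolving the transform with a Gaussian. -/
theorem laplace_damp_eq [SFinite μ] (hf : AEStronglyMeasurable f μ) (ht : Measurable t)
    (hfi : Integrable f μ) {ε b : ℝ} (hb : 0 < b) (hεb : 4 * ε * b = 1) (r : ℝ) :
    laplace μ (damp ε f t) t r =
      ((π / b : ℂ) ^ (1 / 2 : ℂ))⁻¹ * ∫ u : ℝ, exp (-b * u ^ 2) * laplace μ f t ((r - u : ℝ) : ℂ) := by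
  have hg : Integrable (fun u : ℝ ↦ exp (-b * u ^ 2)) := integrable_cexp_neg_mul_sq (by simpa)
  have hc : (π / b : ℂ) ^ (1 / 2 : ℂ) ≠ 0 := by
    rw [Ne, cpow_eq_zero_iff]
    have h1 : (π : ℂ) ≠ 0 := ofReal_ne_zero.2 Real.pi_ne_zero
    have h2 : (b : ℂ) ≠ 0 := ofReal_ne_zero.2 hb.ne'
    simp [h1, h2]
  have hεb' : (ε : ℂ) = 1 / (4 * b) := by
    have h2 : (b : ℂ) ≠ 0 := ofReal_ne_zero.2 hb.ne'
    have h3 : (4 * ε * b : ℂ) = 1 := by exact_mod_cast hεb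
    field_simp
    linear_combination h3
  -- The relation 4εb = 1 makes e^{-εt²} the transform of e^{-bu²}, up to a constant.
  have hfour : ∀ x, (∫ u : ℝ, exp (I * t x * u) * exp (-b * u ^ 2)) =
      (π / b : ℂ) ^ (1 / 2 : ℂ) * (Real.exp (-(ε * t x ^ 2)) : ℂ) := fun x ↦ by
    rw [fourierIntegral_gaussian (b := (b : ℂ)) (by simpa) (t x : ℂ)]
    congr 1
    push_cast
    rw [hεb']
    congr 1
    ring
  have hint : Integrable (Function.uncurry fun (x : X) (u : ℝ) ↦
      exp (-b * u ^ 2) * (f x * exp (-(I * ((r - u : ℝ) : ℂ) * t x)))) (μ.prod volume) := by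
    refine ((hfi.norm.mul_prod hg.norm)).mono' ?_ (Eventually.of_forall fun p ↦ ?_)
    · refine AEStronglyMeasurable.mul (Measurable.aestronglyMeasurable (by fun_prop)) ?_
      exact hf.comp_fst.mul (Measurable.aestronglyMeasurable (by fun_prop))
    · simp only [Function.uncurry]
      rw [norm_mul, norm_mul, norm_exp_neg_I_mul]
      simp [mul_comm]
  have hswap := integral_integral_swap hint
  rw [eq_inv_mul_iff_mul_eq₀ hc]
  calc _ = ∫ x, (∫ u : ℝ, exp (-b * u ^ 2) * (f x * exp (-(I * ((r - u : ℝ) : ℂ) * t x)))) ∂μ := by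
        rw [laplace, ← integral_const_mul]
        congr 1
        ext x
        have h4 : ∀ u : ℝ, exp (-b * u ^ 2) * (f x * exp (-(I * ((r - u : ℝ) : ℂ) * t x))) =
            f x * exp (-(I * r * t x)) * (exp (I * t x * u) * exp (-b * u ^ 2)) := fun u ↦ by
          have : exp (-(I * ((r - u : ℝ) : ℂ) * t x)) = exp (-(I * r * t x)) * exp (I * t x * u) := by
            rw [← exp_add]
            congr 1
            push_cast
            ring
          rw [this]
          ring
        simp_rw [h4]
        rw [integral_const_mul, hfour, damp]
        ring
    _ = _ := by
        rw [hswap]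
        congr 1
        ext u
        rw [integral_const_mul, laplace]

/-- The weight `e^{|s||r|} (1 + |s|)^{-D} (1 + |r|)^{-E}`. -/
noncomputable def weight (D E : ℕ) (s r : ℝ) : ℝ :=
  Real.exp (|s| * |r|) / ((1 + |s|) ^ D * (1 + |r|) ^ E)

theorem weight_nonneg (D E : ℕ) (s r : ℝ) : 0 ≤ weight D E s r := by
  rw [weight]; positivity

theorem weight_neg_right (D E : ℕ) (s r : ℝ) : weight D E s (-r) = weight D E s r := by
  rw [weight, weight, abs_neg]

theorem measurable_weight (D E : ℕ) : Measurable fun p : ℝ × ℝ ↦ weight D E p.1 p.2 := by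
  simp only [weight, abs]
  fun_prop

theorem pow_mul_exp_neg_mul_sq_le {b : ℝ} (hb : 0 < b) (D : ℕ) (v : ℝ) :
    (1 + |v|) ^ D * Real.exp (-b * v ^ 2) ≤
      D.factorial * Real.exp (1 + 1 / (2 * b)) * Real.exp (-(b / 2) * v ^ 2) := by
  have h1 : (1 + |v|) ^ D ≤ D.factorial * Real.exp (1 + |v|) := by
    have := Real.pow_div_factorial_le_exp (1 + |v|) (by positivity) D
    rwa [div_le_iff₀ (by positivity), mul_comm] at this
  have h2 : |v| ≤ b / 2 * v ^ 2 + 1 / (2 * b) := by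
    have h3 : 0 ≤ (b * |v| - 1) ^ 2 / (2 * b) := by positivity
    have h4 : (b * |v| - 1) ^ 2 / (2 * b) = b / 2 * v ^ 2 - |v| + 1 / (2 * b) := by
      rw [← sq_abs v]
      field_simp
      ring
    linarith
  calc _ ≤ D.factorial * Real.exp (1 + |v|) * Real.exp (-b * v ^ 2) := by gcongr
    _ = D.factorial * Real.exp (1 + |v| + -b * v ^ 2) := by rw [mul_assoc, ← Real.exp_add]
    _ ≤ D.factorial * Real.exp (1 + 1 / (2 * b) + -(b / 2) * v ^ 2) := by
        gcongr ?_ * Real.exp ?_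
        linarith
    _ = _ := by rw [mul_assoc, ← Real.exp_add]

theorem lintegral_pow_mul_exp_neg_mul_sq_lt_top {b : ℝ} (hb : 0 < b) (D : ℕ) :
    ∫⁻ v : ℝ, ENNReal.ofReal ((1 + |v|) ^ D * Real.exp (-b * v ^ 2)) < ⊤ := by
  have hi : Integrable fun v : ℝ ↦
      D.factorial * Real.exp (1 + 1 / (2 * b)) * Real.exp (-(b / 2) * v ^ 2) :=
    (integrable_exp_neg_mul_sq (half_pos hb)).const_mul _
  refine lt_of_le_of_lt (lintegral_mono fun v ↦
    ENNReal.ofReal_le_ofReal (pow_mul_exp_neg_mul_sq_le hb D v)) ?_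
  exact hi.lintegral_lt_top

/-- The integrals `∫ (1 + |u|)^D e^{-b(|u| - τ)²} du` grow at most like `τ^D`. -/
theorem exists_lintegral_shifted_gaussian_le {b ε : ℝ} (hb : 0 < b) (hε : 0 ≤ ε) (D : ℕ) :
    ∃ C : ℝ≥0∞, C ≠ ⊤ ∧ ∀ s : ℝ, ∫⁻ u : ℝ, ENNReal.ofReal
      (Real.exp (-b * (|u| - 2 * ε * |s|) ^ 2) * (1 + |u|) ^ D / (1 + |s|) ^ D) ≤ C := by
  set φ : ℝ → ℝ≥0∞ := fun v ↦ ENNReal.ofReal ((1 + |v|) ^ D * Real.exp (-b * v ^ 2)) with hφ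
  have hφm : Measurable φ := by
    simp only [hφ, abs]
    fun_prop
  refine ⟨ENNReal.ofReal ((1 + 2 * ε) ^ D) * ((∫⁻ v, φ v) + ∫⁻ v, φ v),
    (ENNReal.mul_lt_top ENNReal.ofReal_lt_top (ENNReal.add_lt_top.2
      ⟨lintegral_pow_mul_exp_neg_mul_sq_lt_top hb D,
        lintegral_pow_mul_exp_neg_mul_sq_lt_top hb D⟩)).ne, fun s ↦ ?_⟩
  set τ := 2 * ε * |s| with hτ
  have hτ0 : 0 ≤ τ := by positivity
  -- On u ≥ 0 and u ≤ 0 the substitutions v = u - τ and v = u + τ centre the Gaussian; the factor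
  -- (1+|s|)^{-D} pays for the shift τ = 2ε|s|.
  have hshift : ∀ u v : ℝ, |u| ≤ |v| + τ → (|u| - τ) ^ 2 = v ^ 2 →
      Real.exp (-b * (|u| - τ) ^ 2) * (1 + |u|) ^ D / (1 + |s|) ^ D ≤
        (1 + 2 * ε) ^ D * ((1 + |v|) ^ D * Real.exp (-b * v ^ 2)) := by
    intro u v huv heq
    rw [div_le_iff₀ (by positivity), heq]
    have h1 : 1 + |u| ≤ (1 + 2 * ε) * (1 + |v|) * (1 + |s|) := by
      have h2 : 0 ≤ |v| := abs_nonneg v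
      have h3 : 0 ≤ |s| := abs_nonneg s
      have h4 : 0 ≤ ε * |v| := by positivity
      have h5 : 0 ≤ ε * |v| * |s| := by positivity
      have h6 : 0 ≤ |v| * |s| := by positivity
      rw [hτ] at huv
      nlinarith
    calc _ ≤ Real.exp (-b * v ^ 2) * ((1 + 2 * ε) * (1 + |v|) * (1 + |s|)) ^ D := by gcongr
      _ = _ := by rw [mul_pow, mul_pow]; ring
  have hpt : ∀ u : ℝ, ENNReal.ofReal
      (Real.exp (-b * (|u| - τ) ^ 2) * (1 + |u|) ^ D / (1 + |s|) ^ D) ≤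
      ENNReal.ofReal ((1 + 2 * ε) ^ D) * (φ (u - τ) + φ (u + τ)) := by
    intro u
    rcases le_total 0 u with hu | hu
    · refine le_trans (ENNReal.ofReal_le_ofReal (hshift u (u - τ) ?_ (by rw [abs_of_nonneg hu]))) ?_
      · have := abs_sub_abs_le_abs_sub u τ
        rw [abs_of_nonneg hτ0] at this
        linarith
      · rw [ENNReal.ofReal_mul (by positivity)]
        gcongr
        exact le_self_add
    · refine le_trans (ENNReal.ofReal_le_ofReal (hshift u (u + τ) ?_
        (by rw [abs_of_nonpos hu]; ring))) ?_
      · have := abs_sub_abs_le_abs_sub u (-τ)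
        rw [abs_neg, abs_of_nonneg hτ0, sub_neg_eq_add] at this
        linarith
      · rw [ENNReal.ofReal_mul (by positivity)]
        gcongr
        exact le_add_self
  refine (lintegral_mono hpt).trans_eq ?_
  rw [lintegral_const_mul _ (by fun_prop), lintegral_add_left (by fun_prop),
    lintegral_sub_right_eq_self φ τ, lintegral_add_right_eq_self φ τ]

/-- Completing the square: for 4εb = 1, -εs² - bu² + |s||u| = -b(|u| - 2ε|s|)². Damping in s exactly
compensates the exponential cost of a shift in r. Only a power is lost, whence the exponent 2D in s.
-/
theorem gaussian_mul_weight_le {ε b : ℝ} (hεb : 4 * ε * b = 1) (D : ℕ) (s r u : ℝ) :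
    Real.exp (-(ε * s ^ 2)) * Real.exp (-b * u ^ 2) * weight (2 * D) D s (r + u) ≤
      Real.exp (-b * (|u| - 2 * ε * |s|) ^ 2) * (1 + |u|) ^ D / (1 + |s|) ^ D *
        weight D D s r := by
  have h1 : |s| * |r + u| ≤ |s| * |r| + |s| * |u| := by
    rw [← mul_add]
    gcongr
    exact abs_add_le r u
  have h2 : 1 + |r| ≤ (1 + |r + u|) * (1 + |u|) := by
    have h3 : |r| ≤ |r + u| + |u| := by
      have := abs_sub_abs_le_abs_sub (r + u) u
      have h4 := abs_sub (r + u) u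
      rw [add_sub_cancel_right] at h4
      exact h4
    nlinarith [abs_nonneg (r + u), abs_nonneg u, mul_nonneg (abs_nonneg (r + u)) (abs_nonneg u)]
  have hexp : Real.exp (-(ε * s ^ 2)) * Real.exp (-b * u ^ 2) * Real.exp (|s| * |r + u|) ≤
      Real.exp (-b * (|u| - 2 * ε * |s|) ^ 2) * Real.exp (|s| * |r|) := by
    rw [← Real.exp_add, ← Real.exp_add, ← Real.exp_add, Real.exp_le_exp]
    have h5 : -b * (|u| - 2 * ε * |s|) ^ 2 = -(ε * s ^ 2) + -b * u ^ 2 + |s| * |u| := by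
      rw [← sq_abs u, ← sq_abs s]
      linear_combination (|u| * |s| - ε * |s| ^ 2) * hεb
    linarith
  rw [weight, weight, ← mul_div_assoc, div_mul_div_comm, div_le_div_iff₀ (by positivity)
    (by positivity)]
  calc _ ≤ Real.exp (-b * (|u| - 2 * ε * |s|) ^ 2) * Real.exp (|s| * |r|) *
        ((1 + |s|) ^ D * ((1 + |s|) ^ D * ((1 + |r + u|) * (1 + |u|)) ^ D)) := by gcongr
    _ = _ := by rw [mul_pow]; ring

end LaplaceTransform

/-! ### Stability of the integral condition under damping -/

section WeightedIntegral

variable {X : Type*} {f : X → ℂ} {t : X → ℝ} [MeasurableSpace X] {μ : Measure X}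

/-- The weighted double integral of `f` and its transform `F`. -/
noncomputable def doubleIntegral (μ : Measure X) (f : X → ℂ) (t : X → ℝ) (F : ℝ → ℂ) (D E : ℕ) :
    ℝ≥0∞ :=
  ∫⁻ r, ∫⁻ x, ‖f x‖ₑ * ‖F r‖ₑ * ENNReal.ofReal (weight D E (t x) r) ∂μ

/-- The transform of the damped function is a Gaussian average of the original transform.
Translating r by u inside this average moves the shift onto the weight, where
`gaussian_mul_weight_le` applies; the remaining integral in u is bounded uniformly in t. -/
theorem doubleIntegral_damp_lt_top [SFinite μ] (hf : Measurable f) (ht : Measurable t)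
    (hexp : ∀ c : ℝ, Integrable (fun x ↦ ‖f x‖ * Real.exp (c * |t x|)) μ) {D : ℕ}
    (hfin : doubleIntegral μ f t (fun r ↦ laplace μ f t r) D D < ⊤) {ε : ℝ} (hε : 0 < ε) :
    doubleIntegral μ (damp ε f t) t (fun r ↦ laplace μ (damp ε f t) t r) (2 * D) D < ⊤ := by
  have hfi := integrable_of_integrable_exp hf.aestronglyMeasurable hexp
  set b := 1 / (4 * ε) with hb
  have hb0 : 0 < b := by positivity
  have hεb : 4 * ε * b = 1 := by rw [hb]; field_simp
  obtain ⟨C, hC, hCs⟩ := exists_lintegral_shifted_gaussian_le hb0 hε.le D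
  obtain ⟨F, hF⟩ : ∃ F : ℝ → ℂ, F = fun r : ℝ ↦ laplace μ f t r := ⟨_, rfl⟩
  rw [← hF] at hfin
  have hFc : Continuous F := hF ▸
    (differentiable_laplace hf.aestronglyMeasurable ht hexp).continuous.comp continuous_ofReal
  obtain ⟨Fε, hFε⟩ : ∃ F : ℝ → ℂ, F = fun r : ℝ ↦ laplace μ (damp ε f t) t r := ⟨_, rfl⟩
  rw [← hFε]
  have hFεc : Continuous Fε := hFε ▸
    (differentiable_laplace (aestronglyMeasurable_damp hf.aestronglyMeasurable ht ε) ht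
      (integrable_damp_mul_exp hf.aestronglyMeasurable ht hexp hε.le)).continuous.comp
        continuous_ofReal
  have hFm : Measurable F := hFc.measurable
  have hdm : Measurable (damp ε f t) := by
    unfold damp
    fun_prop
  set K : ℝ≥0∞ := ‖((π / b : ℂ) ^ (1 / 2 : ℂ))⁻¹‖ₑ with hK
  set g : ℝ → ℝ≥0∞ := fun u ↦ ENNReal.ofReal (Real.exp (-b * u ^ 2)) with hg
  have hgm : Measurable g := by fun_prop
  have hw : ∀ D E, Measurable fun p : ℝ × ℝ ↦ ENNReal.ofReal (weight D E p.1 p.2) := fun D E ↦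
    (measurable_weight D E).ennreal_ofReal
  have hFle : ∀ r, ‖Fε r‖ₑ ≤ ∫⁻ u, K * (g u * ‖F (r - u)‖ₑ) := by
    intro r
    simp only [hFε]
    rw [laplace_damp_eq hf.aestronglyMeasurable ht hfi hb0 hεb, enorm_mul,
      lintegral_const_mul _ (by fun_prop)]
    gcongr
    refine (enorm_integral_le_lintegral_enorm _).trans_eq ?_
    congr 1
    ext u
    rw [enorm_mul, hF]
    congr 1
    rw [hg, ← ofReal_norm, norm_exp]
    congr 2
    rw [← ofReal_pow, ← ofReal_neg, ← ofReal_mul, ofReal_re]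
  have hx : ∀ x, (∫⁻ r, ‖damp ε f t x‖ₑ * ‖Fε r‖ₑ * ENNReal.ofReal (weight (2 * D) D (t x) r)) ≤
      ∫⁻ r, K * C * (‖f x‖ₑ * ‖F r‖ₑ * ENNReal.ofReal (weight D D (t x) r)) := by
    intro x
    have hwx : ∀ D E, Measurable fun r : ℝ ↦ ENNReal.ofReal (weight D E (t x) r) := fun D E ↦
      (hw D E).comp measurable_prodMk_left
    set a := ‖damp ε f t x‖ₑ with ha
    have haeq : a = ‖f x‖ₑ * ENNReal.ofReal (Real.exp (-(ε * t x ^ 2))) := by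
      rw [ha, ← ofReal_norm, norm_damp, ENNReal.ofReal_mul (norm_nonneg _), ofReal_norm]
    calc _ ≤ ∫⁻ r, ∫⁻ u, a * (K * (g u * ‖F (r - u)‖ₑ)) *
          ENNReal.ofReal (weight (2 * D) D (t x) r) := by
          refine lintegral_mono fun r ↦ ?_
          rw [lintegral_mul_const _ (by fun_prop), lintegral_const_mul _ (by fun_prop)]
          gcongr
          exact hFle r
      _ = ∫⁻ u, ∫⁻ r, a * (K * (g u * ‖F (r - u)‖ₑ)) *
          ENNReal.ofReal (weight (2 * D) D (t x) r) := by
          refine lintegral_lintegral_swap (Measurable.aemeasurable ?_)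
          exact Measurable.mul (by fun_prop) ((hwx _ _).comp measurable_fst)
      _ = ∫⁻ u, ∫⁻ r, a * (K * (g u * ‖F r‖ₑ)) *
          ENNReal.ofReal (weight (2 * D) D (t x) (r + u)) := by
          congr 1
          ext u
          rw [← lintegral_add_right_eq_self _ u]
          simp
      _ = ∫⁻ r, ∫⁻ u, a * (K * (g u * ‖F r‖ₑ)) *
          ENNReal.ofReal (weight (2 * D) D (t x) (r + u)) := by
          refine lintegral_lintegral_swap (Measurable.aemeasurable ?_)
          exact Measurable.mul (by fun_prop) ((hwx _ _).comp (by fun_prop))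
      _ ≤ ∫⁻ r, ∫⁻ u, K * (‖f x‖ₑ * ‖F r‖ₑ * ENNReal.ofReal (weight D D (t x) r)) *
          ENNReal.ofReal (Real.exp (-b * (|u| - 2 * ε * |t x|) ^ 2) * (1 + |u|) ^ D /
            (1 + |t x|) ^ D) := by
          refine lintegral_mono fun r ↦ lintegral_mono fun u ↦ ?_
          have h1 := ENNReal.ofReal_le_ofReal (gaussian_mul_weight_le hεb D (t x) r u)
          rw [ENNReal.ofReal_mul (by positivity), ENNReal.ofReal_mul (by positivity),
            ENNReal.ofReal_mul (by positivity)] at h1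
          rw [haeq, hg]
          calc _ = K * (‖f x‖ₑ * ‖F r‖ₑ) * (ENNReal.ofReal (Real.exp (-(ε * t x ^ 2))) *
                ENNReal.ofReal (Real.exp (-b * u ^ 2)) *
                ENNReal.ofReal (weight (2 * D) D (t x) (r + u))) := by ring
            _ ≤ K * (‖f x‖ₑ * ‖F r‖ₑ) * _ := mul_le_mul_right h1 _
            _ = _ := by ring
      _ ≤ _ := by
          refine lintegral_mono fun r ↦ ?_
          rw [lintegral_const_mul _ (by simp only [abs]; fun_prop)]
          calc _ ≤ K * (‖f x‖ₑ * ‖F r‖ₑ * ENNReal.ofReal (weight D D (t x) r)) * C := by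
                gcongr
                exact hCs (t x)
            _ = _ := by ring
  have hmeas : ∀ (h : X → ℂ) (G : ℝ → ℂ) (D E : ℕ), Measurable h → Continuous G →
      Measurable fun p : ℝ × X ↦ ‖h p.2‖ₑ * ‖G p.1‖ₑ * ENNReal.ofReal (weight D E (t p.2) p.1) := by
    intro h G D E hh hG
    have hGm : Measurable G := hG.measurable
    exact Measurable.mul (by fun_prop) ((hw D E).comp ((ht.comp measurable_snd).prodMk measurable_fst))
  rw [doubleIntegral, lintegral_lintegral_swap (hmeas _ _ _ _ hdm hFεc).aemeasurable]
  refine (lintegral_mono hx).trans_lt ?_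
  have hKC : K * C ≠ ⊤ := ENNReal.mul_ne_top enorm_ne_top hC
  simp_rw [lintegral_const_mul' _ _ hKC]
  rw [← lintegral_lintegral_swap (hmeas _ _ _ _ hf hFc).aemeasurable]
  exact ENNReal.mul_lt_top hKC.lt_top hfin

end WeightedIntegral

/-! ### The one-dimensional Beurling theorem -/

section DampedIntegral

variable {X : Type*} {f : X → ℂ} {t : X → ℝ}

/-- If |t| ≤ R/ε, the polynomial denominator in t is at most a power of R. If |t| ≥ R/ε, then ε|t| ≥
s and the damping already dominates e^{s|t|}. So the weight in t is traded for growth in R. -/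
theorem damp_mul_exp_le {ε : ℝ} (hε : 0 < ε) (D : ℕ) {R s : ℝ} (hs : 0 ≤ s) (hsR : s ≤ R) (x : X) :
    ‖damp ε f t x‖ * Real.exp (s * |t x|) ≤
      ‖f x‖ + (1 + R / ε) ^ (2 * D) * (1 + R) ^ D * (‖damp ε f t x‖ * weight (2 * D) D (t x) s) := by
  have hR : 0 ≤ R := hs.trans hsR
  have hw := weight_nonneg (2 * D) D (t x) s
  rcases le_total (|t x|) (R / ε) with h | h
  · have h1 : Real.exp (s * |t x|) ≤
        (1 + R / ε) ^ (2 * D) * (1 + R) ^ D * weight (2 * D) D (t x) s := by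
      rw [weight, ← mul_div_assoc, le_div_iff₀ (by positivity), abs_of_nonneg hs, mul_comm s,
        mul_comm]
      gcongr
    calc _ ≤ ‖damp ε f t x‖ * ((1 + R / ε) ^ (2 * D) * (1 + R) ^ D * weight (2 * D) D (t x) s) := by
          gcongr
      _ = (1 + R / ε) ^ (2 * D) * (1 + R) ^ D * (‖damp ε f t x‖ * weight (2 * D) D (t x) s) := by
          ring
      _ ≤ _ := le_add_of_nonneg_left (norm_nonneg _)
  · refine le_trans ?_ (le_add_of_nonneg_right (by positivity))
    rw [norm_damp, mul_assoc, ← Real.exp_add]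
    refine mul_le_of_le_one_right (norm_nonneg _) (Real.exp_le_one_iff.2 ?_)
    have h1 : s ≤ ε * |t x| := by
      rw [div_le_iff₀' hε] at h
      linarith
    rw [← sq_abs]
    nlinarith [abs_nonneg (t x)]

variable [MeasurableSpace X] {μ : Measure X}

/-- Removal of the polynomial weight in `x` for a damped function. -/
theorem integral_norm_mul_majorant_le (hf : Measurable f) (ht : Measurable t)
    (hexp : ∀ c : ℝ, Integrable (fun x ↦ ‖f x‖ * Real.exp (c * |t x|)) μ) {D : ℕ} {ε : ℝ}
    (hε : 0 < ε) {g : ℝ → ℂ} (hg : Continuous g) (hgA : ∀ s, ‖g s‖ ≤ ∫ x, ‖f x‖ ∂μ)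
    (hfin : doubleIntegral μ (damp ε f t) t g (2 * D) D < ⊤) {R : ℝ} (hR : 0 ≤ R) :
    ∫ s in (0 : ℝ)..R, ‖g s‖ * ∫ x, ‖damp ε f t x‖ * Real.exp (s * |t x|) ∂μ ≤
      ((∫ x, ‖f x‖ ∂μ) ^ 2 + (1 + 1 / ε) ^ (2 * D) *
        (doubleIntegral μ (damp ε f t) t g (2 * D) D).toReal) * (1 + R) ^ (3 * D + 1) := by
  have hfi := integrable_of_integrable_exp hf.aestronglyMeasurable hexp
  have hdexp := integrable_damp_mul_exp hf.aestronglyMeasurable ht hexp hε.le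
  set A := ∫ x, ‖f x‖ ∂μ with hA
  have hA0 : 0 ≤ A := by positivity
  set K := doubleIntegral μ (damp ε f t) t g (2 * D) D with hK
  set c := (1 + R / ε) ^ (2 * D) * (1 + R) ^ D with hc
  have hc0 : 0 ≤ c := by positivity
  have hdm : Measurable (damp ε f t) := by
    unfold damp
    fun_prop
  have hnn : ∀ s, 0 ≤ ∫ x, ‖damp ε f t x‖ * Real.exp (s * |t x|) ∂μ := fun s ↦ by positivity
  have hmono : Monotone fun s ↦ ∫ x, ‖damp ε f t x‖ * Real.exp (s * |t x|) ∂μ := fun s₁ s₂ h ↦ by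
    refine integral_mono (hdexp s₁) (hdexp s₂) fun x ↦ ?_
    dsimp only
    gcongr
  have hpt : ∀ s ∈ Ioc 0 R,
      ENNReal.ofReal (‖g s‖ * ∫ x, ‖damp ε f t x‖ * Real.exp (s * |t x|) ∂μ) ≤
        ENNReal.ofReal (A ^ 2) + ENNReal.ofReal c *
          ∫⁻ x, ‖damp ε f t x‖ₑ * ‖g s‖ₑ * ENNReal.ofReal (weight (2 * D) D (t x) s) ∂μ := by
    intro s hs
    rw [ENNReal.ofReal_mul (norm_nonneg _), ofReal_integral_eq_lintegral_ofReal (hdexp s)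
      (Eventually.of_forall fun x ↦ by positivity), ofReal_norm]
    calc _ ≤ ‖g s‖ₑ * ∫⁻ x, (ENNReal.ofReal ‖f x‖ + ENNReal.ofReal c *
          (‖damp ε f t x‖ₑ * ENNReal.ofReal (weight (2 * D) D (t x) s))) ∂μ := by
          gcongr with x
          refine (ENNReal.ofReal_le_ofReal (damp_mul_exp_le hε D hs.1.le hs.2 x)).trans_eq ?_
          have hw := weight_nonneg (2 * D) D (t x) s
          rw [ENNReal.ofReal_add (norm_nonneg _) (by positivity), ENNReal.ofReal_mul hc0,
            ENNReal.ofReal_mul (norm_nonneg _), ofReal_norm (damp ε f t x)]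
      _ = ‖g s‖ₑ * ENNReal.ofReal A + ENNReal.ofReal c *
          ∫⁻ x, ‖damp ε f t x‖ₑ * ‖g s‖ₑ * ENNReal.ofReal (weight (2 * D) D (t x) s) ∂μ := by
          have h5 : ∫⁻ x, ‖damp ε f t x‖ₑ * ‖g s‖ₑ * ENNReal.ofReal (weight (2 * D) D (t x) s) ∂μ =
              ‖g s‖ₑ * ∫⁻ x, ‖damp ε f t x‖ₑ * ENNReal.ofReal (weight (2 * D) D (t x) s) ∂μ := by
            rw [← lintegral_const_mul' _ _ enorm_ne_top]
            exact lintegral_congr fun x ↦ by ring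
          rw [h5, lintegral_add_left (by fun_prop), mul_add, hA,
            ofReal_integral_eq_lintegral_ofReal hfi.norm
              (Eventually.of_forall fun x ↦ norm_nonneg _),
            lintegral_const_mul' _ _ ENNReal.ofReal_ne_top, mul_left_comm]
      _ ≤ _ := by
          gcongr
          rw [sq, ENNReal.ofReal_mul hA0, ← ofReal_norm]
          gcongr
          exact hgA s
  have hbound : ∫⁻ s in Ioc 0 R,
      ENNReal.ofReal (‖g s‖ * ∫ x, ‖damp ε f t x‖ * Real.exp (s * |t x|) ∂μ) ≤
        ENNReal.ofReal (A ^ 2 * R + c * K.toReal) := by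
    refine (setLIntegral_mono' measurableSet_Ioc hpt).trans ?_
    rw [lintegral_add_left measurable_const, setLIntegral_const, Real.volume_Ioc, sub_zero,
      lintegral_const_mul' _ _ ENNReal.ofReal_ne_top, ENNReal.ofReal_add (by positivity)
      (by positivity), ENNReal.ofReal_mul (p := A ^ 2) (by positivity), ENNReal.ofReal_mul hc0,
      ENNReal.ofReal_toReal hfin.ne]
    gcongr
    exact setLIntegral_le_lintegral _ _
  have hle : ∫ s in (0 : ℝ)..R, ‖g s‖ * ∫ x, ‖damp ε f t x‖ * Real.exp (s * |t x|) ∂μ ≤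
      A ^ 2 * R + c * K.toReal := by
    rw [intervalIntegral.integral_of_le hR, integral_eq_lintegral_of_nonneg_ae
      (Eventually.of_forall fun s ↦ mul_nonneg (norm_nonneg _) (hnn s))
      (hg.norm.measurable.mul hmono.measurable).aestronglyMeasurable]
    exact ENNReal.toReal_le_of_le_ofReal (by positivity) hbound
  refine hle.trans ?_
  -- The exponent 3D comes from (1+R/ε)^{2D}(1+R)^D; the extra 1 accommodates the term A²R, also
  -- when D = 0.
  have h1 : R ≤ (1 + R) ^ (3 * D + 1) :=
    (by linarith : R ≤ 1 + R).trans (le_self_pow₀ (by linarith) (by omega))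
  have h2 : c ≤ (1 + 1 / ε) ^ (2 * D) * (1 + R) ^ (3 * D + 1) := by
    have h3 : 1 + R / ε ≤ (1 + 1 / ε) * (1 + R) := by
      have h4 : R / ε = 1 / ε * R := by ring
      have h5 : 0 < 1 / ε := by positivity
      rw [h4]
      nlinarith
    calc c ≤ ((1 + 1 / ε) * (1 + R)) ^ (2 * D) * (1 + R) ^ D := by rw [hc]; gcongr
      _ = (1 + 1 / ε) ^ (2 * D) * (1 + R) ^ (3 * D) := by
          rw [mul_pow, mul_assoc, ← pow_add]
          congr 2
          ring
      _ ≤ _ := by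
          gcongr
          · linarith
          · omega
  have hK0 : 0 ≤ K.toReal := ENNReal.toReal_nonneg
  calc A ^ 2 * R + c * K.toReal ≤ A ^ 2 * (1 + R) ^ (3 * D + 1) +
        (1 + 1 / ε) ^ (2 * D) * (1 + R) ^ (3 * D + 1) * K.toReal := by gcongr
    _ = _ := by ring

theorem doubleIntegral_comp_neg (g : ℝ → ℂ) (D E : ℕ) :
    doubleIntegral μ f t (fun r ↦ g (-r)) D E = doubleIntegral μ f t g D E := by
  rw [doubleIntegral, doubleIntegral, ← lintegral_neg_eq_self]
  simp only [neg_neg, weight_neg_right]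

/-- Damping supplies the order-two growth, since s|t| - εt² ≤ s²/(4ε). The degree bound is free of
ε, as the limit ε → 0 requires. -/
theorem exists_laplace_damp_eq_polynomial_mul_gaussian [SFinite μ] (hf : Measurable f)
    (ht : Measurable t)
    (hexp : ∀ c : ℝ, Integrable (fun x ↦ ‖f x‖ * Real.exp (c * |t x|)) μ) {D : ℕ}
    (hfin : doubleIntegral μ f t (fun r ↦ laplace μ f t r) D D < ⊤) {ε : ℝ} (hε : 0 < ε) :
    ∃ (P : Polynomial ℂ) (a : ℂ), P.natDegree ≤ 3 * D + 1 ∧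
      ∀ z, laplace μ (damp ε f t) t z = P.eval z * exp (a * z ^ 2) := by
  have hK := doubleIntegral_damp_lt_top hf ht hexp hfin hε
  have hfi := integrable_of_integrable_exp hf.aestronglyMeasurable hexp
  have hdm := aestronglyMeasurable_damp (hf.aestronglyMeasurable (μ := μ)) ht ε
  have hdexp := integrable_damp_mul_exp hf.aestronglyMeasurable ht hexp hε.le
  have hG := differentiable_laplace hdm ht hdexp
  set G := laplace μ (damp ε f t) t with hGdef
  have hmono : Monotone fun s ↦ ∫ x, ‖damp ε f t x‖ * Real.exp (s * |t x|) ∂μ := fun s₁ s₂ h ↦ by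
    refine integral_mono (hdexp s₁) (hdexp s₂) fun x ↦ ?_
    dsimp only
    gcongr
  have hGm : ∀ z, ‖G z‖ ≤ ∫ x, ‖damp ε f t x‖ * Real.exp (‖z‖ * |t x|) ∂μ := fun z ↦
    (norm_laplace_le hdexp z).trans (hmono (abs_im_le_norm z))
  have hGA : ∀ s : ℝ, ‖G s‖ ≤ ∫ x, ‖f x‖ ∂μ := fun s ↦ by
    refine (norm_laplace_le hdexp s).trans (integral_mono (hdexp _) hfi.norm fun x ↦ ?_)
    simpa using norm_damp_le hε.le x
  have hgrowth : ∀ z : ℂ, ∫ x, ‖damp ε f t x‖ * Real.exp (‖z‖ * |t x|) ∂μ ≤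
      (∫ x, ‖f x‖ ∂μ) * Real.exp (1 / (4 * ε) * ‖z‖ ^ 2) := by
    intro z
    rw [← integral_mul_const]
    refine integral_mono (hdexp _) (hfi.norm.mul_const _) fun x ↦ ?_
    dsimp only
    rw [norm_damp, mul_assoc, ← Real.exp_add]
    gcongr
    have h1 : 0 ≤ (2 * ε * |t x| - ‖z‖) ^ 2 / (4 * ε) := by positivity
    have h2 : (2 * ε * |t x| - ‖z‖) ^ 2 / (4 * ε) =
        ε * t x ^ 2 - ‖z‖ * |t x| + 1 / (4 * ε) * ‖z‖ ^ 2 := by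
      rw [← sq_abs (t x)]
      field_simp
      ring
    linarith
  have hK2 : doubleIntegral μ (damp ε f t) t (fun r : ℝ ↦ G (-r)) (2 * D) D =
      doubleIntegral μ (damp ε f t) t (fun r : ℝ ↦ G r) (2 * D) D := by
    rw [← doubleIntegral_comp_neg (fun r : ℝ ↦ G r)]
    simp
  refine exists_polynomial_mul_gaussian hG hmono hGm (by positivity) hgrowth
    (M := (∫ x, ‖f x‖ ∂μ) ^ 2 + (1 + 1 / ε) ^ (2 * D) *
        (doubleIntegral μ (damp ε f t) t (fun r : ℝ ↦ G r) (2 * D) D).toReal) ?_ ?_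
  · intro R hR
    exact integral_norm_mul_majorant_le hf ht hexp hε (g := fun r : ℝ ↦ G r)
      (hG.continuous.comp continuous_ofReal) hGA hK hR
  · intro R hR
    have := integral_norm_mul_majorant_le hf ht hexp hε (g := fun r : ℝ ↦ G (-r)) (D := D)
      (hG.continuous.comp (by fun_prop)) (fun s ↦ by simpa using hGA (-s)) (by rwa [hK2]) hR
    rwa [hK2] at this

/-- One-dimensional Beurling theorem for the transform of the image of `f μ` under `t`. -/
theorem exists_laplace_eq_polynomial_mul_gaussian [SFinite μ] (hf : Measurable f)
    (ht : Measurable t)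
    (hexp : ∀ c : ℝ, Integrable (fun x ↦ ‖f x‖ * Real.exp (c * |t x|)) μ) {D : ℕ}
    (hfin : doubleIntegral μ f t (fun r ↦ laplace μ f t r) D D < ⊤) :
    ∃ (P : Polynomial ℂ) (a : ℂ), P.natDegree ≤ 3 * D + 1 ∧
      ∀ z, laplace μ f t z = P.eval z * exp (a * z ^ 2) := by
  have hε : ∀ k : ℕ, (0 : ℝ) < 1 / (k + 1) := fun k ↦ by positivity
  choose P a hP hPa using fun k : ℕ ↦
    exists_laplace_damp_eq_polynomial_mul_gaussian hf ht hexp hfin (hε k)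
  -- Damping only decreases |f|, so an undamped exponential moment bounds all the transforms on the
  -- disc of radius two.
  refine exists_polynomial_mul_gaussian_of_tendsto (P := P) (a := a)
    (C := ∫ x, ‖f x‖ * Real.exp (2 * |t x|) ∂μ)
    (differentiable_laplace hf.aestronglyMeasurable ht hexp) hP ?_ ?_
  · intro k z hz
    rw [← hPa]
    have hdexp := integrable_damp_mul_exp hf.aestronglyMeasurable ht hexp (hε k).le
    refine (norm_laplace_le hdexp z).trans (integral_mono (hdexp _) (hexp 2) fun x ↦ ?_)
    dsimp only
    gcongr
    · exact norm_damp_le (hε k).le x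
    · exact (abs_im_le_norm z).trans hz
  · intro z
    simp_rw [← hPa]
    exact tendsto_laplace_damp hf.aestronglyMeasurable ht hexp (fun k ↦ (hε k).le)
      tendsto_one_div_add_atTop_nhds_zero_nat z

end DampedIntegral

/-! ### Integration over lines and null sets -/

section Lines

variable {E : Type*} [NormedAddCommGroup E] [InnerProductSpace ℝ E] [FiniteDimensional ℝ E]
  [MeasurableSpace E] [BorelSpace E]

open Module in
/-- Integration over lines through the origin recovers the integral over the space. -/
theorem lintegral_lintegral_smul {g : E → ℝ≥0∞} (hg : Measurable g) :
    ∫⁻ v : E, ∫⁻ r : ℝ, g (r • v) * ENNReal.ofReal (|r| ^ finrank ℝ E * (1 + r ^ 2)⁻¹) =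
      (∫⁻ r : ℝ, ENNReal.ofReal ((1 + r ^ 2)⁻¹)) * ∫⁻ v, g v := by
  have hd : Measurable fun r : ℝ ↦ ENNReal.ofReal (|r| ^ finrank ℝ E * (1 + r ^ 2)⁻¹) := by
    simp only [abs]
    fun_prop
  rw [lintegral_lintegral_swap (Measurable.aemeasurable
    ((hg.comp (by fun_prop)).mul (hd.comp measurable_snd))), ← lintegral_mul_const _ (by fun_prop)]
  refine lintegral_congr_ae ?_
  filter_upwards [compl_mem_ae_iff.2 (measure_singleton (0 : ℝ))] with r hr
  have hr0 : r ≠ 0 := hr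
  -- The factor |r|^n in the density cancels the Jacobian of the dilation by r, and (1+r²)⁻¹ makes
  -- the integral in r converge.
  have h1 : ∫⁻ v, g (r • v) = ENNReal.ofReal |(r ^ finrank ℝ E)⁻¹| * ∫⁻ v, g v := by
    rw [← lintegral_map hg (measurable_const_smul r), Measure.map_addHaar_smul volume hr0,
      lintegral_smul_measure, smul_eq_mul]
  rw [lintegral_mul_const _ (by fun_prop), h1, mul_right_comm, ← ENNReal.ofReal_mul (abs_nonneg _)]
  congr 2
  rw [abs_inv, abs_pow, ← mul_assoc, inv_mul_cancel₀ (by positivity), one_mul]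

theorem lintegral_inv_one_add_sq_lt_top : ∫⁻ r : ℝ, ENNReal.ofReal ((1 + r ^ 2)⁻¹) < ⊤ :=
  integrable_inv_one_add_sq.lintegral_lt_top

open Module in
theorem ae_lintegral_smul_lt_top {g : E → ℝ≥0∞} (hg : Measurable g) (hfin : ∫⁻ v, g v < ⊤) :
    ∀ᵐ v : E, ∫⁻ r : ℝ, g (r • v) * ENNReal.ofReal (|r| ^ finrank ℝ E * (1 + r ^ 2)⁻¹) < ⊤ := by
  have hd : Measurable fun r : ℝ ↦ ENNReal.ofReal (|r| ^ finrank ℝ E * (1 + r ^ 2)⁻¹) := by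
    simp only [abs]
    fun_prop
  refine ae_lt_top (Measurable.lintegral_prod_right'
    (f := fun p : E × ℝ ↦ g (p.2 • p.1) * ENNReal.ofReal (|p.2| ^ finrank ℝ E * (1 + p.2 ^ 2)⁻¹))
    ((hg.comp (by fun_prop)).mul (hd.comp measurable_snd))) ?_
  rw [lintegral_lintegral_smul hg]
  exact (ENNReal.mul_lt_top lintegral_inv_one_add_sq_lt_top hfin).ne

/-- A set is null if its trace on each line through a fixed point is null. -/
theorem volume_eq_zero_of_lines {N : Set E} (hN : MeasurableSet N) (p : E)
    (h : ∀ v : E, ∀ᵐ r : ℝ, p + r • v ∉ N) : volume N = 0 := by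
  set g : E → ℝ≥0∞ := fun y ↦ N.indicator 1 (p + y) with hg
  have hgm : Measurable g := (measurable_one.indicator hN).comp (by fun_prop)
  have h1 := lintegral_lintegral_smul hgm
  have h2 : ∀ v : E, ∫⁻ r : ℝ, g (r • v) *
      ENNReal.ofReal (|r| ^ Module.finrank ℝ E * (1 + r ^ 2)⁻¹) = 0 := fun v ↦ by
    rw [← lintegral_zero (μ := (volume : Measure ℝ))]
    refine lintegral_congr_ae ?_
    filter_upwards [h v] with r hr
    simp [hg, hr]
  simp_rw [h2, lintegral_zero] at h1
  have h3 : (∫⁻ r : ℝ, ENNReal.ofReal ((1 + r ^ 2)⁻¹)) ≠ 0 := by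
    rw [← ofReal_integral_eq_lintegral_ofReal integrable_inv_one_add_sq
      (Eventually.of_forall fun r ↦ by positivity), integral_univ_inv_one_add_sq]
    simpa using Real.pi_pos
  have h4 : ∫⁻ v, g v = 0 := (mul_eq_zero.1 h1.symm).resolve_left h3
  rw [hg, lintegral_add_left_eq_self (fun y ↦ N.indicator 1 y) p, lintegral_indicator_one hN] at h4
  exact h4

theorem ae_ne_zero_of_analytic {g : ℝ → ℂ} (hg : AnalyticOnNhd ℝ g univ) {r₀ : ℝ} (h : g r₀ ≠ 0) :
    ∀ᵐ r : ℝ, g r ≠ 0 := by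
  have h1 := ae_restrict_le_codiscreteWithin (μ := (volume : Measure ℝ)) MeasurableSet.univ
    (hg.preimage_zero_mem_codiscrete h)
  rwa [Measure.restrict_univ] at h1

/-- Lines through one nonzero point p suffice: on each the zeros are discrete, hence null. No joint
analyticity is needed. -/
theorem ae_ne_zero_of_analytic_on_lines {g : E → ℂ} (hg : Measurable g) {p : E} (hp : g p ≠ 0)
    (h : ∀ v, AnalyticOnNhd ℝ (fun r : ℝ ↦ g (p + r • v)) univ) : ∀ᵐ y, g y ≠ 0 := by
  refine measure_eq_zero_iff_ae_notMem.1 (volume_eq_zero_of_lines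
    (hg (measurableSet_singleton 0)) p fun v ↦ ?_)
  exact ae_ne_zero_of_analytic (h v) (r₀ := 0) (by simpa using hp)

end Lines

/-! ### Polynomials on ℝⁿ and their leading forms -/

section Polynomials

variable {n : ℕ}

theorem continuous_polyValue (Q : MvPolynomial (Fin n) ℂ) : Continuous (polyValue Q) := by
  unfold polyValue
  have h : Continuous fun x : EuclideanSpace ℝ (Fin n) ↦ fun i ↦ ((x i : ℝ) : ℂ) := by fun_prop
  exact (MvPolynomial.continuous_eval Q).comp h

theorem exists_polyValue_ne_zero {Q : MvPolynomial (Fin n) ℂ} (hQ : Q ≠ 0) :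
    ∃ x, polyValue Q x ≠ 0 := by
  by_contra! h
  refine hQ (MvPolynomial.funext_set (fun _ ↦ range ((↑) : ℝ → ℂ))
    (fun _ ↦ infinite_range_of_injective ofReal_injective) fun y hy ↦ ?_)
  choose x hx using fun i ↦ hy i (mem_univ i)
  have h1 := h (WithLp.toLp 2 x)
  have h2 : (fun i ↦ ((WithLp.toLp 2 x : EuclideanSpace ℝ (Fin n)) i : ℂ)) = y := funext hx
  rw [polyValue, h2] at h1
  rw [h1, map_zero]

/-- The restriction of a polynomial to a line. -/
theorem exists_polyValue_line (Q : MvPolynomial (Fin n) ℂ) (p v : EuclideanSpace ℝ (Fin n)) :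
    ∃ q : Polynomial ℂ, ∀ r : ℝ, polyValue Q (p + r • v) = q.eval (r : ℂ) := by
  refine ⟨MvPolynomial.aeval (fun i ↦ Polynomial.C (p i : ℂ) +
    Polynomial.C (v i : ℂ) * Polynomial.X) Q, fun r ↦ ?_⟩
  rw [polyValue, ← Polynomial.coe_evalRingHom, MvPolynomial.aeval_def, MvPolynomial.eval₂_comp_left,
    ← MvPolynomial.eval₂_id]
  congr 1
  · ext x
    simp
  · ext i
    simp
    ring

theorem ae_polyValue_ne_zero {Q : MvPolynomial (Fin n) ℂ} (hQ : Q ≠ 0) :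
    ∀ᵐ y, polyValue Q y ≠ 0 := by
  obtain ⟨p, hp⟩ := exists_polyValue_ne_zero hQ
  refine ae_ne_zero_of_analytic_on_lines (continuous_polyValue Q).measurable hp fun v r _ ↦ ?_
  obtain ⟨q, hq⟩ := exists_polyValue_line Q p v
  simp_rw [hq]
  have h1 : AnalyticAt ℂ (fun z : ℂ ↦ q.eval z) (r : ℂ) := q.differentiable.analyticAt _
  exact h1.restrictScalars.comp (ofRealCLM.analyticAt r)

theorem polyValue_smul_of_isHomogeneous {Q : MvPolynomial (Fin n) ℂ} {j : ℕ}
    (hQ : Q.IsHomogeneous j) (s : ℝ) (w : EuclideanSpace ℝ (Fin n)) :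
    polyValue Q (s • w) = (s : ℂ) ^ j * polyValue Q w := by
  rw [polyValue, polyValue, MvPolynomial.eval_eq, MvPolynomial.eval_eq, Finset.mul_sum]
  refine Finset.sum_congr rfl fun d hd ↦ ?_
  have h1 : d.sum (fun _ k ↦ k) = j := by
    have := hQ (MvPolynomial.mem_support_iff.1 hd)
    simpa [Finsupp.weight_apply] using this
  rw [mul_left_comm, ← h1, Finsupp.sum, ← Finset.prod_pow_eq_pow_sum, ← Finset.prod_mul_distrib]
  congr 1
  refine Finset.prod_congr rfl fun i _ ↦ ?_
  simp [mul_pow]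

/-- A polynomial grows at full speed near directions where its leading form does not vanish. -/
theorem exists_le_norm_polyValue_smul (Q : MvPolynomial (Fin n) ℂ) {v : EuclideanSpace ℝ (Fin n)}
    (hv : polyValue (MvPolynomial.homogeneousComponent Q.totalDegree Q) v ≠ 0) :
    ∃ c ρ S : ℝ, 0 < c ∧ 0 < ρ ∧ 0 < S ∧ ∀ s : ℝ, S ≤ |s| → ∀ w ∈ ball v ρ,
      c * |s| ^ Q.totalDegree ≤ ‖polyValue Q (s • w)‖ := by
  set m := Q.totalDegree with hm
  set H : ℕ → EuclideanSpace ℝ (Fin n) → ℂ := fun j ↦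
    polyValue (MvPolynomial.homogeneousComponent j Q) with hH
  -- For σ ≠ 0, g(σ, w) is σ^m Q(w/σ); it extends continuously to σ = 0, with the leading form as
  -- value. Continuity at (0, v) gives the uniform lower bound.
  set g : ℝ × EuclideanSpace ℝ (Fin n) → ℂ := fun p ↦
    ∑ j ∈ Finset.range (m + 1), (p.1 : ℂ) ^ (m - j) * H j p.2 with hg
  have hHc : ∀ j, Continuous (H j) := fun j ↦ continuous_polyValue _
  have hgc : Continuous g := by
    refine continuous_finsetSum _ fun j _ ↦ ?_
    exact Continuous.mul (by fun_prop) ((hHc j).comp continuous_snd)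
  have hg0 : g (0, v) = H m v := by
    rw [hg]
    simp only [ofReal_zero]
    rw [Finset.sum_range_succ, Finset.sum_eq_zero fun j hj ↦ ?_]
    · simp
    · have := Finset.mem_range.1 hj
      rw [zero_pow (by omega), zero_mul]
  have hQg : ∀ (s : ℝ) w, s ≠ 0 → polyValue Q (s • w) = (s : ℂ) ^ m * g (s⁻¹, w) := by
    intro s w hs
    have hs' : (s : ℂ) ≠ 0 := ofReal_ne_zero.2 hs
    conv_lhs => rw [← MvPolynomial.sum_homogeneousComponent Q]
    have h1 : ∀ y, polyValue (∑ j ∈ Finset.range (m + 1),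
        MvPolynomial.homogeneousComponent j Q) y = ∑ j ∈ Finset.range (m + 1), H j y := fun y ↦ by
      simp only [polyValue, hH, map_sum]
    rw [← hm, h1, hg, Finset.mul_sum]
    refine Finset.sum_congr rfl fun j hj ↦ ?_
    have hj' : j ≤ m := Nat.lt_succ_iff.1 (Finset.mem_range.1 hj)
    simp only [hH]
    rw [polyValue_smul_of_isHomogeneous (MvPolynomial.homogeneousComponent_isHomogeneous j Q),
      ← mul_assoc, ofReal_inv, inv_pow, ← pow_sub₀ _ hs' (Nat.sub_le m j),
      Nat.sub_sub_self hj']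
  have hpos : 0 < ‖H m v‖ := norm_pos_iff.2 hv
  have hev : ∀ᶠ p in 𝓝 ((0 : ℝ), v), ‖H m v‖ / 2 < ‖g p‖ := by
    have h1 : Tendsto (fun p ↦ ‖g p‖) (𝓝 ((0 : ℝ), v)) (𝓝 ‖H m v‖) := by
      rw [← hg0]
      exact hgc.norm.tendsto _
    exact h1.eventually_const_lt (by linarith)
  obtain ⟨ρ, hρ, hball⟩ := Metric.eventually_nhds_iff_ball.1 hev
  refine ⟨‖H m v‖ / 2, ρ, 2 / ρ, by positivity, hρ, by positivity, fun s hs w hw ↦ ?_⟩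
  have hs0 : 0 < |s| := lt_of_lt_of_le (by positivity) hs
  rw [hQg s w (abs_pos.1 hs0), norm_mul, norm_pow, norm_real, Real.norm_eq_abs, mul_comm]
  gcongr
  refine (hball (s⁻¹, w) ?_).le
  rw [← ball_prod_same]
  refine ⟨?_, hw⟩
  rw [mem_ball_zero_iff, Real.norm_eq_abs, abs_inv, inv_lt_comm₀ hs0 hρ]
  refine lt_of_lt_of_le ?_ hs
  rw [← one_div]
  gcongr
  norm_num

theorem homogeneousComponent_totalDegree_ne_zero {Q : MvPolynomial (Fin n) ℂ} (hQ : Q ≠ 0) :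
    MvPolynomial.homogeneousComponent Q.totalDegree Q ≠ 0 := by
  have hne : Q.support.Nonempty := MvPolynomial.support_nonempty.2 hQ
  obtain ⟨d, hd, hdeg⟩ := Finset.exists_mem_eq_sup Q.support hne fun s ↦ s.sum fun _ e ↦ e
  intro h
  have h1 := congrArg (MvPolynomial.coeff d) h
  rw [MvPolynomial.coeff_homogeneousComponent, if_pos, MvPolynomial.coeff_zero] at h1
  · exact MvPolynomial.mem_support_iff.1 hd h1
  · rw [MvPolynomial.totalDegree, hdeg]
    rfl

end Polynomials

/-! ### The Fourier integral and the L² transform -/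

section FourierIntegral

variable {E : Type*} [NormedAddCommGroup E] [InnerProductSpace ℝ E] [FiniteDimensional ℝ E]
  [MeasurableSpace E] [BorelSpace E] {f : E → ℂ}

/-- The Fourier integral `∫ f(x) e^{-i x·y} dx`. -/
noncomputable def fourierInt (f : E → ℂ) (y : E) : ℂ := ∫ x, f x * exp (-(I * (⟪y, x⟫ : ℝ)))

theorem fourierInt_eq_fourier (f : E → ℂ) (y : E) : fourierInt f y = 𝓕 f ((2 * π)⁻¹ • y) := by
  rw [fourierInt, Real.fourier_eq']
  refine integral_congr_ae (Eventually.of_forall fun x ↦ ?_)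
  dsimp only
  rw [smul_eq_mul, mul_comm, real_inner_smul_right, real_inner_comm]
  congr 2
  push_cast
  have : (π : ℂ) ≠ 0 := ofReal_ne_zero.2 Real.pi_ne_zero
  field_simp

theorem fourier_eq_fourierInt (f : E → ℂ) (w : E) : 𝓕 f w = fourierInt f ((2 * π) • w) := by
  rw [fourierInt_eq_fourier, smul_smul, inv_mul_cancel₀ (by positivity), one_smul]

theorem continuous_fourier (hf : Integrable f) : Continuous (𝓕 f) :=
  VectorFourier.fourierIntegral_continuous Real.continuous_fourierChar
    (innerSL ℝ (E := E)).continuous₂ hf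

theorem continuous_fourierInt (hf : Integrable f) : Continuous (fourierInt f) := by
  simp_rw [funext (fourierInt_eq_fourier f)]
  exact (continuous_fourier hf).comp (by fun_prop)

theorem norm_fourierInt_le (f : E → ℂ) (y : E) : ‖fourierInt f y‖ ≤ ∫ x, ‖f x‖ := by
  refine (norm_integral_le_integral_norm _).trans_eq ?_
  congr 1
  ext x
  rw [norm_mul, norm_exp]
  simp

theorem fourierInt_smul (f : E → ℂ) (v : E) (r : ℝ) :
    fourierInt f (r • v) = laplace volume f (fun x ↦ ⟪v, x⟫) r := by
  rw [fourierInt, laplace]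
  simp_rw [real_inner_smul_left]
  push_cast
  simp_rw [mul_assoc]

theorem measurable_inner_left (v : E) : Measurable fun x : E ↦ ⟪v, x⟫ := by fun_prop

theorem integrable_mul_exp_inner (hf : AEStronglyMeasurable f) {c c' : ℝ}
    (hexp : Integrable fun x ↦ ‖f x‖ * Real.exp (c * ‖x‖)) {v : E} (hc' : 0 ≤ c')
    (hv : c' * ‖v‖ ≤ c) : Integrable fun x ↦ ‖f x‖ * Real.exp (c' * |⟪v, x⟫|) := by
  refine hexp.mono' (hf.norm.mul (Measurable.aestronglyMeasurable (by fun_prop)))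
    (Eventually.of_forall fun x ↦ ?_)
  rw [Real.norm_of_nonneg (by positivity)]
  refine mul_le_mul_of_nonneg_left (Real.exp_le_exp.2 ?_) (norm_nonneg _)
  calc c' * |⟪v, x⟫| ≤ c' * (‖v‖ * ‖x‖) := by gcongr; exact abs_real_inner_le_norm v x
    _ = c' * ‖v‖ * ‖x‖ := by ring
    _ ≤ c * ‖x‖ := by gcongr

theorem integrable_mul_exp_inner_of_forall (hf : AEStronglyMeasurable f)
    (hexp : ∀ c : ℝ, Integrable fun x ↦ ‖f x‖ * Real.exp (c * ‖x‖)) (v : E) (c : ℝ) :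
    Integrable fun x ↦ ‖f x‖ * Real.exp (c * |⟪v, x⟫|) := by
  refine (integrable_mul_exp_inner hf (hexp (|c| * ‖v‖)) (abs_nonneg c) le_rfl).mono'
    (hf.norm.mul (Measurable.aestronglyMeasurable (by fun_prop)))
    (Eventually.of_forall fun x ↦ ?_)
  rw [Real.norm_of_nonneg (by positivity)]
  gcongr
  exact le_abs_self c

theorem analyticOnNhd_fourierInt_line (hf : AEStronglyMeasurable f) {c : ℝ} (hc : 0 < c)
    (hexp : Integrable fun x ↦ ‖f x‖ * Real.exp (c * ‖x‖)) (p v : E) :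
    AnalyticOnNhd ℝ (fun r : ℝ ↦ fourierInt f (p + r • v)) univ := by
  -- Absorbing the phase of the base point p into f reduces an arbitrary line to one through the
  -- origin.
  set g : E → ℂ := fun x ↦ f x * exp (-(I * (⟪p, x⟫ : ℝ))) with hg
  have hgm : AEStronglyMeasurable g := hf.mul (Measurable.aestronglyMeasurable (by fun_prop))
  have hgn : ∀ x, ‖g x‖ = ‖f x‖ := fun x ↦ by
    rw [hg, norm_mul, norm_exp]
    simp
  have hline : ∀ r : ℝ, fourierInt f (p + r • v) = laplace volume g (fun x ↦ ⟪v, x⟫) r := fun r ↦ by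
    rw [← fourierInt_smul, fourierInt, fourierInt]
    congr 1
    ext x
    rw [hg, mul_assoc, ← exp_add, inner_add_left]
    congr 2
    push_cast
    ring
  set c' := c / (‖v‖ + 1) with hc'
  have hc'0 : 0 < c' := by positivity
  have hexp' : Integrable fun x ↦ ‖g x‖ * Real.exp (c' * |⟪v, x⟫|) := by
    simp_rw [hgn]
    refine integrable_mul_exp_inner hf hexp hc'0.le ?_
    rw [hc', div_mul_eq_mul_div, div_le_iff₀ (by positivity)]
    gcongr
    linarith
  have hopen : IsOpen {z : ℂ | |z.im| < c'} :=
    isOpen_lt (continuous_abs.comp continuous_im) continuous_const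
  intro r _
  simp_rw [hline]
  have h1 : AnalyticAt ℂ (laplace volume g fun x ↦ ⟪v, x⟫) (r : ℂ) := by
    refine DifferentiableOn.analyticAt (s := {z : ℂ | |z.im| < c'}) (fun z hz ↦ ?_)
      (hopen.mem_nhds (by simpa using hc'0))
    exact (differentiableAt_laplace hgm (measurable_inner_left v) hexp' hz).differentiableWithinAt
  exact h1.restrictScalars.comp (ofRealCLM.analyticAt r)

/-- The Fourier transform of an integrable function of exponential decay is nonzero almost
everywhere unless it vanishes identically. -/
theorem ae_fourierInt_ne_zero (hf : AEStronglyMeasurable f) {c : ℝ} (hc : 0 < c)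
    (hexp : Integrable fun x ↦ ‖f x‖ * Real.exp (c * ‖x‖)) (hfi : Integrable f) {p : E}
    (hp : fourierInt f p ≠ 0) : ∀ᵐ y, fourierInt f y ≠ 0 :=
  ae_ne_zero_of_analytic_on_lines (continuous_fourierInt hfi).measurable hp
    (analyticOnNhd_fourierInt_line hf hc hexp p)

/-- On `L¹ ∩ L²` the `L²` Fourier transform is given by the Fourier integral. -/
theorem coeFn_fourier_toLp (hf : MemLp f 2 volume) (hf1 : Integrable f) :
    ((𝓕 (hf.toLp f) : Lp ℂ 2 (volume : Measure E)) : E → ℂ) =ᵐ[volume] 𝓕 f := by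
  -- Both sides are tested against smooth compactly supported functions; the distributional and the
  -- integral transform each move 𝓕 to the test function.
  refine ae_eq_of_integral_contDiff_smul_eq ((Lp.memLp _).locallyIntegrable one_le_two)
    (continuous_fourier hf1).locallyIntegrable fun g hg hgc ↦ ?_
  have hg₁ : HasCompactSupport (ofRealCLM ∘ g) := hgc.comp_left rfl
  have hg₂ : ContDiff ℝ (⊤ : ℕ∞) (ofRealCLM ∘ g) := by fun_prop
  set φ : SchwartzMap E ℂ := hg₁.toSchwartzMap hg₂ with hφ
  have hφg : ∀ x, φ x = (g x : ℂ) := fun x ↦ by simp [hφ]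
  have h1 := congrArg (fun T : TemperedDistribution E ℂ ↦ T φ)
    (Lp.fourier_toTemperedDistribution_eq (hf.toLp f))
  simp only [TemperedDistribution.fourier_apply, Lp.toTemperedDistribution_apply] at h1
  have h2 : ∫ x, (𝓕 φ) x • (hf.toLp f) x = ∫ x, (𝓕 φ) x • f x :=
    integral_congr_ae (by filter_upwards [hf.coeFn_toLp] with x hx; rw [hx])
  have h3 : ∫ ξ, (𝓕 φ) ξ • f ξ = ∫ x, φ x • 𝓕 f x := by
    have := VectorFourier.integral_fourierIntegral_smul_eq_flip (L := innerₗ E) (μ := volume)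
      (ν := volume) Real.continuous_fourierChar continuous_inner φ.integrable hf1
    rw [flip_innerₗ] at this
    exact this
  rw [h2, h3] at h1
  simp only [hφg] at h1
  simpa using h1.symm

end FourierIntegral

theorem l2Fourier_ae_eq {n : ℕ} {f : EuclideanSpace ℝ (Fin n) → ℂ} (hf : MemLp f 2 volume)
    (hf1 : Integrable f) : l2Fourier f hf =ᵐ[volume] fourierInt f := by
  have h := (Measure.quasiMeasurePreserving_smul (volume : Measure (EuclideanSpace ℝ (Fin n)))
    (r := (2 * π)⁻¹) (by positivity)).ae (coeFn_fourier_toLp hf hf1)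
  filter_upwards [h] with y hy
  rw [l2Fourier, hy, fourierInt_eq_fourier]

theorem measurable_l2Fourier {n : ℕ} {f : EuclideanSpace ℝ (Fin n) → ℂ} (hf : MemLp f 2 volume) :
    Measurable (l2Fourier f hf) :=
  (Lp.stronglyMeasurable _).measurable.comp (measurable_const_smul _)

theorem l2Fourier_congr_ae {n : ℕ} {f g : EuclideanSpace ℝ (Fin n) → ℂ} (hf : MemLp f 2 volume)
    (hg : MemLp g 2 volume) (h : f =ᵐ[volume] g) : l2Fourier f hf = l2Fourier g hg := by
  have : hf.toLp f = hg.toLp g := MemLp.toLp_eq_toLp_iff hf hg |>.2 h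
  ext y
  rw [l2Fourier, l2Fourier, this]

/-- Uniqueness: the `L²` Fourier transform determines the function almost everywhere. -/
theorem ae_eq_of_l2Fourier_ae_eq {n : ℕ} {f g : EuclideanSpace ℝ (Fin n) → ℂ}
    (hf : MemLp f 2 volume) (hg : MemLp g 2 volume)
    (h : l2Fourier f hf =ᵐ[volume] l2Fourier g hg) : f =ᵐ[volume] g := by
  have h1 := (Measure.quasiMeasurePreserving_smul (volume : Measure (EuclideanSpace ℝ (Fin n)))
    (r := 2 * π) (by positivity)).ae h
  have h2 : 𝓕 (hf.toLp f) = 𝓕 (hg.toLp g) := by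
    refine Lp.ext ?_
    filter_upwards [h1] with y hy
    rwa [l2Fourier, l2Fourier, smul_smul, inv_mul_cancel₀ (by positivity), one_smul] at hy
  have h3 : hf.toLp f = hg.toLp g := (Lp.fourierTransformₗᵢ _ ℂ).injective h2
  exact (MemLp.toLp_eq_toLp_iff hf hg).1 h3

/-! ### Comparison of weighted double integrals -/

section DoubleIntegral

variable {X : Type*} {f : X → ℂ} {t τ : X → ℝ} [MeasurableSpace X] {μ : Measure X}

theorem weight_le_exp {D E : ℕ} {s r R : ℝ} (hr : |r| ≤ R) :
    weight D E s r ≤ Real.exp (R * |s|) := by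
  rw [weight]
  refine (div_le_self (Real.exp_pos _).le ?_).trans (Real.exp_le_exp.2 ?_)
  · exact one_le_mul_of_one_le_of_one_le (one_le_pow₀ (by linarith [abs_nonneg s]))
      (one_le_pow₀ (by linarith [abs_nonneg r]))
  · rw [mul_comm]
    gcongr

/-- Bounded r are harmless: there the weight is at most e^{R|t|} and G is bounded, so an exponential
moment of f suffices. -/
theorem doubleIntegral_lt_top_of_tail
    (hexp : ∀ c : ℝ, Integrable (fun x ↦ ‖f x‖ * Real.exp (c * |t x|)) μ) {G : ℝ → ℂ} {A : ℝ}
    (hGA : ∀ r, ‖G r‖ ≤ A) {D E : ℕ} (R : ℝ)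
    (htail : ∫⁻ r in (Ioo (-R) R)ᶜ, ∫⁻ x, ‖f x‖ₑ * ‖G r‖ₑ * ENNReal.ofReal (weight D E (t x) r) ∂μ
      < ⊤) :
    doubleIntegral μ f t G D E < ⊤ := by
  rw [doubleIntegral, ← lintegral_add_compl _ (measurableSet_Ioo (a := -R) (b := R))]
  refine ENNReal.add_lt_top.2 ⟨?_, htail⟩
  set B := ∫⁻ x, ENNReal.ofReal A * ENNReal.ofReal (‖f x‖ * Real.exp (R * |t x|)) ∂μ with hB
  have hBt : B < ⊤ := by
    rw [hB, lintegral_const_mul' _ _ ENNReal.ofReal_ne_top]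
    exact ENNReal.mul_lt_top ENNReal.ofReal_lt_top (hexp R).lintegral_lt_top
  refine (setLIntegral_mono' (g := fun _ ↦ B) measurableSet_Ioo fun r hr ↦ ?_).trans_lt ?_
  · refine lintegral_mono fun x ↦ ?_
    rw [ENNReal.ofReal_mul (norm_nonneg _), ← ofReal_norm, ← ofReal_norm, mul_comm (ENNReal.ofReal _),
      mul_assoc]
    gcongr
    · exact hGA r
    · exact weight_le_exp (abs_le.2 ⟨hr.1.le, hr.2.le⟩)
  · rw [setLIntegral_const]
    exact ENNReal.mul_lt_top hBt measure_Ioo_lt_top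

/-- In s = |s| the logarithmic derivative of the weight is |r| - D/(1+s), nonnegative as soon as |r|
≥ D. -/
theorem weight_mono {D E : ℕ} {s s' r : ℝ} (hs : |s| ≤ |s'|) (hr : D ≤ |r|) :
    weight D E s r ≤ weight D E s' r := by
  have h0 := abs_nonneg s
  have h1 : 1 + |s'| ≤ (1 + |s|) * Real.exp (|s'| - |s|) := by
    nlinarith [Real.add_one_le_exp (|s'| - |s|)]
  have h2 : (1 + |s'|) ^ D ≤ (1 + |s|) ^ D * Real.exp ((|s'| - |s|) * |r|) := by
    calc (1 + |s'|) ^ D ≤ ((1 + |s|) * Real.exp (|s'| - |s|)) ^ D := by gcongr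
      _ = (1 + |s|) ^ D * Real.exp (D * (|s'| - |s|)) := by rw [mul_pow, ← Real.exp_nat_mul]
      _ ≤ _ := by
          rw [mul_comm (D : ℝ)]
          gcongr
  rw [weight, weight, div_le_div_iff₀ (by positivity) (by positivity)]
  calc Real.exp (|s| * |r|) * ((1 + |s'|) ^ D * (1 + |r|) ^ E) ≤
        Real.exp (|s| * |r|) * ((1 + |s|) ^ D * Real.exp ((|s'| - |s|) * |r|) * (1 + |r|) ^ E) := by
        gcongr
    _ = Real.exp (|s| * |r| + (|s'| - |s|) * |r|) * ((1 + |s|) ^ D * (1 + |r|) ^ E) := by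
        rw [Real.exp_add]
        ring
    _ = _ := by ring_nf

/-- With Cauchy–Schwarz this passes from the radial function ‖v‖‖x‖ to ⟪v, x⟫. Monotonicity of the
weight covers |r| ≥ D, and smaller r are harmless. -/
theorem doubleIntegral_lt_top_of_abs_le
    (hexp : ∀ c : ℝ, Integrable (fun x ↦ ‖f x‖ * Real.exp (c * |t x|)) μ) {G : ℝ → ℂ} {A : ℝ}
    (hGA : ∀ r, ‖G r‖ ≤ A) {D E : ℕ} (hle : ∀ x, |t x| ≤ |τ x|)
    (hfin : doubleIntegral μ f τ G D E < ⊤) : doubleIntegral μ f t G D E < ⊤ := by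
  refine doubleIntegral_lt_top_of_tail hexp hGA D (lt_of_le_of_lt ?_ hfin)
  refine le_trans (setLIntegral_mono' measurableSet_Ioo.compl fun r hr ↦ lintegral_mono fun x ↦ ?_)
    (setLIntegral_le_lintegral _ _)
  gcongr
  refine weight_mono (hle x) ?_
  by_contra! h
  exact hr (abs_lt.1 h)

end DoubleIntegral

/-! ### Exponential moments and restriction of the hypothesis to lines -/

section Space

variable {n : ℕ} {f g : EuclideanSpace ℝ (Fin n) → ℂ} {Q : MvPolynomial (Fin n) ℂ} {d δ : ℝ}

/-- The integrand of the uncertainty condition. -/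
noncomputable def density (f g : EuclideanSpace ℝ (Fin n) → ℂ) (Q : MvPolynomial (Fin n) ℂ)
    (d δ : ℝ) (x y : EuclideanSpace ℝ (Fin n)) : ℝ≥0∞ :=
  ENNReal.ofReal (‖f x‖ * ‖g y‖ * Real.exp (‖x‖ * ‖y‖) * ‖polyValue Q y‖ ^ δ
    / (1 + ‖x‖ + ‖y‖) ^ d)

theorem measurable_density (hf : Measurable f) (hg : Measurable g) :
    Measurable fun p : EuclideanSpace ℝ (Fin n) × EuclideanSpace ℝ (Fin n) ↦
      density f g Q d δ p.1 p.2 := by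
  have hQ : Measurable (polyValue Q) := (continuous_polyValue Q).measurable
  unfold density
  fun_prop

theorem rpow_le_pow_ceil {u d : ℝ} (hu : 1 ≤ u) : u ^ d ≤ u ^ ⌈d⌉₊ := by
  rw [← Real.rpow_natCast]
  exact Real.rpow_le_rpow_of_exponent_le hu (Nat.le_ceil d)

/-- At a fixed y the integrand is |f(x)|e^{‖x‖‖y‖} up to a positive constant and a power of
1+‖x‖+‖y‖; the gap ‖y‖ - c absorbs the power. -/
theorem integrable_mul_exp_of_density (hf : Measurable f) {y : EuclideanSpace ℝ (Fin n)}
    (hy : ∫⁻ x, density f g Q d δ x y < ⊤) (hgy : g y ≠ 0) (hQy : polyValue Q y ≠ 0) {c : ℝ}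
    (hc : c < ‖y‖) : Integrable fun x ↦ ‖f x‖ * Real.exp (c * ‖x‖) := by
  set D := ⌈d⌉₊
  set η := ‖y‖ - c with hη
  have hη0 : 0 < η := by linarith
  set A := ‖g y‖ * ‖polyValue Q y‖ ^ δ with hA
  have hA0 : 0 < A := mul_pos (norm_pos_iff.2 hgy) (Real.rpow_pos_of_pos (norm_pos_iff.2 hQy) _)
  set K := D.factorial / η ^ D * Real.exp (η * (1 + ‖y‖)) with hK
  have hK0 : 0 < K := by positivity
  have hbase : ∀ x : EuclideanSpace ℝ (Fin n), (1 + ‖x‖ + ‖y‖) ^ d ≤ K * Real.exp (η * ‖x‖) := by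
    intro x
    have hx := norm_nonneg x
    have hy0 := norm_nonneg y
    refine (rpow_le_pow_ceil (by linarith)).trans ?_
    have h1 := Real.pow_div_factorial_le_exp (η * (1 + ‖x‖ + ‖y‖)) (by positivity) D
    rw [div_le_iff₀ (by positivity), mul_pow] at h1
    have h2 : K * Real.exp (η * ‖x‖) =
        Real.exp (η * (1 + ‖x‖ + ‖y‖)) * D.factorial / η ^ D := by
      rw [hK, mul_assoc, ← Real.exp_add]
      ring_nf
    rw [h2, le_div_iff₀ (by positivity)]
    linarith
  rw [← lintegral_ofReal_ne_top_iff_integrable (Measurable.aestronglyMeasurable (by fun_prop))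
    (Eventually.of_forall fun x ↦ by positivity)]
  refine ne_top_of_le_ne_top (ENNReal.mul_lt_top (ENNReal.ofReal_lt_top (r := K / A)) hy).ne ?_
  rw [← lintegral_const_mul' _ _ ENNReal.ofReal_ne_top]
  refine lintegral_mono fun x ↦ ?_
  rw [density, ← ENNReal.ofReal_mul (by positivity)]
  refine ENNReal.ofReal_le_ofReal ?_
  have hpos : 0 < (1 + ‖x‖ + ‖y‖) ^ d := Real.rpow_pos_of_pos (by positivity) _
  have h3 : K / A * (‖f x‖ * ‖g y‖ * Real.exp (‖x‖ * ‖y‖) * ‖polyValue Q y‖ ^ δ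
      / (1 + ‖x‖ + ‖y‖) ^ d) = ‖f x‖ * (K * Real.exp (‖x‖ * ‖y‖) / (1 + ‖x‖ + ‖y‖) ^ d) := by
    have : K / A * (‖f x‖ * ‖g y‖ * Real.exp (‖x‖ * ‖y‖) * ‖polyValue Q y‖ ^ δ
      / (1 + ‖x‖ + ‖y‖) ^ d) = K / A * (‖f x‖ * A * Real.exp (‖x‖ * ‖y‖)
      / (1 + ‖x‖ + ‖y‖) ^ d) := by rw [hA]; ring
    rw [this]
    field_simp
  rw [h3]
  gcongr
  rw [le_div_iff₀ hpos]
  calc Real.exp (c * ‖x‖) * (1 + ‖x‖ + ‖y‖) ^ d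
      ≤ Real.exp (c * ‖x‖) * (K * Real.exp (η * ‖x‖)) := by gcongr; exact hbase x
    _ = K * Real.exp (‖x‖ * ‖y‖) := by
        rw [mul_left_comm, ← Real.exp_add, hη]
        ring_nf

theorem ae_lintegral_density_lt_top (hf : Measurable f) (hg : Measurable g)
    (hfin : ∫⁻ x, ∫⁻ y, density f g Q d δ x y < ⊤) : ∀ᵐ y, ∫⁻ x, density f g Q d δ x y < ⊤ := by
  refine ae_lt_top (Measurable.lintegral_prod_left' (measurable_density hf hg)) ?_
  rw [← lintegral_lintegral_swap (measurable_density hf hg).aemeasurable]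
  exact hfin.ne

theorem integrable_of_integrable_mul_exp (hf : AEStronglyMeasurable f) {c : ℝ} (hc : 0 ≤ c)
    (h : Integrable fun x ↦ ‖f x‖ * Real.exp (c * ‖x‖)) : Integrable f :=
  h.mono' hf (Eventually.of_forall fun x ↦
    le_mul_of_one_le_right (norm_nonneg _) (Real.one_le_exp (by positivity)))

/-- Exponential moments of all orders and nonvanishing of the transform. -/
theorem exponential_moments [NeZero n] (hf : Measurable f) (hf2 : MemLp f 2 volume) (hQ : Q ≠ 0)
    (hfin : ∫⁻ x, ∫⁻ y, density f (l2Fourier f hf2) Q d δ x y < ⊤) (hne : ¬ f =ᵐ[volume] 0) :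
    (∀ c : ℝ, Integrable fun x ↦ ‖f x‖ * Real.exp (c * ‖x‖)) ∧ ∀ᵐ y, fourierInt f y ≠ 0 := by
  have hfm := hf.aestronglyMeasurable (μ := (volume : Measure (EuclideanSpace ℝ (Fin n))))
  have hae := ae_lintegral_density_lt_top hf (measurable_l2Fourier hf2) hfin
  have hQae := ae_polyValue_ne_zero hQ
  have hfreq : ∃ᶠ y in ae volume, l2Fourier f hf2 y ≠ 0 := by
    intro h
    refine hne (ae_eq_of_l2Fourier_ae_eq hf2 (MemLp.zero' (p := 2)) ?_)
    filter_upwards [h, l2Fourier_ae_eq (n := n) (MemLp.zero' (p := 2)) (integrable_zero _ _ _)]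
      with y hy hy0
    rw [not_not.1 hy]
    exact (hy0.trans (by simp [fourierInt])).symm
  -- One suitable y ≠ 0 gives a first exponential moment. This makes f̂ analytic along lines, hence
  -- nonzero almost everywhere, so that suitable y of arbitrarily large norm exist and give all the
  -- moments.
  obtain ⟨y, hy1, ⟨hy2, hy3⟩, hy4⟩ := (hfreq.and_eventually ((hae.and hQae).and
    (compl_mem_ae_iff.2 (measure_singleton (0 : EuclideanSpace ℝ (Fin n)))))).exists
  have hy0 : 0 < ‖y‖ := norm_pos_iff.2 hy4
  have hhalf := integrable_mul_exp_of_density hf hy2 hy1 hy3 (half_lt_self hy0)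
  have hfi := integrable_of_integrable_mul_exp hfm (half_pos hy0).le hhalf
  have hl2 := l2Fourier_ae_eq hf2 hfi
  obtain ⟨p, hp1, hp2⟩ := (hfreq.and_eventually hl2).exists
  have hFne := ae_fourierInt_ne_zero hfm (half_pos hy0) hhalf hfi (hp2 ▸ hp1)
  refine ⟨fun c ↦ ?_, hFne⟩
  have hopen : IsOpen {y : EuclideanSpace ℝ (Fin n) | c < ‖y‖} :=
    isOpen_lt continuous_const continuous_norm
  have hnonempty : {y : EuclideanSpace ℝ (Fin n) | c < ‖y‖}.Nonempty := by
    obtain ⟨y, hy⟩ := NormedSpace.exists_lt_norm ℝ (EuclideanSpace ℝ (Fin n)) c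
    exact ⟨y, hy⟩
  have hfreq' : ∃ᶠ y in ae volume, y ∈ {y : EuclideanSpace ℝ (Fin n) | c < ‖y‖} :=
    frequently_ae_mem_iff.2 (hopen.measure_pos _ hnonempty).ne'
  obtain ⟨z, hz1, ⟨⟨hz2, hz3⟩, hz4⟩, hz5⟩ :=
    (hfreq'.and_eventually (((hae.and hQae).and hFne).and hl2)).exists
  exact integrable_mul_exp_of_density hf hz2 (hz5 ▸ hz4) hz3 hz1

/-- On almost every line through the origin, the one-dimensional weighted double integral is
finite. -/
theorem ae_doubleIntegral_line_lt_top [NeZero n] (hf : Measurable f) (hQ : Q ≠ 0) (hδ : 0 < δ)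
    (hexp : ∀ c : ℝ, Integrable fun x ↦ ‖f x‖ * Real.exp (c * ‖x‖))
    (hfin : ∫⁻ x, ∫⁻ y, density f (fourierInt f) Q d δ x y < ⊤) :
    ∀ᵐ v, doubleIntegral volume f (fun x ↦ ‖v‖ * ‖x‖) (fun r ↦ fourierInt f (r • v))
      (⌈d⌉₊ + 2) (⌈d⌉₊ + 2) < ⊤ := by
  have hfm := hf.aestronglyMeasurable (μ := (volume : Measure (EuclideanSpace ℝ (Fin n))))
  have hfi := integrable_of_integrable_mul_exp hfm zero_le_one (hexp 1)
  have hFm := (continuous_fourierInt hfi).measurable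
  have hG : Measurable fun y ↦ ∫⁻ x, density f (fourierInt f) Q d δ x y :=
    Measurable.lintegral_prod_left' (measurable_density hf hFm)
  have hGfin : ∫⁻ y, ∫⁻ x, density f (fourierInt f) Q d δ x y < ⊤ := by
    rwa [← lintegral_lintegral_swap (measurable_density hf hFm).aemeasurable]
  filter_upwards [ae_lintegral_smul_lt_top hG hGfin,
    ae_polyValue_ne_zero (homogeneousComponent_totalDegree_ne_zero hQ),
    compl_mem_ae_iff.2 (measure_singleton (0 : EuclideanSpace ℝ (Fin n)))] with v hv1 hv2 hv3
  have hv0 : 0 < ‖v‖ := norm_pos_iff.2 hv3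
  obtain ⟨c, ρ, S, hc, hρ, hS, hcS⟩ := exists_le_norm_polyValue_smul Q hv2
  set D := ⌈d⌉₊
  -- Beyond S the leading form keeps |Q(rv)| ≥ c|r|^m, so Q can be dropped; beyond 1 so can |r|^n.
  -- The +2 in the exponents absorbs the factor (1+r²)⁻¹ from integration over lines.
  set R := max S 1 with hR
  set κ := 1 + 1 / ‖v‖ + ‖v‖ with hκ
  have hcδ : 0 < c ^ δ := Real.rpow_pos_of_pos hc _
  refine doubleIntegral_lt_top_of_tail (A := ∫ x, ‖f x‖) (fun a ↦ ?_)
    (fun r ↦ norm_fourierInt_le f _) R ?_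
  · have := hexp (a * ‖v‖)
    simp_rw [mul_assoc] at this
    simpa [abs_mul] using this
  refine lt_of_le_of_lt ?_ (ENNReal.mul_lt_top (ENNReal.ofReal_lt_top (r := κ ^ D / c ^ δ)) hv1)
  rw [← lintegral_const_mul' _ _ ENNReal.ofReal_ne_top]
  refine le_trans (setLIntegral_mono' measurableSet_Ioo.compl fun r hr ↦ ?_)
    (setLIntegral_le_lintegral _ _)
  have hrR : R ≤ |r| := by
    by_contra! h
    exact hr (abs_lt.1 h)
  have hr1 : 1 ≤ |r| := (le_max_right _ _).trans hrR
  rw [← lintegral_mul_const' _ _ ENNReal.ofReal_ne_top,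
    ← lintegral_const_mul' _ _ ENNReal.ofReal_ne_top]
  refine lintegral_mono fun x ↦ ?_
  have hW := weight_nonneg (D + 2) (D + 2) (‖v‖ * ‖x‖) r
  rw [density, ← ofReal_norm, ← ofReal_norm, ← ENNReal.ofReal_mul (by positivity),
    ← ENNReal.ofReal_mul (by positivity), ← ENNReal.ofReal_mul (by positivity),
    ← ENNReal.ofReal_mul (by positivity)]
  refine ENNReal.ofReal_le_ofReal ?_
  have hx := norm_nonneg x
  have hQr : c ^ δ ≤ ‖polyValue Q (r • v)‖ ^ δ := by
    refine Real.rpow_le_rpow hc.le ?_ hδ.le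
    exact (le_mul_of_one_le_right hc.le (one_le_pow₀ hr1)).trans
      (hcS r ((le_max_left _ _).trans hrR) v (mem_ball_self hρ))
  have hnorm : ‖r • v‖ = |r| * ‖v‖ := by rw [norm_smul, Real.norm_eq_abs]
  have hsum : (1 + ‖x‖ + ‖r • v‖) ^ d ≤ κ ^ D * ((1 + ‖v‖ * ‖x‖) ^ D * (1 + |r|) ^ D) := by
    refine (rpow_le_pow_ceil (by linarith [norm_nonneg (r • v)])).trans ?_
    rw [← mul_pow, ← mul_pow, hnorm]
    gcongr
    have h1 : 1 / ‖v‖ * (‖v‖ * ‖x‖) = ‖x‖ := by field_simp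
    have h2 : 0 < 1 / ‖v‖ := by positivity
    have h3 : 0 ≤ ‖v‖ * ‖x‖ := by positivity
    have h4 : (1 : ℝ) ≤ 1 + ‖v‖ * ‖x‖ := by linarith
    have h5 : 1 + ‖v‖ * ‖x‖ ≤ (1 + ‖v‖ * ‖x‖) * (1 + |r|) :=
      le_mul_of_one_le_right (by positivity) (by linarith)
    have h6 : 1 + |r| ≤ (1 + ‖v‖ * ‖x‖) * (1 + |r|) :=
      le_mul_of_one_le_left (by positivity) h4
    calc 1 + ‖x‖ + |r| * ‖v‖ ≤ 1 + 1 / ‖v‖ * (1 + ‖v‖ * ‖x‖) + (1 + |r|) * ‖v‖ := by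
          rw [mul_add, h1]
          nlinarith
      _ ≤ (1 + ‖v‖ * ‖x‖) * (1 + |r|) + 1 / ‖v‖ * ((1 + ‖v‖ * ‖x‖) * (1 + |r|)) +
          (1 + ‖v‖ * ‖x‖) * (1 + |r|) * ‖v‖ := by
          gcongr
          linarith
      _ = _ := by rw [hκ]; ring
  have hsq : 1 + r ^ 2 ≤ (1 + |r|) ^ 2 := by
    rw [← sq_abs]
    nlinarith [abs_nonneg r]
  have hpos : 0 < (1 + ‖x‖ + ‖r • v‖) ^ d := Real.rpow_pos_of_pos (by positivity) _
  have hrn : 1 ≤ |r| ^ Module.finrank ℝ (EuclideanSpace ℝ (Fin n)) := one_le_pow₀ hr1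
  have hkey : weight (D + 2) (D + 2) (‖v‖ * ‖x‖) r ≤ κ ^ D / c ^ δ * (Real.exp (‖x‖ * ‖r • v‖) *
      ‖polyValue Q (r • v)‖ ^ δ / (1 + ‖x‖ + ‖r • v‖) ^ d * (1 + r ^ 2)⁻¹) := by
    have h7 : Real.exp (‖x‖ * ‖r • v‖) = Real.exp (|‖v‖ * ‖x‖| * |r|) := by
      rw [hnorm, abs_of_nonneg (by positivity : 0 ≤ ‖v‖ * ‖x‖)]
      ring_nf
    rw [h7, weight, ← div_eq_mul_inv, div_div, div_mul_div_comm, div_le_div_iff₀ (by positivity)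
      (by positivity), abs_of_nonneg (by positivity : 0 ≤ ‖v‖ * ‖x‖)]
    calc Real.exp (‖v‖ * ‖x‖ * |r|) * (c ^ δ * ((1 + ‖x‖ + ‖r • v‖) ^ d * (1 + r ^ 2)))
        ≤ Real.exp (‖v‖ * ‖x‖ * |r|) * (‖polyValue Q (r • v)‖ ^ δ *
          (κ ^ D * ((1 + ‖v‖ * ‖x‖) ^ D * (1 + |r|) ^ D) * (1 + |r|) ^ 2)) := by gcongr
      _ = κ ^ D * (Real.exp (‖v‖ * ‖x‖ * |r|) * ‖polyValue Q (r • v)‖ ^ δ) *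
          ((1 + ‖v‖ * ‖x‖) ^ D * (1 + |r|) ^ (D + 2)) := by ring
      _ ≤ _ := by
          gcongr
          · linarith [show 0 ≤ ‖v‖ * ‖x‖ by positivity]
          · omega
  calc ‖f x‖ * ‖fourierInt f (r • v)‖ * weight (D + 2) (D + 2) (‖v‖ * ‖x‖) r
      ≤ ‖f x‖ * ‖fourierInt f (r • v)‖ * (κ ^ D / c ^ δ * (Real.exp (‖x‖ * ‖r • v‖) *
        ‖polyValue Q (r • v)‖ ^ δ / (1 + ‖x‖ + ‖r • v‖) ^ d * (1 + r ^ 2)⁻¹)) := by gcongr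
    _ ≤ ‖f x‖ * ‖fourierInt f (r • v)‖ * (κ ^ D / c ^ δ * (Real.exp (‖x‖ * ‖r • v‖) *
        ‖polyValue Q (r • v)‖ ^ δ / (1 + ‖x‖ + ‖r • v‖) ^ d *
          (|r| ^ Module.finrank ℝ (EuclideanSpace ℝ (Fin n)) * (1 + r ^ 2)⁻¹))) := by
        gcongr
        exact le_mul_of_one_le_left (by positivity) hrn
    _ = _ := by ring

end Space

/-! ### Exponential moments against Gaussian exponents -/

section Moment

variable {X : Type*} {f : X → ℂ} {t : X → ℝ} [MeasurableSpace X] {μ : Measure X}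

/-- Finiteness of the weighted double integral bounds the exponential moments in terms of the
Gaussian factor of the transform. -/
theorem exists_moment_le {D : ℕ} {P : Polynomial ℂ} (hP : P ≠ 0) {a : ℂ}
    (hexp : ∀ c : ℝ, Integrable (fun x ↦ ‖f x‖ * Real.exp (c * |t x|)) μ)
    (hfin : doubleIntegral μ f t (fun r ↦ P.eval (r : ℂ) * exp (a * r ^ 2)) D D < ⊤) :
    ∃ C : ℝ, ∀ᶠ R : ℝ in atTop,
      ∫ x, ‖f x‖ * Real.exp (R * |t x|) ∂μ ≤ Real.exp (-a.re * R ^ 2 + C * R) := by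
  obtain ⟨c, R₀, hc, hcP⟩ := exists_le_norm_eval hP
  set J := (doubleIntegral μ f t (fun r ↦ P.eval (r : ℂ) * exp (a * r ^ 2)) D D).toReal with hJ
  have hJ0 : 0 ≤ J := ENNReal.toReal_nonneg
  set K := J * (D.factorial : ℝ) ^ 2 / c with hK
  have hK0 : 0 ≤ K := by positivity
  refine ⟨8 * |a.re| + 5 + K, ?_⟩
  filter_upwards [eventually_ge_atTop 1, eventually_ge_atTop R₀] with R hR1 hR0
  set α := a.re with hα
  set m := ∫ x, ‖f x‖ * Real.exp (R * |t x|) ∂μ with hm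
  have hm0 : 0 ≤ m := integral_nonneg fun x ↦ by positivity
  set B := c * Real.exp (α * R ^ 2 - |α| * (4 * R + 4)) /
    ((D.factorial : ℝ) ^ 2 * Real.exp (4 + R)) with hB
  have hB0 : 0 < B := by positivity
  have hpow : ∀ s : ℝ, 0 ≤ s → s ^ D ≤ D.factorial * Real.exp s := fun s hs ↦ by
    have := Real.pow_div_factorial_le_exp s hs D
    rwa [div_le_iff₀ (by positivity), mul_comm] at this
  -- For r in [R+1, R+2] the weight has a spare factor e^{|t|}, which absorbs (1+|t|)^D; replacing
  -- r² by R² and bounding (1+r)^D cost only e^{O(R)}.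
  have hlow : ∀ r ∈ Icc (R + 1) (R + 2), ∀ x, B * Real.exp (R * |t x|) ≤
      ‖P.eval (r : ℂ) * exp (a * r ^ 2)‖ * weight D D (t x) r := by
    rintro r ⟨hr1, hr2⟩ x
    have hr0 : 0 ≤ r := by linarith
    have ht0 := abs_nonneg (t x)
    have h1 : c * Real.exp (α * R ^ 2 - |α| * (4 * R + 4)) ≤
        ‖P.eval (r : ℂ) * exp (a * r ^ 2)‖ := by
      rw [norm_mul, norm_exp]
      gcongr
      · refine hcP _ ?_
        rw [norm_real, Real.norm_of_nonneg hr0]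
        linarith
      · have : (a * (r : ℂ) ^ 2).re = α * r ^ 2 := by
          rw [← ofReal_pow, re_mul_ofReal]
        rw [this]
        have h2 : 0 ≤ r ^ 2 - R ^ 2 := by nlinarith
        have h3 : r ^ 2 - R ^ 2 ≤ 4 * R + 4 := by nlinarith
        nlinarith [neg_abs_le α, abs_nonneg α]
    have h2 : Real.exp (R * |t x|) / ((D.factorial : ℝ) ^ 2 * Real.exp (4 + R)) ≤
        weight D D (t x) r := by
      rw [weight, abs_of_nonneg hr0, div_le_div_iff₀ (by positivity) (by positivity)]
      have e1 := hpow (1 + |t x|) (by positivity)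
      have e2 : (1 + r) ^ D ≤ D.factorial * Real.exp (3 + R) :=
        (hpow (1 + r) (by positivity)).trans
            (mul_le_mul_of_nonneg_left (Real.exp_le_exp.2 (by linarith)) (by positivity))
      calc Real.exp (R * |t x|) * ((1 + |t x|) ^ D * (1 + r) ^ D)
          ≤ Real.exp (R * |t x|) *
            (D.factorial * Real.exp (1 + |t x|) * (D.factorial * Real.exp (3 + R))) := by gcongr
        _ = Real.exp (|t x| * (R + 1)) * ((D.factorial : ℝ) ^ 2 * Real.exp (4 + R)) := by
            have : Real.exp (R * |t x|) * Real.exp (1 + |t x|) * Real.exp (3 + R) =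
                Real.exp (|t x| * (R + 1)) * Real.exp (4 + R) := by
              rw [← Real.exp_add, ← Real.exp_add, ← Real.exp_add]
              ring_nf
            linear_combination (D.factorial : ℝ) ^ 2 * this
        _ ≤ _ := by gcongr
    calc B * Real.exp (R * |t x|) = c * Real.exp (α * R ^ 2 - |α| * (4 * R + 4)) *
          (Real.exp (R * |t x|) / ((D.factorial : ℝ) ^ 2 * Real.exp (4 + R))) := by
          rw [hB]
          ring
      _ ≤ _ := by gcongr
  have hint : ENNReal.ofReal (B * m) ≤
      doubleIntegral μ f t (fun r ↦ P.eval (r : ℂ) * exp (a * r ^ 2)) D D := by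
    have h1 : ENNReal.ofReal (B * m) =
        ∫⁻ _ in Icc (R + 1) (R + 2), ENNReal.ofReal (B * m) := by
      rw [setLIntegral_const, Real.volume_Icc]
      norm_num
    rw [h1, doubleIntegral]
    refine le_trans (setLIntegral_mono' measurableSet_Icc fun r hr ↦ ?_)
      (setLIntegral_le_lintegral _ _)
    rw [ENNReal.ofReal_mul hB0.le, hm, ofReal_integral_eq_lintegral_ofReal (hexp R)
      (Eventually.of_forall fun x ↦ by positivity), ← lintegral_const_mul' _ _ ENNReal.ofReal_ne_top]
    refine lintegral_mono fun x ↦ ?_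
    rw [← ENNReal.ofReal_mul hB0.le, ← ofReal_norm, ← ofReal_norm,
      ← ENNReal.ofReal_mul (by positivity), ← ENNReal.ofReal_mul (by positivity)]
    refine ENNReal.ofReal_le_ofReal ?_
    calc B * (‖f x‖ * Real.exp (R * |t x|)) = ‖f x‖ * (B * Real.exp (R * |t x|)) := by ring
      _ ≤ ‖f x‖ * (‖P.eval (r : ℂ) * exp (a * r ^ 2)‖ * weight D D (t x) r) :=
          mul_le_mul_of_nonneg_left (hlow r hr x) (norm_nonneg _)
      _ = _ := by ring
  have hBm : B * m ≤ J := by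
    rw [hJ]
    exact (ENNReal.ofReal_le_iff_le_toReal hfin.ne).1 hint
  have hmK : m ≤ K * Real.exp (-α * R ^ 2 + |α| * (4 * R + 4) + (4 + R)) := by
    have h1 : m ≤ J / B := by rw [le_div_iff₀ hB0]; linarith
    refine h1.trans_eq ?_
    have h2 : Real.exp (-α * R ^ 2 + |α| * (4 * R + 4) + (4 + R)) =
        (Real.exp (α * R ^ 2 - |α| * (4 * R + 4)))⁻¹ * Real.exp (4 + R) := by
      rw [← Real.exp_neg, ← Real.exp_add]
      ring_nf
    rw [h2, hK, hB]
    field_simp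
  refine hmK.trans ?_
  have h3 : K ≤ Real.exp (K * R) :=
    (by linarith [Real.add_one_le_exp K] : K ≤ Real.exp K).trans (by gcongr; nlinarith)
  calc K * Real.exp (-α * R ^ 2 + |α| * (4 * R + 4) + (4 + R))
      ≤ Real.exp (K * R) * Real.exp (-α * R ^ 2 + |α| * (4 * R + 4) + (4 + R)) := by gcongr
    _ = Real.exp (K * R + (-α * R ^ 2 + |α| * (4 * R + 4) + (4 + R))) := by rw [← Real.exp_add]
    _ ≤ _ := Real.exp_le_exp.2 (by nlinarith [abs_nonneg α])

theorem le_of_eventually_mul_exp_sq_le {c A B C : ℝ} (hc : 0 < c)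
    (h : ∀ᶠ R : ℝ in atTop, c * Real.exp (A * R ^ 2) ≤ Real.exp (B * R ^ 2 + C * R)) : A ≤ B := by
  by_contra! hAB
  have h1 : Tendsto (fun R : ℝ ↦ R * ((A - B) * R - C)) atTop atTop :=
    tendsto_id.atTop_mul_atTop₀ (tendsto_atTop_add_const_right _ _
      (tendsto_id.const_mul_atTop (sub_pos.2 hAB)))
  obtain ⟨R, hR, hR2⟩ := (h.and (h1.eventually_gt_atTop (-Real.log c))).exists
  rw [← Real.exp_log hc, ← Real.exp_add, Real.exp_le_exp] at hR
  nlinarith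

/-- Expanding gives x²·Re a - 2x·Im a ≤ 0 for every real x. This vanishes at x = 0, so its slope
there is zero and its leading coefficient is not positive. -/
theorem im_eq_zero_of_forall_re_le {a : ℂ}
    (h : ∀ x : ℝ, (a * (x + I) ^ 2).re ≤ -a.re) : a.im = 0 ∧ a.re ≤ 0 := by
  have h' : ∀ x : ℝ, x ^ 2 * a.re ≤ 2 * x * a.im := fun x ↦ by
    have := h x
    simp [pow_two] at this
    nlinarith
  have h1 := h' 1
  have h2 := h' (-1)
  have hA : a.re ≤ 0 := by linarith
  refine ⟨?_, hA⟩
  rcases hA.eq_or_lt with h0 | h0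
  · have := h' (-a.im)
    rw [h0] at this
    nlinarith
  · have := h' (a.im / a.re)
    have e1 : (a.im / a.re) ^ 2 * a.re = a.im ^ 2 / a.re := by field_simp
    have e2 : 2 * (a.im / a.re) * a.im = 2 * (a.im ^ 2 / a.re) := by ring
    rw [e1, e2] at this
    have e3 : 0 ≤ a.im ^ 2 / a.re := by linarith
    by_contra hne
    have : a.im ^ 2 / a.re < 0 := div_neg_of_pos_of_neg (by positivity) h0
    linarith

end Moment

/-! ### Comparison of exponents on different lines -/

section Lines

variable {E : Type*} [NormedAddCommGroup E] [InnerProductSpace ℝ E] [FiniteDimensional ℝ E]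
  [MeasurableSpace E] [BorelSpace E] {f : E → ℂ}

/-- Comparison of the Gaussian exponents of the transform along two lines. -/
theorem re_mul_sq_le (hfm : AEStronglyMeasurable f)
    (hexp : ∀ c : ℝ, Integrable fun x ↦ ‖f x‖ * Real.exp (c * ‖x‖)) {v w : E} (hv : v ≠ 0)
    (hw : w ≠ 0) {D : ℕ} {P P' : Polynomial ℂ} (hP : P ≠ 0) (hP' : P' ≠ 0) {a b : ℂ}
    (hfin : doubleIntegral volume f (fun x ↦ ‖v‖ * ‖x‖)
      (fun r ↦ P.eval (r : ℂ) * exp (a * r ^ 2)) D D < ⊤)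
    (hb : ∀ z, laplace volume f (fun x ↦ ⟪w, x⟫) z = P'.eval z * exp (b * z ^ 2)) {u : ℂ}
    (hu : 0 < u.im) : (b * u ^ 2).re ≤ -a.re * (u.im * ‖w‖ / ‖v‖) ^ 2 := by
  have hv0 : 0 < ‖v‖ := norm_pos_iff.2 hv
  have hw0 : 0 < ‖w‖ := norm_pos_iff.2 hw
  -- With this k, R·Im u·‖w‖‖x‖ = Rk·‖v‖‖x‖: the radial moments on the line of v bound the transform
  -- on the line of w at Ru. This is why the double integral keeps ‖v‖‖x‖ instead of ⟪v, x⟫.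
  set k := u.im * ‖w‖ / ‖v‖ with hk
  have hk0 : 0 < k := by positivity
  obtain ⟨C, hC⟩ := exists_moment_le (t := fun x ↦ ‖v‖ * ‖x‖) hP (fun c ↦ by
    have := hexp (c * ‖v‖)
    simp_rw [mul_assoc] at this
    simpa [abs_mul] using this) hfin
  obtain ⟨c, R₀, hc, hcP⟩ := exists_le_norm_eval hP'
  refine le_of_eventually_mul_exp_sq_le (C := C * k) hc ?_
  have hu0 : 0 < ‖u‖ := norm_pos_iff.2 fun h ↦ by simp [h] at hu
  filter_upwards [(tendsto_id.atTop_mul_const hk0).eventually hC, eventually_gt_atTop 0,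
    (tendsto_id.atTop_mul_const hu0).eventually_ge_atTop R₀] with R h1 hR h2
  have h3 := norm_laplace_le (t := fun x ↦ ⟪w, x⟫)
    (integrable_mul_exp_inner_of_forall hfm hexp w) (R * u)
  rw [hb, norm_mul, norm_exp] at h3
  have h4 : (b * (R * u) ^ 2).re = (b * u ^ 2).re * R ^ 2 := by
    rw [← re_mul_ofReal]
    congr 1
    push_cast
    ring
  have h5 : |((R : ℂ) * u).im| = R * u.im := by
    rw [im_ofReal_mul, abs_of_pos (by positivity)]
  rw [h4, h5] at h3
  calc c * Real.exp ((b * u ^ 2).re * R ^ 2)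
      ≤ ‖P'.eval (R * u)‖ * Real.exp ((b * u ^ 2).re * R ^ 2) := by
        gcongr
        refine hcP _ ?_
        rw [norm_mul, norm_real, Real.norm_of_nonneg hR.le]
        exact h2
    _ ≤ _ := h3
    _ ≤ ∫ x, ‖f x‖ * Real.exp (R * k * |‖v‖ * ‖x‖|) := by
        refine integral_mono (integrable_mul_exp_inner_of_forall hfm hexp w _) ?_ fun x ↦ ?_
        · have := hexp (R * k * ‖v‖)
          simp_rw [mul_assoc] at this ⊢
          simpa [abs_mul] using this
        · dsimp only
          gcongr ‖f x‖ * Real.exp ?_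
          rw [abs_of_nonneg (by positivity : 0 ≤ ‖v‖ * ‖x‖), hk]
          have : R * (u.im * ‖w‖ / ‖v‖) * (‖v‖ * ‖x‖) = R * u.im * (‖w‖ * ‖x‖) := by
            field_simp
          rw [this]
          gcongr
          exact abs_real_inner_le_norm w x
    _ ≤ _ := h1
    _ = _ := by
        congr 1
        simp only [id]
        ring

end Lines

/-! ### One Gaussian for almost all lines -/

section Space

variable {n : ℕ} {f : EuclideanSpace ℝ (Fin n) → ℂ}

theorem tendsto_fourierInt_smul (f : EuclideanSpace ℝ (Fin n) → ℂ) {v : EuclideanSpace ℝ (Fin n)}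
    (hv : v ≠ 0) : Tendsto (fun r : ℝ ↦ fourierInt f (r • v)) atTop (𝓝 0) := by
  simp_rw [fourierInt_eq_fourier]
  refine (tendsto_integral_exp_inner_smul_cocompact f).comp ?_
  rw [← cobounded_eq_cocompact, ← tendsto_norm_atTop_iff_cobounded]
  simp_rw [norm_smul, ← mul_assoc]
  exact ((tendsto_norm_atTop_atTop.const_mul_atTop
    (norm_pos_iff.2 (by positivity))).atTop_mul_const
    (norm_pos_iff.2 hv))

/-- Under the line-wise Beurling condition, the transform is, on almost every line through the
origin, a polynomial of bounded degree times one and the same Gaussian. -/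
theorem exists_gaussian_on_lines [NeZero n] (hf : Measurable f)
    (hexp : ∀ c : ℝ, Integrable fun x ↦ ‖f x‖ * Real.exp (c * ‖x‖))
    (hne : ∀ᵐ y, fourierInt f y ≠ 0) {D : ℕ}
    (hfin : ∀ᵐ v, doubleIntegral volume f (fun x ↦ ‖v‖ * ‖x‖) (fun r ↦ fourierInt f (r • v))
      D D < ⊤) :
    ∃ a : ℝ, 0 < a ∧ ∀ᵐ v, ∃ P : Polynomial ℂ, P.natDegree ≤ 3 * D + 1 ∧
      ∀ r : ℝ, fourierInt f (r • v) = P.eval (r : ℂ) * Real.exp (-a * ‖r • v‖ ^ 2) := by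
  have hfm := hf.aestronglyMeasurable (μ := (volume : Measure (EuclideanSpace ℝ (Fin n))))
  have key : ∀ᵐ v, v ≠ 0 ∧ ∃ (P : Polynomial ℂ) (a : ℂ), P ≠ 0 ∧ P.natDegree ≤ 3 * D + 1 ∧
      (∀ z, laplace volume f (fun x ↦ ⟪v, x⟫) z = P.eval z * exp (a * z ^ 2)) ∧
      doubleIntegral volume f (fun x ↦ ‖v‖ * ‖x‖)
        (fun r ↦ P.eval (r : ℂ) * exp (a * r ^ 2)) D D < ⊤ := by
    filter_upwards [hfin, hne,
      compl_mem_ae_iff.2 (measure_singleton (0 : EuclideanSpace ℝ (Fin n)))] with v hv1 hv2 hv3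
    have hl : ∀ r : ℝ, fourierInt f (r • v) = laplace volume f (fun x ↦ ⟪v, x⟫) r :=
      fourierInt_smul f v
    have hfin' : doubleIntegral volume f (fun x ↦ ⟪v, x⟫)
        (fun r ↦ laplace volume f (fun x ↦ ⟪v, x⟫) r) D D < ⊤ := by
      simp_rw [← hl]
      refine doubleIntegral_lt_top_of_abs_le (integrable_mul_exp_inner_of_forall hfm hexp v)
        (fun r ↦ norm_fourierInt_le f _) (fun x ↦ ?_) hv1
      rw [abs_of_nonneg (by positivity : 0 ≤ ‖v‖ * ‖x‖)]
      exact abs_real_inner_le_norm v x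
    obtain ⟨P, a, hPd, hP⟩ := exists_laplace_eq_polynomial_mul_gaussian hf
      (measurable_inner_left v) (integrable_mul_exp_inner_of_forall hfm hexp v) hfin'
    refine ⟨hv3, P, a, ?_, hPd, hP, ?_⟩
    · rintro rfl
      have := hl 1
      rw [hP, one_smul] at this
      exact hv2 (by simpa using this)
    · simpa only [hl, hP] using hv1
  obtain ⟨v, hv, P, b, hP0, -, hP, hPfin⟩ := key.exists
  -- Comparing a line with itself along u = x + i, for all real x, makes its exponent real and
  -- nonpositive.
  have hreal := im_eq_zero_of_forall_re_le (a := b) fun x ↦ by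
    have := re_mul_sq_le hfm hexp hv hv hP0 hP0 hPfin hP (u := x + I) (by simp)
    rwa [add_im, ofReal_im, I_im, zero_add, one_mul, div_self (norm_ne_zero_iff.2 hv), one_pow,
      mul_one] at this
  have hv0 : 0 < ‖v‖ := norm_pos_iff.2 hv
  set a := -b.re / ‖v‖ ^ 2 with ha
  have hcmp : ∀ᵐ w, ∃ P : Polynomial ℂ, P ≠ 0 ∧ P.natDegree ≤ 3 * D + 1 ∧
      ∀ r : ℝ, fourierInt f (r • w) = P.eval (r : ℂ) * Real.exp (-a * ‖r • w‖ ^ 2) := by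
    filter_upwards [key] with w ⟨hw, P', b', hP'0, hP'd, hP', hP'fin⟩
    refine ⟨P', hP'0, hP'd, fun r ↦ ?_⟩
    have hw0 : 0 < ‖w‖ := norm_pos_iff.2 hw
    -- With u = i the two comparisons are opposite inequalities, so the exponents scale exactly as
    -- ‖w‖² and ‖v‖².
    have h1 := re_mul_sq_le hfm hexp hv hw hP0 hP'0 hPfin hP' (u := I) (by simp)
    have h2 := re_mul_sq_le hfm hexp hw hv hP'0 hP0 hP'fin hP (u := I) (by simp)
    have h3 := (im_eq_zero_of_forall_re_le (a := b') fun x ↦ by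
      have := re_mul_sq_le hfm hexp hw hw hP'0 hP'0 hP'fin hP' (u := x + I) (by simp)
      rwa [add_im, ofReal_im, I_im, zero_add, one_mul, div_self (norm_ne_zero_iff.2 hw), one_pow,
        mul_one] at this).1
    rw [I_sq, mul_neg_one, neg_re, I_im, one_mul, neg_mul, neg_le_neg_iff, div_pow,
      mul_div_assoc', div_le_iff₀ (by positivity)] at h1 h2
    have h4 : b' = ((-a * ‖w‖ ^ 2 : ℝ) : ℂ) := by
      refine Complex.ext ?_ (by rw [h3, ofReal_im])
      rw [ofReal_re, ha]
      field_simp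
      linarith
    rw [fourierInt_smul, hP', h4, norm_smul, mul_pow, Real.norm_eq_abs, sq_abs]
    push_cast
    ring_nf
  refine ⟨a, ?_, hcmp.mono fun w ⟨P, _, h2, h3⟩ ↦ ⟨P, h2, h3⟩⟩
  have ha0 : 0 ≤ a := by
    rw [ha]
    exact div_nonneg (by linarith [hreal.2]) (by positivity)
  -- If a = 0 the transform would be a nonzero polynomial on some line, contradicting its decay by
  -- Riemann–Lebesgue.
  refine ha0.lt_of_ne fun h0 ↦ ?_
  obtain ⟨w, ⟨P, hP0, -, hP⟩, hw⟩ := (hcmp.and (key.mono fun w h ↦ h.1)).exists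
  obtain ⟨c, R₀, hc, hcP⟩ := exists_le_norm_eval hP0
  have h1 := (tendsto_fourierInt_smul f hw).norm
  rw [norm_zero] at h1
  obtain ⟨r, hr1, hr2⟩ := ((h1.eventually_lt_const hc).and (eventually_ge_atTop (max R₀ 0))).exists
  rw [hP, ← h0] at hr1
  refine hr1.not_ge ?_
  have := hcP r (by
    rw [norm_real, Real.norm_of_nonneg ((le_max_right _ _).trans hr2)]
    exact (le_max_left _ _).trans hr2)
  simpa using this

end Space

/-! ### Smooth functions that are polynomial on lines -/

section Taylor

theorem iteratedDeriv_eval_ofReal (p : Polynomial ℂ) (k : ℕ) :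
    iteratedDeriv k (fun r : ℝ ↦ p.eval (r : ℂ)) =
      fun r : ℝ ↦ ((Polynomial.derivative^[k]) p).eval (r : ℂ) := by
  induction k with
  | zero => simp
  | succ k ih =>
    rw [iteratedDeriv_succ, ih, Function.iterate_succ_apply']
    ext r
    exact (((Polynomial.derivative^[k]) p).hasDerivAt (r : ℂ)).comp_ofReal.deriv

variable {n : ℕ}

/-- A continuous multilinear map evaluated on the diagonal is a polynomial. -/
theorem exists_polyValue_eq_diagonal {k : ℕ}
    (T : ContinuousMultilinearMap ℝ (fun _ : Fin k ↦ EuclideanSpace ℝ (Fin n)) ℂ) :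
    ∃ H : MvPolynomial (Fin n) ℂ, ∀ v, T (fun _ ↦ v) = polyValue H v := by
  set e := EuclideanSpace.basisFun (Fin n) ℝ
  refine ⟨∑ s : Fin k → Fin n, MvPolynomial.C (T fun j ↦ e (s j)) * ∏ j, MvPolynomial.X (s j),
    fun v ↦ ?_⟩
  have h1 : (fun _ : Fin k ↦ v) = fun _ ↦ ∑ i, v i • e i := by
    ext1 j
    exact (e.sum_repr v).symm
  conv_lhs => rw [h1]
  rw [T.map_sum, polyValue, map_sum]
  refine Finset.sum_congr rfl fun s _ ↦ ?_
  rw [T.map_smul_univ, map_mul, map_prod, MvPolynomial.eval_C, mul_comm, real_smul]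
  simp

/-- A smooth function which is a polynomial of bounded degree on almost every line through the
origin is a polynomial. -/
theorem exists_polyValue_of_lines {h : EuclideanSpace ℝ (Fin n) → ℂ} {N : ℕ}
    (hh : ContDiff ℝ N h) (hlines : ∀ᵐ v, ∃ P : Polynomial ℂ, P.natDegree ≤ N ∧
      ∀ r : ℝ, h (r • v) = P.eval (r : ℂ)) :
    ∃ H : MvPolynomial (Fin n) ℂ, ∀ v, h v = polyValue H v := by
  choose H hH using fun k : ℕ ↦ exists_polyValue_eq_diagonal (iteratedFDeriv ℝ k h 0)
  -- G is the Taylor polynomial of h at the origin. Where h restricts to P on a line, the k-th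
  -- derivative at 0 is k! times a coefficient of P, so G = h at r = 1; continuity removes the
  -- exceptional null set.
  set G : MvPolynomial (Fin n) ℂ :=
    ∑ k ∈ Finset.range (N + 1), MvPolynomial.C ((k.factorial : ℂ)⁻¹) * H k with hG
  refine ⟨G, fun v ↦ ?_⟩
  refine congrFun (Measure.eq_of_ae_eq (μ := volume) ?_ hh.continuous (continuous_polyValue G)) v
  filter_upwards [hlines] with v ⟨P, hPd, hP⟩
  have hcoeff : ∀ k ≤ N, polyValue (H k) v = k.factorial * P.coeff k := by
    intro k hk
    set L : ℝ →L[ℝ] EuclideanSpace ℝ (Fin n) := ContinuousLinearMap.toSpanSingleton ℝ v with hL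
    have h1 : (h ∘ L) = fun r : ℝ ↦ P.eval (r : ℂ) := by
      ext r
      simp [hL, hP]
    have h2 := L.iteratedFDeriv_comp_right hh 0 (i := k) (by exact_mod_cast hk)
    have h3 := congrArg (fun T : ContinuousMultilinearMap ℝ (fun _ : Fin k ↦ ℝ) ℂ ↦ T fun _ ↦ 1) h2
    simp only [ContinuousMultilinearMap.compContinuousLinearMap_apply, map_zero] at h3
    rw [← iteratedDeriv_eq_iteratedFDeriv, h1, iteratedDeriv_eval_ofReal] at h3
    have h4 : (fun _ : Fin k ↦ L 1) = fun _ ↦ v := by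
      ext1 j
      simp [hL]
    rw [h4, hH] at h3
    rw [← h3]
    dsimp only
    rw [ofReal_zero, ← Polynomial.coeff_zero_eq_eval_zero, Polynomial.coeff_iterate_derivative]
    simp [Nat.descFactorial_self]
  have h1 := hP 1
  rw [one_smul, ofReal_one, Polynomial.eval_eq_sum_range' (Nat.lt_succ_of_le hPd)] at h1
  rw [h1, hG, polyValue, map_sum]
  refine Finset.sum_congr rfl fun k hk ↦ ?_
  have h5 := hcoeff k (Nat.lt_succ_iff.1 (Finset.mem_range.1 hk))
  rw [polyValue] at h5
  rw [map_mul, MvPolynomial.eval_C, h5, one_pow, mul_one, inv_mul_cancel_left₀]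
  exact_mod_cast k.factorial_ne_zero

end Taylor

/-! ### The transform as a polynomial times a Gaussian -/

section Space

variable {n : ℕ} {f : EuclideanSpace ℝ (Fin n) → ℂ}

theorem integrable_pow_mul_of_exp (hfm : AEStronglyMeasurable f)
    (hexp : ∀ c : ℝ, Integrable fun x ↦ ‖f x‖ * Real.exp (c * ‖x‖)) (k : ℕ) :
    Integrable fun x ↦ ‖x‖ ^ k * ‖f x‖ := by
  refine ((hexp 1).const_mul (k.factorial : ℝ)).mono'
    ((Measurable.aestronglyMeasurable (by fun_prop)).mul hfm.norm)
    (Eventually.of_forall fun x ↦ ?_)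
  rw [Real.norm_of_nonneg (by positivity), one_mul]
  have := Real.pow_div_factorial_le_exp ‖x‖ (norm_nonneg x) k
  rw [div_le_iff₀ (by positivity)] at this
  calc ‖x‖ ^ k * ‖f x‖ ≤ Real.exp ‖x‖ * k.factorial * ‖f x‖ := by gcongr
    _ = _ := by ring

theorem contDiff_fourierInt (hfm : AEStronglyMeasurable f)
    (hexp : ∀ c : ℝ, Integrable fun x ↦ ‖f x‖ * Real.exp (c * ‖x‖)) (N : ℕ) :
    ContDiff ℝ N (fourierInt f) := by
  have h : ContDiff ℝ N (𝓕 f) := by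
    have := Real.contDiff_fourier (N := N) fun k _ ↦ integrable_pow_mul_of_exp hfm hexp k
    exact_mod_cast this
  simp_rw [funext (fourierInt_eq_fourier f)]
  exact h.comp (contDiff_const_smul _)

theorem exists_fourierInt_eq_polyValue_mul [NeZero n] (hf : Measurable f)
    (hexp : ∀ c : ℝ, Integrable fun x ↦ ‖f x‖ * Real.exp (c * ‖x‖))
    (hne : ∀ᵐ y, fourierInt f y ≠ 0) {D : ℕ}
    (hfin : ∀ᵐ v, doubleIntegral volume f (fun x ↦ ‖v‖ * ‖x‖) (fun r ↦ fourierInt f (r • v))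
      D D < ⊤) :
    ∃ (a : ℝ) (H : MvPolynomial (Fin n) ℂ), 0 < a ∧
      ∀ y, fourierInt f y = polyValue H y * Real.exp (-a * ‖y‖ ^ 2) := by
  obtain ⟨a, ha, hlines⟩ := exists_gaussian_on_lines hf hexp hne hfin
  have hexpr : ∀ y : EuclideanSpace ℝ (Fin n),
      ((Real.exp (a * ‖y‖ ^ 2) : ℝ) : ℂ) * (Real.exp (-a * ‖y‖ ^ 2) : ℝ) = 1 := fun y ↦ by
    rw [← ofReal_mul, ← Real.exp_add]
    simp
  obtain ⟨H, hH⟩ := exists_polyValue_of_lines (N := 3 * D + 1)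
    (h := fun y ↦ fourierInt f y * (Real.exp (a * ‖y‖ ^ 2) : ℝ))
    ((contDiff_fourierInt hf.aestronglyMeasurable hexp _).mul
      (ofRealCLM.contDiff.comp (Real.contDiff_exp.comp (contDiff_const.mul (contDiff_norm_sq ℝ)))))
    (hlines.mono fun v ⟨P, hPd, hP⟩ ↦ ⟨P, hPd, fun r ↦ by
      rw [hP, mul_assoc, mul_comm (Complex.ofReal _), hexpr, mul_one]⟩)
  refine ⟨a, H, ha, fun y ↦ ?_⟩
  rw [← hH, mul_assoc, hexpr, mul_one]

end Space

/-! ### Growth, derivatives and dilations of polynomials -/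

section Polynomial

variable {n : ℕ}

theorem exists_norm_polyValue_le (P : MvPolynomial (Fin n) ℂ) :
    ∃ (K : ℝ) (N : ℕ), 0 ≤ K ∧ ∀ x, ‖polyValue P x‖ ≤ K * (1 + ‖x‖) ^ N := by
  induction P using MvPolynomial.induction_on with
  | C c => exact ⟨‖c‖, 0, norm_nonneg _, fun x ↦ by simp [polyValue]⟩
  | add p q hp hq =>
    obtain ⟨K, N, hK, h⟩ := hp
    obtain ⟨K', N', hK', h'⟩ := hq
    refine ⟨K + K', max N N', by positivity, fun x ↦ ?_⟩
    have hx : 1 ≤ 1 + ‖x‖ := by linarith [norm_nonneg x]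
    rw [polyValue, map_add]
    calc _ ≤ _ := norm_add_le _ _
      _ ≤ K * (1 + ‖x‖) ^ N + K' * (1 + ‖x‖) ^ N' := add_le_add (h x) (h' x)
      _ ≤ K * (1 + ‖x‖) ^ max N N' + K' * (1 + ‖x‖) ^ max N N' := by
          gcongr
          · exact le_max_left _ _
          · exact le_max_right _ _
      _ = _ := by ring
  | mul_X p i hp =>
    obtain ⟨K, N, hK, h⟩ := hp
    refine ⟨K, N + 1, hK, fun x ↦ ?_⟩
    rw [polyValue, map_mul, MvPolynomial.eval_X, norm_mul, pow_succ, ← mul_assoc, norm_real]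
    gcongr
    · exact h x
    · exact (PiLp.norm_apply_le x i).trans (by linarith)

theorem totalDegree_pderiv_le (i : Fin n) (P : MvPolynomial (Fin n) ℂ) :
    (MvPolynomial.pderiv i P).totalDegree ≤ P.totalDegree := by
  conv_lhs => rw [P.as_sum, map_sum]
  refine MvPolynomial.totalDegree_finsetSum_le fun s hs ↦ ?_
  rw [MvPolynomial.pderiv_monomial]
  refine (MvPolynomial.totalDegree_monomial_le _ _).trans ?_
  refine le_trans ?_ (MvPolynomial.le_totalDegree hs)
  exact Finsupp.degree_mono tsub_le_self

theorem hasDerivAt_polyValue_line (P : MvPolynomial (Fin n) ℂ) (i : Fin n)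
    (x : EuclideanSpace ℝ (Fin n)) :
    HasDerivAt (fun r : ℝ ↦ polyValue P (x + r • EuclideanSpace.single i 1))
      (polyValue (MvPolynomial.pderiv i P) x) 0 := by
  induction P using MvPolynomial.induction_on with
  | C c => simpa [polyValue] using hasDerivAt_const (0 : ℝ) c
  | add p q hp hq =>
    simp only [polyValue, map_add] at hp hq ⊢
    exact hp.add hq
  | mul_X p j hp =>
    have hX : HasDerivAt (fun r : ℝ ↦ (((x + r • EuclideanSpace.single i (1 : ℝ)) j : ℝ) : ℂ))
        (if j = i then 1 else 0) 0 := by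
      have h1 : HasDerivAt (fun r : ℝ ↦ x j + r * (if j = i then 1 else 0))
          (if j = i then 1 else 0) 0 := by
        simpa using ((hasDerivAt_id (0 : ℝ)).mul_const (if j = i then (1 : ℝ) else 0)).const_add (x j)
      have h2 := h1.ofReal_comp
      convert! h2 using 1
      · ext r
        simp
      · split_ifs <;> simp
    have := hp.mul hX
    simp only [polyValue, map_mul, MvPolynomial.eval_X, Derivation.leibniz, smul_eq_mul, map_add,
      MvPolynomial.pderiv_X] at this ⊢
    convert! this using 1
    simp [Pi.single_apply, apply_ite]
    split_ifs <;> simp_all [add_comm, mul_comm]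

/-- Rescaling the variables of a polynomial. -/
theorem exists_polyValue_smul (P : MvPolynomial (Fin n) ℂ) (c : ℝ) :
    ∃ P' : MvPolynomial (Fin n) ℂ, P'.totalDegree ≤ P.totalDegree ∧
      ∀ x, polyValue P' x = polyValue P (c • x) := by
  refine ⟨∑ k ∈ Finset.range (P.totalDegree + 1), MvPolynomial.C ((c : ℂ) ^ k) *
    MvPolynomial.homogeneousComponent k P, MvPolynomial.totalDegree_finsetSum_le fun k hk ↦ ?_,
    fun x ↦ ?_⟩
  · refine (MvPolynomial.totalDegree_mul _ _).trans ?_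
    rw [MvPolynomial.totalDegree_C, zero_add]
    exact (MvPolynomial.homogeneousComponent_isHomogeneous k P).totalDegree_le.trans
      (Nat.lt_succ_iff.1 (Finset.mem_range.1 hk))
  · conv_rhs => rw [← P.sum_homogeneousComponent]
    rw [polyValue, polyValue, map_sum, map_sum]
    refine Finset.sum_congr rfl fun k _ ↦ ?_
    rw [map_mul, MvPolynomial.eval_C]
    exact (polyValue_smul_of_isHomogeneous
      (MvPolynomial.homogeneousComponent_isHomogeneous k P) c x).symm

end Polynomial

/-! ### Fourier transforms of polynomials times Gaussians -/

section Gaussian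

variable {n : ℕ} {b : ℝ}

/-- A polynomial times the Gaussian `e^{-b|x|²}`. -/
noncomputable def polyGauss (b : ℝ) (P : MvPolynomial (Fin n) ℂ) (x : EuclideanSpace ℝ (Fin n)) :
    ℂ :=
  polyValue P x * (Real.exp (-b * ‖x‖ ^ 2) : ℂ)

theorem continuous_polyGauss (b : ℝ) (P : MvPolynomial (Fin n) ℂ) : Continuous (polyGauss b P) := by
  have := continuous_polyValue P
  unfold polyGauss
  fun_prop

theorem norm_polyGauss (b : ℝ) (P : MvPolynomial (Fin n) ℂ) (x : EuclideanSpace ℝ (Fin n)) :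
    ‖polyGauss b P x‖ = ‖polyValue P x‖ * Real.exp (-b * ‖x‖ ^ 2) := by
  rw [polyGauss, norm_mul, norm_real, Real.norm_of_nonneg (Real.exp_pos _).le]

theorem integrable_exp_neg_mul_norm_sq (hb : 0 < b) :
    Integrable fun x : EuclideanSpace ℝ (Fin n) ↦ Real.exp (-b * ‖x‖ ^ 2) := by
  have h := (GaussianFourier.integrable_cexp_neg_mul_sq_norm_add (V := EuclideanSpace ℝ (Fin n))
    (b := (b : ℂ)) (by simpa) 0 0).norm
  refine h.congr (Eventually.of_forall fun x ↦ ?_)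
  dsimp only
  rw [norm_exp, zero_mul, add_zero, ← ofReal_neg, ← ofReal_pow, ← ofReal_mul, ofReal_re]

theorem integrable_polyGauss_mul_exp (hb : 0 < b) (P : MvPolynomial (Fin n) ℂ) (c : ℝ) :
    Integrable fun x ↦ ‖polyGauss b P x‖ * Real.exp (c * ‖x‖) := by
  obtain ⟨K, N, hK, hP⟩ := exists_norm_polyValue_le P
  set κ := |c| + 1 with hκ
  set A := K * N.factorial * Real.exp (1 + κ ^ 2 / (2 * b)) with hA
  have hc := continuous_polyGauss b P
  refine ((integrable_exp_neg_mul_norm_sq (n := n) (half_pos hb)).const_mul A).mono'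
    (Continuous.aestronglyMeasurable (by fun_prop)) (Eventually.of_forall fun x ↦ ?_)
  have hx := norm_nonneg x
  rw [Real.norm_of_nonneg (by positivity), norm_polyGauss]
  have h1 : (1 + ‖x‖) ^ N ≤ N.factorial * Real.exp (1 + ‖x‖) := by
    have := Real.pow_div_factorial_le_exp (1 + ‖x‖) (by positivity) N
    rwa [div_le_iff₀ (by positivity), mul_comm] at this
  have h2 : κ * ‖x‖ ≤ κ ^ 2 / (2 * b) + b / 2 * ‖x‖ ^ 2 := by
    have : κ ^ 2 / (2 * b) + b / 2 * ‖x‖ ^ 2 - κ * ‖x‖ = (κ - b * ‖x‖) ^ 2 / (2 * b) := by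
      field_simp
      ring
    have h3 : 0 ≤ (κ - b * ‖x‖) ^ 2 / (2 * b) := by positivity
    linarith
  calc ‖polyValue P x‖ * Real.exp (-b * ‖x‖ ^ 2) * Real.exp (c * ‖x‖)
      ≤ K * (N.factorial * Real.exp (1 + ‖x‖)) * Real.exp (-b * ‖x‖ ^ 2) *
        Real.exp (|c| * ‖x‖) := by
        gcongr
        · exact (hP x).trans (by gcongr)
        · exact le_abs_self c
    _ = K * N.factorial * Real.exp (1 + κ * ‖x‖ - b * ‖x‖ ^ 2) := by
        have : Real.exp (1 + κ * ‖x‖ - b * ‖x‖ ^ 2) =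
            Real.exp (1 + ‖x‖) * Real.exp (-b * ‖x‖ ^ 2) * Real.exp (|c| * ‖x‖) := by
          rw [← Real.exp_add, ← Real.exp_add, hκ]
          ring_nf
        rw [this]
        ring
    _ ≤ K * N.factorial * Real.exp (1 + κ ^ 2 / (2 * b) + -(b / 2) * ‖x‖ ^ 2) := by
        gcongr
        linarith
    _ = _ := by
        rw [hA, Real.exp_add (1 + κ ^ 2 / (2 * b))]
        ring

theorem integrable_polyGauss (hb : 0 < b) (P : MvPolynomial (Fin n) ℂ) :
    Integrable (polyGauss b P) :=
  integrable_of_integrable_mul_exp (continuous_polyGauss b P).aestronglyMeasurable le_rfl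
    (integrable_polyGauss_mul_exp hb P 0)

theorem memLp_polyGauss (hb : 0 < b) (P : MvPolynomial (Fin n) ℂ) :
    MemLp (polyGauss b P) 2 volume := by
  rw [memLp_two_iff_integrable_sq_norm (continuous_polyGauss b P).aestronglyMeasurable]
  refine (integrable_polyGauss (mul_pos two_pos hb) (P * P)).norm.congr
    (Eventually.of_forall fun x ↦ ?_)
  dsimp only
  rw [norm_polyGauss, norm_polyGauss, polyValue, map_mul, norm_mul, mul_pow, ← Real.exp_nat_mul,
    polyValue]
  push_cast
  ring_nf

theorem integrable_norm_mul_polyGauss (hb : 0 < b) (P : MvPolynomial (Fin n) ℂ) :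
    Integrable fun x ↦ ‖x‖ * ‖polyGauss b P x‖ := by
  simpa using integrable_pow_mul_of_exp (continuous_polyGauss b P).aestronglyMeasurable
    (integrable_polyGauss_mul_exp hb P) 1

/-- Differentiation of the Fourier integral along a line. -/
theorem hasDerivAt_fourierInt_line {g : EuclideanSpace ℝ (Fin n) → ℂ} (hg : Integrable g)
    (hg' : Integrable fun x ↦ ‖x‖ * ‖g x‖) (y v : EuclideanSpace ℝ (Fin n)) :
    HasDerivAt (fun r : ℝ ↦ fourierInt g (y + r • v))
      (fourierInt (fun x ↦ -I * (⟪v, x⟫ : ℝ) * g x) y) 0 := by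
  have hm : ∀ y : EuclideanSpace ℝ (Fin n),
      AEStronglyMeasurable (fun x ↦ g x * exp (-(I * (⟪y, x⟫ : ℝ)))) := fun y ↦
    hg.aestronglyMeasurable.mul (Measurable.aestronglyMeasurable (by fun_prop))
  have hn : ∀ y x : EuclideanSpace ℝ (Fin n), ‖exp (-(I * (⟪y, x⟫ : ℝ)))‖ = 1 := fun y x ↦ by
    rw [norm_exp]
    simp
  have h := (hasDerivAt_integral_of_dominated_loc_of_deriv_le (μ := volume) (x₀ := (0 : ℝ))
    (F := fun (r : ℝ) x ↦ g x * exp (-(I * (⟪y + r • v, x⟫ : ℝ))))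
    (F' := fun (r : ℝ) x ↦ -I * (⟪v, x⟫ : ℝ) * g x * exp (-(I * (⟪y + r • v, x⟫ : ℝ))))
    (bound := fun x ↦ ‖v‖ * (‖x‖ * ‖g x‖)) (s := univ) univ_mem
    (Eventually.of_forall fun r ↦ hm _) ?_ ?_ ?_ (hg'.const_mul _) ?_).2
  · simpa [fourierInt] using h
  · refine hg.norm.mono' (hm _) (Eventually.of_forall fun x ↦ ?_)
    rw [norm_mul, hn, mul_one]
  · exact ((Measurable.aestronglyMeasurable (by fun_prop)).mul hg.aestronglyMeasurable).mul
      (Measurable.aestronglyMeasurable (by fun_prop))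
  · refine Eventually.of_forall fun x r _ ↦ ?_
    rw [norm_mul, hn, mul_one, norm_mul, norm_mul, norm_neg, norm_I, one_mul, norm_real, ← mul_assoc]
    gcongr
    exact norm_inner_le_norm v x
  · refine Eventually.of_forall fun x r _ ↦ ?_
    have h1 : HasDerivAt (fun r : ℝ ↦ ⟪y + r • v, x⟫) ⟪v, x⟫ r := by
      simp_rw [inner_add_left, real_inner_smul_left]
      simpa using ((hasDerivAt_id r).mul_const ⟪v, x⟫).const_add ⟪y, x⟫
    have h2 := ((h1.ofReal_comp.const_mul (-I)).cexp).const_mul (g x)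
    simp only [← neg_mul] at h2 ⊢
    convert! h2 using 1
    ring

theorem hasDerivAt_polyGauss_line (b : ℝ) (P : MvPolynomial (Fin n) ℂ) (i : Fin n)
    (x : EuclideanSpace ℝ (Fin n)) :
    HasDerivAt (fun r : ℝ ↦ polyGauss b P (x + r • EuclideanSpace.single i 1))
      (polyGauss b (MvPolynomial.pderiv i P - MvPolynomial.C (2 * b : ℂ) * MvPolynomial.X i * P) x)
      0 := by
  have h1 : HasDerivAt (fun r : ℝ ↦ -b * ‖x + r • EuclideanSpace.single i (1 : ℝ)‖ ^ 2)
      (-b * (2 * x i)) 0 := by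
    have h2 : HasDerivAt (fun r : ℝ ↦ x + r • EuclideanSpace.single i (1 : ℝ))
        (EuclideanSpace.single i (1 : ℝ)) 0 := by
      simpa using ((hasDerivAt_id (0 : ℝ)).smul_const (EuclideanSpace.single i (1 : ℝ))).const_add x
    have h3 := h2.norm_sq.const_mul (-b)
    simpa [EuclideanSpace.inner_single_right] using h3
  have h4 := (hasDerivAt_polyValue_line P i x).mul h1.exp.ofReal_comp
  convert! h4 using 1
  simp [polyGauss, polyValue]
  ring

/-- The Fourier integral of a polynomial times a Gaussian is a polynomial of no larger degree times
a Gaussian. -/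
theorem exists_fourierInt_polyGauss (hb : 0 < b) (P : MvPolynomial (Fin n) ℂ) :
    ∃ P' : MvPolynomial (Fin n) ℂ, P'.totalDegree ≤ P.totalDegree ∧
      ∀ y, fourierInt (polyGauss b P) y = polyGauss (1 / (4 * b)) P' y := by
  have hmon : ∀ (s : Fin n →₀ ℕ) (c : ℂ), ∃ P' : MvPolynomial (Fin n) ℂ,
      P'.totalDegree ≤ (MvPolynomial.monomial s c).totalDegree ∧
      ∀ y, fourierInt (polyGauss b (MvPolynomial.monomial s c)) y =
        polyGauss (1 / (4 * b)) P' y := by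
    -- Multiplication by x_i becomes i∂_i on the Fourier side, which raises the degree of the factor
    -- before the Gaussian by at most one.
    refine MvPolynomial.induction_on_monomial (fun c ↦ ?_) (fun p i hp ↦ ?_)
    · refine ⟨MvPolynomial.C (c * (π / b : ℂ) ^ (n / 2 : ℂ)), by
        rw [MvPolynomial.totalDegree_C]; exact Nat.zero_le _, fun y ↦ ?_⟩
      have h := fourier_gaussian_innerProductSpace (V := EuclideanSpace ℝ (Fin n)) (b := (b : ℂ))
        (by simpa) ((2 * π)⁻¹ • y)
      rw [← fourierInt_eq_fourier, finrank_euclideanSpace_fin] at h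
      have h2 : fourierInt (polyGauss b (MvPolynomial.C c : MvPolynomial (Fin n) ℂ)) y =
          c * fourierInt (fun v : EuclideanSpace ℝ (Fin n) ↦ cexp (-b * ‖v‖ ^ 2)) y := by
        rw [fourierInt, fourierInt, ← integral_const_mul]
        congr 1
        ext x
        simp [polyGauss, polyValue]
        ring
      rw [h2, h, polyGauss, polyValue, MvPolynomial.eval_C, mul_assoc, ofReal_exp, norm_smul]
      congr 3
      have : (b : ℂ) ≠ 0 := ofReal_ne_zero.2 hb.ne'
      have : (π : ℂ) ≠ 0 := ofReal_ne_zero.2 Real.pi_ne_zero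
      rw [Real.norm_of_nonneg (by positivity)]
      push_cast
      field_simp
      ring
    · obtain ⟨P', hd, hP'⟩ := hp
      -- The degree of p·X_i exceeds that of p only if p ≠ 0.
      rcases eq_or_ne p 0 with rfl | hp0
      · exact ⟨0, by simp, fun y ↦ by simp [fourierInt, polyGauss, polyValue]⟩
      set b' := 1 / (4 * b) with hb'
      refine ⟨MvPolynomial.C I * (MvPolynomial.pderiv i P' -
        MvPolynomial.C (2 * b' : ℂ) * MvPolynomial.X i * P'), ?_, fun y ↦ ?_⟩
      · refine (MvPolynomial.totalDegree_mul _ _).trans ?_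
        rw [MvPolynomial.totalDegree_C, zero_add, MvPolynomial.totalDegree_mul_of_isDomain hp0
          (MvPolynomial.X_ne_zero i), MvPolynomial.totalDegree_X]
        refine (MvPolynomial.totalDegree_sub _ _).trans (max_le ?_ ?_)
        · exact (totalDegree_pderiv_le i P').trans (by omega)
        · refine (MvPolynomial.totalDegree_mul _ _).trans ?_
          have h1 := MvPolynomial.totalDegree_mul (MvPolynomial.C (2 * b' : ℂ))
            (MvPolynomial.X i : MvPolynomial (Fin n) ℂ)
          rw [MvPolynomial.totalDegree_C, MvPolynomial.totalDegree_X] at h1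
          omega
      · have h1 := hasDerivAt_fourierInt_line (integrable_polyGauss hb p)
          (integrable_norm_mul_polyGauss hb p) y (EuclideanSpace.single i 1)
        have h2 := hasDerivAt_polyGauss_line b' P' i y
        simp_rw [hP'] at h1
        have h3 := h1.unique h2
        have h4 : polyGauss b' (MvPolynomial.C I * (MvPolynomial.pderiv i P' -
            MvPolynomial.C (2 * b' : ℂ) * MvPolynomial.X i * P')) y =
            I * polyGauss b' (MvPolynomial.pderiv i P' -
            MvPolynomial.C (2 * b' : ℂ) * MvPolynomial.X i * P') y := by
          rw [polyGauss, polyGauss, polyValue, map_mul, MvPolynomial.eval_C, polyValue, mul_assoc]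
        rw [h4, ← h3, fourierInt, fourierInt, ← integral_const_mul]
        congr 1
        ext x
        simp only [polyGauss, polyValue, map_mul, MvPolynomial.eval_X,
          EuclideanSpace.inner_single_left, map_one, one_mul]
        linear_combination (MvPolynomial.eval (fun i ↦ (x i : ℂ)) p * x i *
          (Real.exp (-b * ‖x‖ ^ 2) : ℂ) * exp (-(I * (⟪y, x⟫ : ℝ)))) * I_mul_I
  choose R hRd hR using hmon
  refine ⟨∑ s ∈ P.support, R s (P.coeff s), MvPolynomial.totalDegree_finsetSum_le fun s hs ↦ ?_,
    fun y ↦ ?_⟩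
  · refine (hRd _ _).trans ((MvPolynomial.totalDegree_monomial_le _ _).trans ?_)
    exact MvPolynomial.le_totalDegree hs
  · have h1 : polyGauss (1 / (4 * b)) (∑ s ∈ P.support, R s (P.coeff s)) y =
        ∑ s ∈ P.support, polyGauss (1 / (4 * b)) (R s (P.coeff s)) y := by
      simp only [polyGauss, polyValue, map_sum, Finset.sum_mul]
    rw [h1]
    simp_rw [← hR, fourierInt]
    rw [← integral_finsetSum]
    · congr 1
      ext x
      conv_lhs => rw [P.as_sum]
      simp only [polyGauss, polyValue, map_sum, Finset.sum_mul]
    · intro s _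
      refine (integrable_polyGauss hb (MvPolynomial.monomial s (P.coeff s))).norm.mono'
        ((continuous_polyGauss _ _).aestronglyMeasurable.mul
          (Measurable.aestronglyMeasurable (by fun_prop))) (Eventually.of_forall fun x ↦ ?_)
      rw [norm_mul, norm_exp]
      simp

/-- A function whose transform is a polynomial times a Gaussian is itself of this form. -/
theorem exists_ae_eq_polyGauss {f : EuclideanSpace ℝ (Fin n) → ℂ} (hf : Integrable f)
    (hf2 : MemLp f 2 volume) {a : ℝ} (ha : 0 < a) {H : MvPolynomial (Fin n) ℂ}
    (hH : ∀ y, fourierInt f y = polyGauss a H y) :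
    ∃ P : MvPolynomial (Fin n) ℂ, P.totalDegree ≤ H.totalDegree ∧
      f =ᵐ[volume] polyGauss (1 / (4 * a)) P := by
  obtain ⟨H', hH'd, hH'⟩ := exists_polyValue_smul H (2 * π)
  set a' := a * (2 * π) ^ 2 with ha'
  have ha'0 : 0 < a' := by positivity
  have hF : 𝓕 f = polyGauss a' H' := by
    ext w
    rw [fourier_eq_fourierInt, hH, polyGauss, polyGauss, hH', norm_smul,
      Real.norm_of_nonneg (by positivity), ha']
    ring_nf
  obtain ⟨P₀, hP₀d, hP₀⟩ := exists_fourierInt_polyGauss ha'0 H'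
  obtain ⟨P, hPd, hP⟩ := exists_polyValue_smul P₀ (-(2 * π))
  have hinv : 𝓕⁻ (polyGauss a' H') = polyGauss (1 / (4 * a)) P := by
    ext x
    rw [Real.fourierInv_eq_fourier_neg, fourier_eq_fourierInt, hP₀, polyGauss, polyGauss, hP,
      smul_neg, ← neg_smul, norm_smul, norm_neg, Real.norm_of_nonneg (by positivity), ha']
    congr 3
    field_simp
  refine ⟨P, hPd.trans (hP₀d.trans hH'd), ?_⟩
  have ha4 : 0 < 1 / (4 * a) := by positivity
  -- Inversion is applied to the explicit function 𝓕 f, which is integrable with integrable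
  -- transform; injectivity of the L² transform then identifies f.
  refine ae_eq_of_l2Fourier_ae_eq hf2 (memLp_polyGauss ha4 P) ?_
  filter_upwards [l2Fourier_ae_eq hf2 hf,
    l2Fourier_ae_eq (memLp_polyGauss ha4 P) (integrable_polyGauss ha4 P)] with y h1 h2
  rw [h1, h2, fourierInt_eq_fourier, fourierInt_eq_fourier, hF, ← hinv]
  refine (congrFun (Continuous.fourier_fourierInv_eq (continuous_polyGauss a' H')
    (integrable_polyGauss ha'0 H') ?_) _).symm
  obtain ⟨P₁, -, hP₁⟩ := exists_polyValue_smul P₀ (2 * π)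
  refine (integrable_polyGauss ha4 P₁).congr (Eventually.of_forall fun x ↦ ?_)
  rw [fourier_eq_fourierInt, hP₀, polyGauss, polyGauss, hP₁, norm_smul,
    Real.norm_of_nonneg (by positivity), ha']
  congr 3
  field_simp

end Gaussian

/-! ### The sharp degree bound and the conclusion -/

section DegreeBound

variable {n : ℕ}

/-- The exponent d may have either sign: the upper bound on u serves d ≥ 0 and the lower bound
serves d ≤ 0. -/
theorem rpow_mul_rpow_le_max {s u c C d : ℝ} (hs : 0 < s) (hc : 0 < c) (h1 : c * s ≤ u)
    (h2 : u ≤ C * s) : u ^ d ≤ max (C ^ d) (c ^ d) * s ^ d := by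
  have hu : 0 < u := (mul_pos hc hs).trans_le h1
  have hC : 0 < C := pos_of_mul_pos_left (hu.trans_le h2) hs.le
  have hsd : 0 < s ^ d := Real.rpow_pos_of_pos hs d
  rcases le_total 0 d with hd | hd
  · calc u ^ d ≤ (C * s) ^ d := Real.rpow_le_rpow hu.le h2 hd
      _ = C ^ d * s ^ d := Real.mul_rpow hC.le hs.le
      _ ≤ _ := by gcongr; exact le_max_left _ _
  · calc u ^ d ≤ (c * s) ^ d := Real.rpow_le_rpow_of_nonpos (mul_pos hc hs) h1 hd
      _ = c ^ d * s ^ d := Real.mul_rpow hc.le hs.le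
      _ ≤ _ := by gcongr; exact le_max_right _ _

/-- The total exponent is -(‖x‖ - 2a‖y‖)²/(4a), which stays bounded within unit distance of x = 2ay.
-/
theorem exp_le_exp_mul_gaussians {a : ℝ} (ha : 0 < a) {x y : EuclideanSpace ℝ (Fin n)}
    (h : ‖x - (2 * a) • y‖ ≤ 1) :
    Real.exp (-(1 / (4 * a))) ≤ Real.exp (-(1 / (4 * a)) * ‖x‖ ^ 2) * Real.exp (-a * ‖y‖ ^ 2) *
      Real.exp (‖x‖ * ‖y‖) := by
  have h1 : |‖x‖ - 2 * a * ‖y‖| ≤ 1 := by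
    have := (abs_norm_sub_norm_le x ((2 * a) • y)).trans h
    rwa [norm_smul, Real.norm_of_nonneg (by positivity)] at this
  have h2 : (‖x‖ - 2 * a * ‖y‖) ^ 2 ≤ 1 := by
    rw [← sq_abs]
    exact pow_le_one₀ (abs_nonneg _) h1
  rw [← Real.exp_add, ← Real.exp_add]
  gcongr
  have h3 : -(1 / (4 * a)) * ‖x‖ ^ 2 + -a * ‖y‖ ^ 2 + ‖x‖ * ‖y‖ =
      -(1 / (4 * a)) * (‖x‖ - 2 * a * ‖y‖) ^ 2 := by
    field_simp
    ring
  rw [h3, neg_mul, neg_le_neg_iff]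
  exact mul_le_of_le_one_right (by positivity) h2

set_option maxHeartbeats 400000 in
/-- The integrand is bounded below by a power of `s` on a region of size `s ^ n`. -/
theorem exists_le_density [NeZero n] {P H Q : MvPolynomial (Fin n) ℂ} (hP : P ≠ 0) (hH : H ≠ 0)
    (hQ : Q ≠ 0) {a : ℝ} (ha : 0 < a) (d : ℝ) {δ : ℝ} (hδ : 0 < δ) :
    ∃ (θ : EuclideanSpace ℝ (Fin n)) (κ ρ S : ℝ), 0 < κ ∧ 0 < ρ ∧ 2 * ρ < ‖θ‖ ∧ 1 ≤ S ∧
      ∀ s, S ≤ s → ∀ y ∈ ball (s • θ) (s * ρ), ∀ x ∈ ball ((2 * a) • y) 1,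
        ENNReal.ofReal (κ * s ^ (P.totalDegree + H.totalDegree + Q.totalDegree * δ - d)) ≤
          density (polyGauss (1 / (4 * a)) P) (polyGauss a H) Q d δ x y := by
  -- A direction in which none of the three leading forms vanishes, so that P, H and Q all grow at
  -- full speed near it.
  obtain ⟨θ, ⟨⟨hθP, hθH⟩, hθQ⟩, hθ⟩ := (((ae_polyValue_ne_zero
    (homogeneousComponent_totalDegree_ne_zero hP)).and (ae_polyValue_ne_zero
    (homogeneousComponent_totalDegree_ne_zero hH))).and (ae_polyValue_ne_zero
    (homogeneousComponent_totalDegree_ne_zero hQ))).and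
    (compl_mem_ae_iff.2 (measure_singleton (0 : EuclideanSpace ℝ (Fin n)))) |>.exists
  have hθ0 : 0 < ‖θ‖ := norm_pos_iff.2 hθ
  have hθP' : polyValue (MvPolynomial.homogeneousComponent P.totalDegree P) ((2 * a) • θ) ≠ 0 := by
    rw [polyValue_smul_of_isHomogeneous (MvPolynomial.homogeneousComponent_isHomogeneous _ P)]
    exact mul_ne_zero (pow_ne_zero _ (ofReal_ne_zero.2 (by positivity))) hθP
  obtain ⟨c₁, ρ₁, S₁, hc₁, hρ₁, hS₁, h₁⟩ := exists_le_norm_polyValue_smul P hθP'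
  obtain ⟨c₂, ρ₂, S₂, hc₂, hρ₂, hS₂, h₂⟩ := exists_le_norm_polyValue_smul H hθH
  obtain ⟨c₃, ρ₃, S₃, hc₃, hρ₃, hS₃, h₃⟩ := exists_le_norm_polyValue_smul Q hθQ
  -- The bound ρ₁/(4a) gives half of ρ₁ to 2a(y/s - θ), leaving the other half for (x - 2ay)/s;
  -- ‖θ‖/2 keeps y away from the origin.
  obtain ⟨ρ, hρ0, hρ⟩ : ∃ ρ > 0, ρ < min (min (ρ₁ / (4 * a)) ρ₂) (min ρ₃ (‖θ‖ / 2)) :=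
    exists_between (lt_min (lt_min (by positivity) hρ₂) (lt_min hρ₃ (by positivity)))
  obtain ⟨⟨hρ1, hρ2⟩, hρ3, hρ4⟩ := by simpa only [lt_min_iff] using hρ
  set p := P.totalDegree
  set q := H.totalDegree
  set m := Q.totalDegree
  set M := max ((1 + (2 * a + 1) * (2 * ‖θ‖) + 1) ^ d) ((‖θ‖ / 2) ^ d) with hM
  have hM0 : 0 < M := lt_max_of_lt_right (Real.rpow_pos_of_pos (by positivity) _)
  have hcδ : 0 < c₃ ^ δ := Real.rpow_pos_of_pos hc₃ _
  refine ⟨θ, c₁ * c₂ * c₃ ^ δ * Real.exp (-(1 / (4 * a))) / M, ρ,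
    max (max S₁ S₂) (max S₃ (max 1 (2 / ρ₁))), by positivity, hρ0, by linarith,
    (le_max_left _ _).trans ((le_max_right _ _).trans (le_max_right _ _)), fun s hs y hy x hx ↦ ?_⟩
  simp only [max_le_iff] at hs
  obtain ⟨⟨hs1, hs2⟩, hs3, hs4, hs5⟩ := hs
  have hs0 : 0 < s := by linarith
  have hsabs : |s| = s := abs_of_pos hs0
  rw [mem_ball, dist_eq_norm] at hy hx
  set w := s⁻¹ • y with hw
  have hsw : s • w = y := by rw [hw, smul_smul, mul_inv_cancel₀ hs0.ne', one_smul]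
  set z := s⁻¹ • x with hz
  have hsz : s • z = x := by rw [hz, smul_smul, mul_inv_cancel₀ hs0.ne', one_smul]
  have hwθ : ‖w - θ‖ < ρ := by
    rw [← hsw, ← smul_sub, norm_smul, Real.norm_of_nonneg hs0.le] at hy
    exact lt_of_mul_lt_mul_left hy hs0.le
  have hzθ : ‖z - (2 * a) • θ‖ < ρ₁ := by
    have e1 : ‖z - (2 * a) • w‖ < ρ₁ / 2 := by
      nth_rewrite 1 [← hsw] at hx
      nth_rewrite 1 [← hsz] at hx
      rw [smul_comm (2 * a) s w, ← smul_sub, norm_smul, Real.norm_of_nonneg hs0.le] at hx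
      have : 1 ≤ s * (ρ₁ / 2) := by
        rw [div_le_iff₀ hρ₁] at hs5
        linarith
      exact lt_of_mul_lt_mul_left (hx.trans_le this) hs0.le
    have e2 : ‖(2 * a) • w - (2 * a) • θ‖ < ρ₁ / 2 := by
      rw [← smul_sub, norm_smul, Real.norm_of_nonneg (by positivity)]
      rw [lt_div_iff₀ (by positivity)] at hρ1
      have : 2 * a * ‖w - θ‖ ≤ 2 * a * ρ := by gcongr
      linarith
    calc _ ≤ _ := norm_sub_le_norm_sub_add_norm_sub z ((2 * a) • w) ((2 * a) • θ)
      _ < _ := by linarith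
  have hPx : c₁ * s ^ p ≤ ‖polyValue P x‖ := by
    have := h₁ s (by rwa [hsabs]) z (by rwa [mem_ball, dist_eq_norm])
    rwa [hsz, hsabs] at this
  have hHy : c₂ * s ^ q ≤ ‖polyValue H y‖ := by
    have := h₂ s (by rwa [hsabs]) w (by rw [mem_ball, dist_eq_norm]; linarith)
    rwa [hsw, hsabs] at this
  have hQy : c₃ ^ δ * s ^ (m * δ) ≤ ‖polyValue Q y‖ ^ δ := by
    have := h₃ s (by rwa [hsabs]) w (by rw [mem_ball, dist_eq_norm]; linarith)
    rw [hsw, hsabs] at this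
    rw [Real.rpow_mul hs0.le, Real.rpow_natCast, ← Real.mul_rpow hc₃.le (by positivity)]
    exact Real.rpow_le_rpow (by positivity) this hδ.le
  have hysub : |‖y‖ - s * ‖θ‖| < s * ρ := by
    have := (abs_norm_sub_norm_le y (s • θ)).trans_lt hy
    rwa [norm_smul, Real.norm_of_nonneg hs0.le] at this
  obtain ⟨hy1, hy2⟩ := abs_lt.1 hysub
  have hsρ : s * ρ ≤ s * (‖θ‖ / 2) := by gcongr
  have hsθ : 0 < s * ‖θ‖ := by positivity
  have hylow : ‖θ‖ / 2 * s ≤ ‖y‖ := by linarith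
  have hyup : ‖y‖ ≤ 2 * ‖θ‖ * s := by linarith
  have hxup : ‖x‖ ≤ 2 * a * ‖y‖ + 1 := by
    have := (norm_sub_norm_le x ((2 * a) • y)).trans hx.le
    rw [norm_smul, Real.norm_of_nonneg (by positivity)] at this
    linarith
  have hden : (1 + ‖x‖ + ‖y‖) ^ d ≤ M * s ^ d := by
    refine rpow_mul_rpow_le_max hs0 (by positivity) ?_ ?_
    · linarith [norm_nonneg x]
    · have : (2 * a + 1) * ‖y‖ ≤ (2 * a + 1) * (2 * ‖θ‖ * s) := by gcongr
      linarith
  have hpos : 0 < (1 + ‖x‖ + ‖y‖) ^ d := Real.rpow_pos_of_pos (by positivity) _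
  have hexp := exp_le_exp_mul_gaussians ha hx.le
  have hsplit : s ^ (p + q + m * δ - d) = s ^ p * s ^ q * s ^ (m * δ) / s ^ d := by
    rw [Real.rpow_sub hs0, Real.rpow_add hs0, Real.rpow_add hs0, Real.rpow_natCast,
      Real.rpow_natCast]
  rw [density, hsplit, norm_polyGauss, norm_polyGauss]
  refine ENNReal.ofReal_le_ofReal ?_
  calc c₁ * c₂ * c₃ ^ δ * Real.exp (-(1 / (4 * a))) / M *
        (s ^ p * s ^ q * s ^ (m * δ) / s ^ d)
      = c₁ * s ^ p * (c₂ * s ^ q) * Real.exp (-(1 / (4 * a))) * (c₃ ^ δ * s ^ (m * δ)) /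
        (M * s ^ d) := by ring
    _ ≤ ‖polyValue P x‖ * ‖polyValue H y‖ * (Real.exp (-(1 / (4 * a)) * ‖x‖ ^ 2) *
        Real.exp (-a * ‖y‖ ^ 2) * Real.exp (‖x‖ * ‖y‖)) * ‖polyValue Q y‖ ^ δ /
        (1 + ‖x‖ + ‖y‖) ^ d := by
        have hsp : 0 ≤ c₁ * s ^ p := by positivity
        have hsq : 0 ≤ c₂ * s ^ q := by positivity
        have hsm : 0 ≤ c₃ ^ δ * s ^ (m * δ) := by positivity
        refine div_le_div₀ (by positivity) ?_ hpos hden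
        exact mul_le_mul (mul_le_mul (mul_le_mul hPx hHy hsq (norm_nonneg _)) hexp
          (Real.exp_pos _).le (by positivity)) hQy hsm (by positivity)
    _ = _ := by ring

/-- The sharp degree bound. -/
theorem totalDegree_lt_of_lintegral_density_lt_top [NeZero n] {P H Q : MvPolynomial (Fin n) ℂ}
    (hP : P ≠ 0) (hH : H ≠ 0) (hQ : Q ≠ 0) (hPH : P.totalDegree ≤ H.totalDegree) {a : ℝ}
    (ha : 0 < a) {d δ : ℝ} (hδ : 0 < δ)
    (hfin : ∫⁻ x, ∫⁻ y, density (polyGauss (1 / (4 * a)) P) (polyGauss a H) Q d δ x y < ⊤) :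
    (P.totalDegree : ℝ) < (d - n - Q.totalDegree * δ) / 2 := by
  obtain ⟨θ, κ, ρ, S, hκ, hρ, hρθ, hS, hlow⟩ := exists_le_density hP hH hQ ha d hδ
  set p := P.totalDegree
  set q := H.totalDegree
  set m := Q.totalDegree
  -- Since p ≤ q, this inequality contains the bound on 2p.
  suffices hlt : (n : ℝ) + (p + q + m * δ - d) < 0 by
    have : (p : ℝ) ≤ q := by exact_mod_cast hPH
    linarith
  by_contra! hE
  have hθ0 : 0 < ‖θ‖ := by linarith
  have hmeas := measurable_density (Q := Q) (d := d) (δ := δ)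
    (continuous_polyGauss (1 / (4 * a)) P).measurable (continuous_polyGauss a H).measurable
  set G : EuclideanSpace ℝ (Fin n) → ℝ≥0∞ := fun y ↦
    ∫⁻ x, density (polyGauss (1 / (4 * a)) P) (polyGauss a H) Q d δ x y with hG
  have hGfin : ∫⁻ y, G y < ⊤ := by
    rwa [hG, ← lintegral_lintegral_swap hmeas.aemeasurable]
  set ν := (volume : Measure (EuclideanSpace ℝ (Fin n))).withDensity G with hν
  have hνfin : IsFiniteMeasure ν := isFiniteMeasure_withDensity hGfin.ne
  -- The tails T k have measure tending to 0, yet T k contains a ball of radius kρ whose mass is at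
  -- least a constant times k to a nonnegative power. Exponent 0 is thereby excluded too.
  set T : ℕ → Set (EuclideanSpace ℝ (Fin n)) := fun k ↦ {y | k * (‖θ‖ / 2) ≤ ‖y‖} with hT
  have hTm : ∀ k, MeasurableSet (T k) := fun k ↦
    measurableSet_le measurable_const measurable_norm
  have hTanti : Antitone T := fun i j hij y hy ↦ by
    have : (i : ℝ) ≤ j := by exact_mod_cast hij
    exact le_trans (by gcongr) (show (j : ℝ) * (‖θ‖ / 2) ≤ ‖y‖ from hy)
  have hTinter : ⋂ k, T k = ∅ := by
    refine eq_empty_iff_forall_notMem.2 fun y hy ↦ ?_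
    obtain ⟨k, hk⟩ := exists_nat_gt (‖y‖ / (‖θ‖ / 2))
    rw [div_lt_iff₀ (by positivity)] at hk
    exact absurd (mem_iInter.1 hy k) (not_le.2 hk)
  have hlim : Tendsto (fun k ↦ ν (T k)) atTop (𝓝 0) := by
    have := tendsto_measure_iInter_atTop (μ := ν) (fun k ↦ (hTm k).nullMeasurableSet) hTanti
      ⟨0, measure_ne_top _ _⟩
    rwa [hTinter, measure_empty] at this
  set V := volume (ball (0 : EuclideanSpace ℝ (Fin n)) 1) with hV
  have hV0 : 0 < V := measure_ball_pos _ _ one_pos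
  have hbound : ∀ᶠ k : ℕ in atTop, ENNReal.ofReal (κ * ρ ^ n) * V * V ≤ ν (T k) := by
    filter_upwards [tendsto_natCast_atTop_atTop.eventually_ge_atTop S] with k hk
    have hk1 : (1 : ℝ) ≤ k := hS.trans hk
    have hk0 : (0 : ℝ) < k := by linarith
    have hsub : ball ((k : ℝ) • θ) (k * ρ) ⊆ T k := fun y hy ↦ by
      rw [mem_ball, dist_eq_norm] at hy
      have h1 := (abs_norm_sub_norm_le y ((k : ℝ) • θ)).trans_lt hy
      rw [norm_smul, Real.norm_of_nonneg hk0.le] at h1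
      have h2 := (abs_lt.1 h1).1
      show (k : ℝ) * (‖θ‖ / 2) ≤ ‖y‖
      nlinarith
    refine le_trans ?_ (measure_mono hsub)
    set L := ENNReal.ofReal (κ * (k : ℝ) ^ (p + q + m * δ - d)) with hL
    have hGlow : ∀ y ∈ ball ((k : ℝ) • θ) (k * ρ), L * V ≤ G y := fun y hy ↦ by
      rw [hV, ← Measure.addHaar_ball_center volume ((2 * a) • y) 1, ← setLIntegral_const]
      exact (setLIntegral_mono' measurableSet_ball fun x hx ↦ hlow k hk y hy x hx).trans
        (setLIntegral_le_lintegral _ _)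
    calc ENNReal.ofReal (κ * ρ ^ n) * V * V
        ≤ ENNReal.ofReal (κ * (k : ℝ) ^ (p + q + m * δ - d) * (k * ρ) ^ n) * V * V := by
          gcongr ENNReal.ofReal ?_ * V * V
          have h1 : (1 : ℝ) ≤ (k : ℝ) ^ ((n : ℝ) + (p + q + m * δ - d)) :=
            Real.one_le_rpow hk1 hE
          rw [Real.rpow_add hk0, Real.rpow_natCast] at h1
          calc κ * ρ ^ n ≤ κ * ρ ^ n * ((k : ℝ) ^ n * (k : ℝ) ^ (p + q + m * δ - d)) :=
                le_mul_of_one_le_right (by positivity) h1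
            _ = _ := by rw [mul_pow]; ring
      _ = L * V * (ENNReal.ofReal ((k * ρ) ^ n) * V) := by
          rw [ENNReal.ofReal_mul (by positivity), hL]
          ring
      _ = L * V * volume (ball ((k : ℝ) • θ) (k * ρ)) := by
          rw [Measure.addHaar_ball volume _ (by positivity), finrank_euclideanSpace_fin]
      _ = ∫⁻ y in ball ((k : ℝ) • θ) (k * ρ), L * V := by rw [setLIntegral_const]
      _ ≤ ∫⁻ y in ball ((k : ℝ) • θ) (k * ρ), G y :=
          setLIntegral_mono' measurableSet_ball hGlow
      _ = _ := (withDensity_apply _ measurableSet_ball).symm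
  have hpos : 0 < ENNReal.ofReal (κ * ρ ^ n) * V * V :=
    ENNReal.mul_pos (ENNReal.mul_pos (ENNReal.ofReal_pos.2 (by positivity)).ne' hV0.ne').ne' hV0.ne'
  obtain ⟨k, hk1, hk2⟩ := (hbound.and (hlim.eventually_lt_const hpos)).exists
  exact hk2.not_ge hk1

/-- The measurable, nonzero case of the theorem. -/
theorem exists_ae_eq_polyGauss_of_measurable [NeZero n] {f : EuclideanSpace ℝ (Fin n) → ℂ}
    (hf : Measurable f) (hf2 : MemLp f 2 volume) {d δ : ℝ} (hδ : 0 < δ)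
    {Q : MvPolynomial (Fin n) ℂ} (hQ : Q ≠ 0) (hne : ¬ f =ᵐ[volume] 0)
    (hfin : ∫⁻ x, ∫⁻ y, density f (l2Fourier f hf2) Q d δ x y < ⊤) :
    ∃ (a : ℝ) (P : MvPolynomial (Fin n) ℂ), 0 < a ∧
      (P.totalDegree : ℝ) < (d - n - Q.totalDegree * δ) / 2 ∧ f =ᵐ[volume] polyGauss a P := by
  have hfm := hf.aestronglyMeasurable (μ := (volume : Measure (EuclideanSpace ℝ (Fin n))))
  obtain ⟨hexp, hFne⟩ := exponential_moments hf hf2 hQ hfin hne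
  have hfi := integrable_of_integrable_mul_exp hfm zero_le_one (hexp 1)
  have hfin' : ∫⁻ x, ∫⁻ y, density f (fourierInt f) Q d δ x y < ⊤ := by
    refine lt_of_eq_of_lt (lintegral_congr fun x ↦ lintegral_congr_ae ?_) hfin
    filter_upwards [l2Fourier_ae_eq hf2 hfi] with y hy
    rw [density, density, hy]
  obtain ⟨a, H, ha, hH⟩ := exists_fourierInt_eq_polyValue_mul hf hexp hFne
    (ae_doubleIntegral_line_lt_top hf hQ hδ hexp hfin')
  obtain ⟨P, hPd, hP⟩ := exists_ae_eq_polyGauss hfi hf2 ha hH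
  have hP0 : P ≠ 0 := by
    rintro rfl
    refine hne (hP.trans (Eventually.of_forall fun x ↦ ?_))
    simp [polyGauss, polyValue]
  have hH0 : H ≠ 0 := by
    rintro rfl
    obtain ⟨y, hy⟩ := hFne.exists
    exact hy (by simp [hH, polyValue])
  refine ⟨1 / (4 * a), P, by positivity, ?_, hP⟩
  refine totalDegree_lt_of_lintegral_density_lt_top hP0 hH0 hQ hPd ha hδ
    (lt_of_eq_of_lt (lintegral_congr_ae ?_) hfin')
  filter_upwards [hP] with x hx
  refine lintegral_congr fun y ↦ ?_
  rw [density, density, hx, hH]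
  rfl

end DegreeBound

end Beurling

theorem theorem2p3 (n : ℕ) (hn : 1 ≤ n)
    (f : EuclideanSpace ℝ (Fin n) → ℂ) (hf : MemLp f 2 volume)
    (d δ : ℝ) (hδ : 0 < δ) (m : ℕ)
    (Q : MvPolynomial (Fin n) ℂ) (hQ : Q ≠ 0) (hm : Q.totalDegree = m)
    (hfin : (∫⁻ x : EuclideanSpace ℝ (Fin n), ∫⁻ y : EuclideanSpace ℝ (Fin n),
      ENNReal.ofReal
        (‖f x‖ * ‖l2Fourier f hf y‖ * Real.exp (‖x‖ * ‖y‖) * ‖polyValue Q y‖ ^ δ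
          / (1 + ‖x‖ + ‖y‖) ^ d)) < ⊤) :
    ∃ (a : ℝ) (P : MvPolynomial (Fin n) ℂ), 0 < a ∧
      (P = 0 ∨ (P.totalDegree : ℝ) < (d - n - m * δ) / 2) ∧
      f =ᵐ[volume] fun x => polyValue P x * (Real.exp (-a * ‖x‖ ^ 2) : ℂ) := by
  have : NeZero n := ⟨by omega⟩
  by_cases hne : f =ᵐ[volume] 0
  -- The zero polynomial has `totalDegree` 0 and not -∞, so f = 0 falls under the first alternative.
  · refine ⟨1, 0, one_pos, Or.inl rfl, hne.trans (Filter.Eventually.of_forall fun x ↦ ?_)⟩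
    simp [polyValue]
  -- Passing to a measurable representative changes neither the L² class nor, therefore, the chosen
  -- transform.
  set g := hf.1.mk f with hg
  have hfg : f =ᵐ[volume] g := hf.1.ae_eq_mk
  have hg2 : MemLp g 2 volume := hf.ae_eq hfg
  obtain ⟨a, P, ha, hP, hgP⟩ := Beurling.exists_ae_eq_polyGauss_of_measurable
    hf.1.stronglyMeasurable_mk.measurable hg2 hδ hQ (fun h ↦ hne (hfg.trans h)) (d := d) (by
      refine lt_of_eq_of_lt (lintegral_congr_ae ?_) hfin
      filter_upwards [hfg] with x hx
      rw [hx, Beurling.l2Fourier_congr_ae hf hg2 hfg]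
      rfl)
  exact ⟨a, P, ha, Or.inr (hm ▸ hP), hfg.trans hgP⟩
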